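/- Let $\alpha<0$, $0<\beta<2\alpha^2/9$ and $V(q)=\frac{q^2}{2}+\frac{\alpha q^3}{3}+\frac{\beta q^4}{4}$, a double-well potential. Put $q_{\rm thres}=\frac{-\alpha-\sqrt{\alpha^2-4\beta}}{2\beta}$ and $E_{\max}=V(q_{\rm thres})$. Then $E_{\max}>0$, and for every $E\in(0,E_{\max})$ the following holds. **Roots.** $E-V(q)$ has four real roots $a>b>c>d$ (functions of $E$), with $d<0<c<q_{\rm thres}<b$, so that $E-V(q)=\frac{\beta}{4}(a-q)(b-q)(c-q)(q-d)$. Put $$k=\sqrt{\tfrac{(a-b)(c-d)}{(a-c)(b-d)}},\qquad k'=\sqrt{1-k^2},\qquad \gamma^2=\tfrac{d-c}{a-c}$$ ($\gamma^2$ is the name of a parameter). Then $0<k<1$ and $\gamma^2<0$. Let $\mathbf F(\varphi,k)$, $\mathbf K(k)$, $\mathbf E(k)$, $\mathbf\Pi(n,k)=\int_0^{\pi/2}\frac{dt}{(1-n\sin^2t)\sqrt{1-k^2\sin^2t}}$ be the elliptic integrals with modulus $k$, and $\operatorname{sn}$, $\operatorname{cn}$ the Jacobi elliptic functions. **Action.**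 Let $p(q,E)=\sqrt{2(E-V(q))}$ and let $I(E)=\frac1{2\pi}\oint_{\Gamma_E}p\,dq$, where $\Gamma_E$ is the closed component over $[d,c]$ of $\{p^2/2+V(q)=E\}$, traversed from $(d,0)$ first along $p\ge0$. Then $$\begin{aligned}I(E)=\tfrac1{48\pi}\sqrt{\tfrac{2\beta}{(a-c)(b-d)}}\Big[&(a-c)(b-d)\tfrac{16(\alpha^2-3\beta)}{3\beta^2}\mathbf E(k)\\&+(a-c)(a-d)\big(3a^2-6ab-b^2+4b(c+d)-3c^2+2cd-3d^2\big)\mathbf K(k)\\&+3(a-d)\big(-3a^3+\tfrac{16\alpha^2a}{9\beta^2}-\tfrac{4a(a\alpha+3)}{3\beta}-b^3+(c+d)(b^2-(c-d)^2)+b(c^2+d^2)\big)\mathbf\Pi(\gamma^2,k)\Big],\end{aligned}$$ $I$ is strictly increasing on $(0,E_{\max})$, and $\frac{dI}{dE}=\frac2\pi\sqrt{\frac{2}{\beta(a-c)(b-d)}}\,\mathbf K(k)$. Let $H_0$ denote the inverse function of $I$ on $(0,E_{\max})$. **Angle.** For $(q,p)\in\Gamma_E$ with $d<q<c$, the angle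 $\theta=\frac{\partial}{\partial I}\int_{(d,0)}^{(q,p)}p\,dx$ (integral along $\Gamma_E$ in the direction of motion, derivative at fixed $q$ on the branch of $p$) exists and equals $\pi\mathbf F(\phi,k)/\mathbf K(k)$ if $p>0$ and $2\pi-\pi\mathbf F(\phi,k)/\mathbf K(k)$ if $p<0$, where $\phi=\arcsin\sqrt{\frac{(a-c)(q-d)}{(c-d)(a-q)}}$. **Inverse transformation.** The function $$q(\theta,E)=a+\frac{d-a}{1-\gamma^2\operatorname{sn}^2\!\big(\frac{\mathbf K(k)}{\pi}\theta,k\big)}$$ is $2\pi$-periodic in $\theta$, with $q(0,E)=d$ and $q(\pi,E)=c$, and maps each of $[0,\pi]$ and $[\pi,2\pi]$ bijectively onto $[d,c]$. For $\theta\in(0,\pi)$ the point of $\Gamma_E$ over $q(\theta,E)$ with $p>0$ has angle $\theta$; for $\theta\in(\pi,2\pi)$ the one with $p<0$ has angle $\theta$. **Fourier expansion.** There is a unique $\nu\in(0,\mathbf K(k'))$ with $\operatorname{cn}(\nu,k')=\sqrt{\frac{c-d}{a-d}}$. Put $\omega=\frac{\pi(\mathbf K(k')-\nu)}{2\mathbf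 K(k)}$ and $\omega_0=\frac{\pi\mathbf K(k')}{2\mathbf K(k)}$. For every $\theta\in\mathbb R$, $$q(\theta,E)=a+\frac{(d-a)\mathbf\Pi(\gamma^2,k)}{\mathbf K(k)}-\frac{\pi\sqrt{(b-d)(a-c)}}{\mathbf K(k)}\sum_{n=1}^\infty\frac{\sinh(2n\omega)}{\sinh(2n\omega_0)}\cos(n\theta),$$ and the coefficient $q_1=\frac1{2\pi}\int_0^{2\pi}q(\theta,E)e^{-i\theta}d\theta$ is $$q_1=-G(E),\qquad G(E):=\frac{\pi\sqrt{(b-d)(a-c)}\,\sinh(2\omega)}{2\mathbf K(k)\sinh(2\omega_0)}.$$ **First integral.** $H_0(J)$ and $q_1(J):=q_1|_{E=H_0(J)}$ are differentiable on the range $I((0,E_{\max}))$. For real $F,\Omega$, the averaged $1:1$ slow flow is, by definition, $$\dot J=-\tfrac F2\big(q_1(J)e^{i\vartheta}+\bar q_1(J)e^{-i\vartheta}\big),\qquad \dot\vartheta=H_0'(J)-\tfrac{iF}2\big(q_1'(J)e^{i\vartheta}-\bar q_1'(J)e^{-i\vartheta}\big)-\Omega .$$ Let $J(\xi)$ be the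 closed form of $I(\xi)$ above, and $$C(\vartheta,\xi)=\xi-F\,G(\xi)\sin\vartheta-\Omega J(\xi),\qquad \xi\in(0,E_{\max}),\ \vartheta\in\mathbb R.$$ Then $$C(\vartheta,\xi)=\xi-\tfrac{iF}2\big(q_1(\xi)e^{i\vartheta}-\bar q_1(\xi)e^{-i\vartheta}\big)-\Omega I(\xi)=\frac1{2\pi}\int_0^{2\pi}\big(\xi-F\,q(\vartheta+\varphi,\xi)\sin\varphi\big)d\varphi-\Omega I(\xi),$$ and for every solution $(J(t),\vartheta(t))$ of the slow flow on an interval with $J(t)\in I((0,E_{\max}))$, the function $t\mapsto C(\vartheta(t),H_0(J(t)))$ is constant. -/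

import Mathlib

noncomputable section

namespace QuarticWell

open Real Set

/-! Elliptic integrals in terms of the modulus `k`, and the Jacobi elliptic functions of a real
argument (for `0 ≤ k < 1`). -/

/-- Incomplete elliptic integral of the first kind `F(φ, k)`. -/
def ellipticF (φ k : ℝ) : ℝ := ∫ t in (0 : ℝ)..φ, 1 / √(1 - k ^ 2 * sin t ^ 2)

/-- Complete elliptic integral of the first kind `K(k) = F(π/2, k)`. -/
def ellipticK (k : ℝ) : ℝ := ellipticF (π / 2) k

/-- Complete elliptic integral of the second kind `E(k)`. -/
def ellipticE (k : ℝ) : ℝ := ∫ t in (0 : ℝ)..(π / 2), √(1 - k ^ 2 * sin t ^ 2)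

/-- Complete elliptic integral of the third kind with parameter `n`. -/
def ellipticPi (n k : ℝ) : ℝ :=
  ∫ t in (0 : ℝ)..(π / 2), 1 / ((1 - n * sin t ^ 2) * √(1 - k ^ 2 * sin t ^ 2))

/-- Jacobi amplitude: the inverse of the increasing bijection `φ ↦ F(φ, k)` of the real line. -/
def jacobiAm (u k : ℝ) : ℝ := Function.invFun (fun φ : ℝ => ellipticF φ k) u

/-- Jacobi elliptic sine. -/
def jacobiSn (u k : ℝ) : ℝ := sin (jacobiAm u k)

/-- Jacobi elliptic cosine. -/
def jacobiCn (u k : ℝ) : ℝ := cos (jacobiAm u k)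

/-- The `ν` in `(0, K(k))` with `cn(ν, k) = x`. -/
def arcCn (x k : ℝ) : ℝ :=
  Function.invFunOn (fun u : ℝ => jacobiCn u k) (Ioo 0 (ellipticK k)) x

/-! The quartic potential, its barrier, and the ordered roots of `E - V`. -/

/-- The potential `V(q) = q²/2 + α q³/3 + β q⁴/4`. -/
def V (α β q : ℝ) : ℝ := q ^ 2 / 2 + α * q ^ 3 / 3 + β * q ^ 4 / 4

/-- The unperturbed Hamiltonian `p²/2 + V(q)`. -/
def hamiltonian (α β q p : ℝ) : ℝ := p ^ 2 / 2 + V α β q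

/-- Position of the local maximum of `V`. -/
def qThres (α β : ℝ) : ℝ := (-α - √(α ^ 2 - 4 * β)) / (2 * β)

/-- Height of the barrier. -/
def EMax (α β : ℝ) : ℝ := V α β (qThres α β)

/-- The four real roots of `E - V(q)` in descending order (whenever there are four). -/
def roots (α β E : ℝ) : Fin 4 → ℝ :=
  Classical.epsilon fun r : Fin 4 → ℝ => StrictAnti r ∧ ∀ i, E - V α β (r i) = 0

def rootA (α β E : ℝ) : ℝ := roots α β E 0
def rootB (α β E : ℝ) : ℝ := roots α β E 1
def rootC (α β E : ℝ) : ℝ := roots α β E 2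
def rootD (α β E : ℝ) : ℝ := roots α β E 3

/-- The factor `(a - c)(b - d)`. -/
def crossProd (α β E : ℝ) : ℝ :=
  (rootA α β E - rootC α β E) * (rootB α β E - rootD α β E)

/-- The modulus `k`. -/
def modulus (α β E : ℝ) : ℝ :=
  √((rootA α β E - rootB α β E) * (rootC α β E - rootD α β E) / crossProd α β E)

/-- The complementary modulus `k'`. -/
def coModulus (α β E : ℝ) : ℝ := √(1 - modulus α β E ^ 2)

/-- The (negative) parameter written `γ²`. -/
def gammaSq (α β E : ℝ) : ℝ :=
  (rootD α β E - rootC α β E) / (rootA α β E - rootC α β E)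

/-! Action and angle variables of the shallow well around `q = 0`. -/

/-- The momentum `p(q, E) ≥ 0` on the upper branch of the level curve. -/
def momentum (α β E q : ℝ) : ℝ := √(2 * (E - V α β q))

/-- The action `(2π)⁻¹ ∮ p dq` over the closed component of the level curve that encircles the
origin: from `d` to `c` along `p ≥ 0`, then back from `c` to `d` along `p ≤ 0`. -/
def action (α β E : ℝ) : ℝ :=
  1 / (2 * π) *
    ((∫ q in (rootD α β E)..(rootC α β E), momentum α β E q) +
      ∫ q in (rootC α β E)..(rootD α β E), -momentum α β E q)

/-- The unperturbed Hamiltonian as a function of the action: the inverse of `E ↦ I(E)`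
on `(0, EMax)`. -/
def energyOfAction (α β : ℝ) : ℝ → ℝ :=
  Function.invFunOn (action α β) (Ioo 0 (EMax α β))

/-- `∫ p dx` along the level curve of energy `E`, from the turning point `(d, 0)` in the direction
of the motion up to the point over `q` that lies on the branch given by the sign of `p`. -/
def abbreviatedAction (α β q p E : ℝ) : ℝ :=
  if 0 ≤ p then ∫ x in (rootD α β E)..q, momentum α β E x
  else (∫ x in (rootD α β E)..(rootC α β E), momentum α β E x) +
    ∫ x in (rootC α β E)..q, -momentum α β E x

/-- `θ` is the angle variable of the phase point `(q, p)`: the derivative `∂/∂I ∫ p(x, I) dx`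
exists at fixed `q` (on the branch of `p`) and equals `θ`. -/
def IsAngle (α β q p θ : ℝ) : Prop :=
  HasDerivAt (fun J : ℝ => abbreviatedAction α β q p (energyOfAction α β J)) θ
    (action α β (hamiltonian α β q p))

/-- The closed form of the action. -/
def actionClosedForm (α β E : ℝ) : ℝ :=
  let a := rootA α β E
  let b := rootB α β E
  let c := rootC α β E
  let d := rootD α β E
  let k := modulus α β E
  1 / (48 * π) * √(2 * β / ((a - c) * (b - d))) *
    ((a - c) * (b - d) * (16 * (α ^ 2 - 3 * β) / (3 * β ^ 2)) * ellipticE k +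
      (a - c) * (a - d) *
        (3 * a ^ 2 - 6 * a * b - b ^ 2 + 4 * b * (c + d) - 3 * c ^ 2 + 2 * c * d - 3 * d ^ 2) *
          ellipticK k +
      3 * (a - d) *
        (-3 * a ^ 3 + 16 * α ^ 2 * a / (9 * β ^ 2) - 4 * a * (a * α + 3) / (3 * β) - b ^ 3 +
          (c + d) * (b ^ 2 - (c - d) ^ 2) + b * (c ^ 2 + d ^ 2)) *
          ellipticPi (gammaSq α β E) k)

/-- The amplitude `φ` with `sin² φ = (a - c)(q - d) / ((c - d)(a - q))`. -/
def amplitude (α β E q : ℝ) : ℝ :=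
  arcsin √((rootA α β E - rootC α β E) * (q - rootD α β E) /
    ((rootC α β E - rootD α β E) * (rootA α β E - q)))

/-- The position as a function of angle and energy. -/
def position (α β E θ : ℝ) : ℝ :=
  rootA α β E + (rootD α β E - rootA α β E) /
    (1 - gammaSq α β E *
      jacobiSn (ellipticK (modulus α β E) / π * θ) (modulus α β E) ^ 2)

/-! Fourier coefficients. -/

/-- The `m`-th Fourier coefficient of `θ ↦ q(θ, E)`, with `q = ∑ qₘ exp(i m θ)`. -/
def fourierQ (α β : ℝ) (m : ℤ) (E : ℝ) : ℂ :=
  1 / (2 * (π : ℂ)) *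
    ∫ θ in (0 : ℝ)..(2 * π), (position α β E θ : ℂ) * Complex.exp (-(Complex.I * m * θ))

/-- The number `ν`. -/
def nu (α β E : ℝ) : ℝ :=
  arcCn √((rootC α β E - rootD α β E) / (rootA α β E - rootD α β E)) (coModulus α β E)

def omega (α β E : ℝ) : ℝ :=
  π * (ellipticK (coModulus α β E) - nu α β E) / (2 * ellipticK (modulus α β E))

def omegaZero (α β E : ℝ) : ℝ :=
  π * ellipticK (coModulus α β E) / (2 * ellipticK (modulus α β E))

/-- The function `G`. -/
def G (α β ξ : ℝ) : ℝ :=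
  π * √((rootB α β ξ - rootD α β ξ) * (rootA α β ξ - rootC α β ξ)) * sinh (2 * omega α β ξ) /
    (2 * ellipticK (modulus α β ξ) * sinh (2 * omegaZero α β ξ))

/-! The averaged 1:1 slow flow and its first integral. -/

/-- The first Fourier coefficient as a function of the action. -/
def firstCoeffOfAction (α β J : ℝ) : ℂ := fourierQ α β 1 (energyOfAction α β J)

/-- `(J, ϑ)` solves the slow-flow equations with forcing amplitude `F` and frequency `Ω` on the
time set `T`, with the averaged action `J` staying in the range of actions of the well. -/
def IsSlowFlowSolution (α β F Ω : ℝ) (T : Set ℝ) (J ϑ : ℝ → ℝ) : Prop :=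
  ∀ t ∈ T, J t ∈ action α β '' Ioo 0 (EMax α β) ∧
    ∃ J₁ ϑ₁ : ℝ, HasDerivWithinAt J J₁ T t ∧ HasDerivWithinAt ϑ ϑ₁ T t ∧
      (J₁ : ℂ) = -((F : ℂ) / 2) *
        (firstCoeffOfAction α β (J t) * Complex.exp (Complex.I * ϑ t) +
          star (firstCoeffOfAction α β (J t)) * Complex.exp (-(Complex.I * ϑ t))) ∧
      (ϑ₁ : ℂ) = ((deriv (energyOfAction α β) (J t) : ℝ) : ℂ) - Complex.I * F / 2 *
        (deriv (firstCoeffOfAction α β) (J t) * Complex.exp (Complex.I * ϑ t) -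
          star (deriv (firstCoeffOfAction α β) (J t)) * Complex.exp (-(Complex.I * ϑ t))) - Ω

/-- The function `C(ϑ, ξ) = ξ - F G(ξ) sin ϑ - Ω J(ξ)`. -/
def firstIntegral (α β F Ω ϑ ξ : ℝ) : ℝ :=
  ξ - F * G α β ξ * sin ϑ - Ω * actionClosedForm α β ξ

end QuarticWell

end

open QuarticWell

namespace QuarticWell

open Real Set Filter Topology MeasureTheory

/-! ### Elliptic integrals as functions of the amplitude -/

section EllipticIntegrals

variable {k : ℝ}

/-! Everything rests on the substitution `x = a + (d - a) / (1 - n sin² φ)` with `n = γ²`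
(`wellPoint`). It carries `[0, π/2]` onto the well `[d, c]` and turns each factor of the quartic `E
- V` into a constant times `1`, `1 - k² sin² φ`, `cos² φ` or `sin² φ` over the common denominator `1
- n sin² φ` (`sub_wellPoint`). Hence `dx / p` becomes a constant times the integrand of `F(φ, k)`.

Action: after substitution, `p dx` minus a combination of the integrands of `E`, `K` and `Π` is an
exact derivative that vanishes at both ends (`hasDerivAt_reduction`). Vieta's relations bring the
coefficients into the stated form.

Frequency and angle: the energy derivative of `∫ p dx` is `∫ dx / p`. To avoid dominating
singularities that move with the energy, `√(2(E - V))` is written as an integral over the energy,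
Fubini is applied, and the fundamental theorem of calculus is used in `E`
(`hasDerivAt_integral_sqrt`). Since `√` vanishes on negative numbers, the moving turning points can
be replaced by fixed endpoints. Dividing by `dI/dE` gives `θ = π F / K`, whose inversion is the
formula with `sn²`.

Fourier coefficients: `1 / sn` is extended to complex arguments by the imaginary-argument addition
formula, and the Cauchy-Riemann equations are checked. In the strip `0 < Im z ≤ K'`, `|Re z| ≤ K`,
the position has a single pole, at `iν`, and it is again real and even on the line `Im z = K'`.
Moving the contour from the real axis to that line relates the `m`-th modes on the two lines, with a
residue term (`integral_wellPoint_sub`). The modes on both lines are even in `m`, so the relations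
for `m` and `-m` form a linear system with two unknowns, and its solution is the quotient of
hyperbolic sines.

First integral: `q₁ = -G` is real, so the slow flow is Hamiltonian in `(J, ϑ)` with Hamiltonian
`C(ϑ, H₀(J))`, which is therefore conserved. The differentiability of `G` and `H₀` comes from that
of the roots (inverse function theorem) and of elliptic integrals in both arguments. -/

lemma one_sub_sq_mul_sin_sq_pos (hk : k ^ 2 < 1) (t : ℝ) : 0 < 1 - k ^ 2 * sin t ^ 2 := by
  nlinarith [sin_sq_le_one t, sq_nonneg k, sq_nonneg (sin t)]

lemma continuous_ellipticF_integrand (hk : k ^ 2 < 1) :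
    Continuous fun t : ℝ => 1 / √(1 - k ^ 2 * sin t ^ 2) := by
  refine Continuous.div (by fun_prop) (by fun_prop) fun t => ?_
  exact (Real.sqrt_pos.2 (one_sub_sq_mul_sin_sq_pos hk t)).ne'

lemma hasDerivAt_ellipticF (hk : k ^ 2 < 1) (φ : ℝ) :
    HasDerivAt (fun φ => ellipticF φ k) (1 / √(1 - k ^ 2 * sin φ ^ 2)) φ :=
  intervalIntegral.integral_hasDerivAt_right
    ((continuous_ellipticF_integrand hk).intervalIntegrable _ _)
    (continuous_ellipticF_integrand hk).stronglyMeasurable.stronglyMeasurableAtFilter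
    (continuous_ellipticF_integrand hk).continuousAt

lemma ellipticF_zero (k : ℝ) : ellipticF 0 k = 0 := by simp [ellipticF]

lemma ellipticF_neg (φ k : ℝ) : ellipticF (-φ) k = -ellipticF φ k := by
  unfold ellipticF
  have h := intervalIntegral.integral_comp_neg (a := 0) (b := φ)
    (fun t : ℝ => 1 / √(1 - k ^ 2 * sin t ^ 2))
  simp only [sin_neg, neg_sq, neg_zero] at h
  rw [h, intervalIntegral.integral_symm]

lemma strictMono_ellipticF (hk : k ^ 2 < 1) : StrictMono fun φ => ellipticF φ k :=
  strictMono_of_hasDerivAt_pos (fun φ => hasDerivAt_ellipticF hk φ)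
    fun φ => one_div_pos.2 (Real.sqrt_pos.2 (one_sub_sq_mul_sin_sq_pos hk φ))

lemma continuous_ellipticF (hk : k ^ 2 < 1) : Continuous fun φ => ellipticF φ k :=
  continuous_iff_continuousAt.2 fun φ => (hasDerivAt_ellipticF hk φ).continuousAt

/-- The integrand is at least `1`. This makes `K` positive and `F` unbounded in both directions,
hence surjective. -/
lemma le_ellipticF (hk : k ^ 2 < 1) {φ : ℝ} (hφ : 0 ≤ φ) : φ ≤ ellipticF φ k := by
  have h : ∫ _ in (0 : ℝ)..φ, (1 : ℝ) ≤ ellipticF φ k := by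
    refine intervalIntegral.integral_mono_on hφ (by simp)
      ((continuous_ellipticF_integrand hk).intervalIntegrable _ _) fun t _ => ?_
    rw [le_div_iff₀ (Real.sqrt_pos.2 (one_sub_sq_mul_sin_sq_pos hk t)), one_mul]
    exact Real.sqrt_le_one.2 (by nlinarith [mul_nonneg (sq_nonneg k) (sq_nonneg (sin t))])
  simpa using h

lemma surjective_ellipticF (hk : k ^ 2 < 1) : Function.Surjective fun φ => ellipticF φ k := by
  refine (continuous_ellipticF hk).surjective ?_ ?_
  · exact tendsto_atTop_mono' _ (eventually_ge_atTop 0 |>.mono fun φ h => le_ellipticF hk h)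
      tendsto_id
  · refine tendsto_atBot_mono' atBot (f₁ := fun φ : ℝ => φ) ?_ tendsto_id
    filter_upwards [eventually_le_atBot 0] with φ hφ
    have := le_ellipticF hk (neg_nonneg.2 hφ)
    rw [ellipticF_neg] at this
    simpa using this

/-- The integrand has period `π`, so the increment over a length `π` is constant; at `-π/2` oddness
evaluates it. -/
lemma ellipticF_add_pi (hk : k ^ 2 < 1) (φ : ℝ) :
    ellipticF (φ + π) k = ellipticF φ k + 2 * ellipticK k := by
  have key : ∀ ψ, ellipticF (ψ + π) k - ellipticF ψ k = ellipticF (-(π / 2) + π) k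
      - ellipticF (-(π / 2)) k := by
    intro ψ
    have hd : ∀ x, HasDerivAt (fun ψ => ellipticF (ψ + π) k - ellipticF ψ k) 0 x := fun x => by
      have h := ((hasDerivAt_ellipticF hk (x + π)).comp_add_const x π).sub
        (hasDerivAt_ellipticF hk x)
      rwa [sin_add_pi, neg_sq, sub_self] at h
    exact is_const_of_deriv_eq_zero (fun x => (hd x).differentiableAt) (fun x => (hd x).deriv) _ _
  have h := key φ
  rw [ellipticF_neg, show -(π / 2) + π = π / 2 by ring] at h
  unfold ellipticK
  linarith

lemma ellipticK_pos (hk : k ^ 2 < 1) : 0 < ellipticK k :=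
  lt_of_lt_of_le (by positivity) (le_ellipticF hk (by positivity : (0 : ℝ) ≤ π / 2))

/-! ### The Jacobi amplitude and elliptic functions -/

/-- Surjectivity of `F` is what makes `Function.invFun` a genuine inverse rather than a default
value. -/
lemma ellipticF_jacobiAm (hk : k ^ 2 < 1) (u : ℝ) : ellipticF (jacobiAm u k) k = u :=
  Function.invFun_eq (surjective_ellipticF hk u)

lemma jacobiAm_ellipticF (hk : k ^ 2 < 1) (φ : ℝ) : jacobiAm (ellipticF φ k) k = φ :=
  (strictMono_ellipticF hk).injective (ellipticF_jacobiAm hk _)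

lemma jacobiAm_eq (hk : k ^ 2 < 1) {u φ : ℝ} (h : ellipticF φ k = u) : jacobiAm u k = φ := by
  rw [← h, jacobiAm_ellipticF hk]

lemma strictMono_jacobiAm (hk : k ^ 2 < 1) : StrictMono fun u => jacobiAm u k := fun u v huv => by
  refine (strictMono_ellipticF hk).lt_iff_lt.1 ?_
  simpa only [ellipticF_jacobiAm hk] using huv

lemma continuous_jacobiAm (hk : k ^ 2 < 1) : Continuous fun u => jacobiAm u k := by
  refine (strictMono_jacobiAm hk).monotone.continuous_of_surjective fun φ => ⟨ellipticF φ k, ?_⟩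
  exact jacobiAm_ellipticF hk φ

/-- The Jacobi delta amplitude. -/
noncomputable def jacobiDn (u k : ℝ) : ℝ := √(1 - k ^ 2 * jacobiSn u k ^ 2)

lemma jacobiDn_pos (hk : k ^ 2 < 1) (u : ℝ) : 0 < jacobiDn u k :=
  Real.sqrt_pos.2 (one_sub_sq_mul_sin_sq_pos hk _)

lemma jacobiDn_sq (hk : k ^ 2 < 1) (u : ℝ) : jacobiDn u k ^ 2 = 1 - k ^ 2 * jacobiSn u k ^ 2 :=
  Real.sq_sqrt (one_sub_sq_mul_sin_sq_pos hk _).le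

lemma jacobiCn_sq (u k : ℝ) : jacobiCn u k ^ 2 = 1 - jacobiSn u k ^ 2 := cos_sq' _

lemma hasDerivAt_jacobiAm (hk : k ^ 2 < 1) (u : ℝ) :
    HasDerivAt (fun u => jacobiAm u k) (jacobiDn u k) u := by
  have h := (hasDerivAt_ellipticF hk (jacobiAm u k)).of_local_left_inverse
    (continuous_jacobiAm hk).continuousAt
    (one_div_pos.2 (Real.sqrt_pos.2 (one_sub_sq_mul_sin_sq_pos hk _))).ne'
    (Eventually.of_forall fun v => ellipticF_jacobiAm hk v)
  rwa [one_div, inv_inv] at h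

lemma hasDerivAt_jacobiSn (hk : k ^ 2 < 1) (u : ℝ) :
    HasDerivAt (fun u => jacobiSn u k) (jacobiCn u k * jacobiDn u k) u :=
  (hasDerivAt_jacobiAm hk u).sin

lemma hasDerivAt_jacobiCn (hk : k ^ 2 < 1) (u : ℝ) :
    HasDerivAt (fun u => jacobiCn u k) (-(jacobiSn u k * jacobiDn u k)) u := by
  have h := (hasDerivAt_jacobiAm hk u).cos
  rwa [neg_mul] at h

lemma hasDerivAt_jacobiDn (hk : k ^ 2 < 1) (u : ℝ) :
    HasDerivAt (fun u => jacobiDn u k) (-(k ^ 2 * jacobiSn u k * jacobiCn u k)) u := by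
  have h := (((hasDerivAt_jacobiSn hk u).pow 2).const_mul (k ^ 2)).const_sub 1
  refine (h.sqrt (one_sub_sq_mul_sin_sq_pos hk _).ne').congr_deriv ?_
  have hd := (jacobiDn_pos hk u).ne'
  change _ / (2 * jacobiDn u k) = _
  push_cast
  field_simp

lemma jacobiAm_zero (hk : k ^ 2 < 1) : jacobiAm 0 k = 0 := jacobiAm_eq hk (ellipticF_zero k)

lemma jacobiAm_ellipticK (hk : k ^ 2 < 1) : jacobiAm (ellipticK k) k = π / 2 :=
  jacobiAm_eq hk rfl

lemma jacobiAm_neg (hk : k ^ 2 < 1) (u : ℝ) : jacobiAm (-u) k = -jacobiAm u k :=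
  jacobiAm_eq hk (by rw [ellipticF_neg, ellipticF_jacobiAm hk])

lemma jacobiAm_add_two_mul_ellipticK (hk : k ^ 2 < 1) (u : ℝ) :
    jacobiAm (u + 2 * ellipticK k) k = jacobiAm u k + π :=
  jacobiAm_eq hk (by rw [ellipticF_add_pi hk, ellipticF_jacobiAm hk])

lemma jacobiSn_zero (hk : k ^ 2 < 1) : jacobiSn 0 k = 0 := by
  simp [jacobiSn, jacobiAm_zero hk]

lemma jacobiSn_ellipticK (hk : k ^ 2 < 1) : jacobiSn (ellipticK k) k = 1 := by
  simp [jacobiSn, jacobiAm_ellipticK hk]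

lemma jacobiCn_ellipticK (hk : k ^ 2 < 1) : jacobiCn (ellipticK k) k = 0 := by
  simp [jacobiCn, jacobiAm_ellipticK hk]

lemma jacobiSn_neg (hk : k ^ 2 < 1) (u : ℝ) : jacobiSn (-u) k = -jacobiSn u k := by
  simp [jacobiSn, jacobiAm_neg hk]

lemma jacobiSn_add_two_mul_ellipticK (hk : k ^ 2 < 1) (u : ℝ) :
    jacobiSn (u + 2 * ellipticK k) k = -jacobiSn u k := by
  simp [jacobiSn, jacobiAm_add_two_mul_ellipticK hk]

lemma jacobiCn_add_two_mul_ellipticK (hk : k ^ 2 < 1) (u : ℝ) :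
    jacobiCn (u + 2 * ellipticK k) k = -jacobiCn u k := by
  simp [jacobiCn, jacobiAm_add_two_mul_ellipticK hk]

lemma jacobiDn_add_two_mul_ellipticK (hk : k ^ 2 < 1) (u : ℝ) :
    jacobiDn (u + 2 * ellipticK k) k = jacobiDn u k := by
  simp [jacobiDn, jacobiSn_add_two_mul_ellipticK hk]

lemma jacobiAm_mem_Ioo (hk : k ^ 2 < 1) {u : ℝ} (hu : u ∈ Ioo 0 (ellipticK k)) :
    jacobiAm u k ∈ Ioo 0 (π / 2) := by
  rw [← jacobiAm_zero hk, ← jacobiAm_ellipticK hk]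
  exact ⟨strictMono_jacobiAm hk hu.1, strictMono_jacobiAm hk hu.2⟩

lemma ellipticF_mem_Ioo (hk : k ^ 2 < 1) {φ : ℝ} (hφ : φ ∈ Ioo 0 (π / 2)) :
    ellipticF φ k ∈ Ioo 0 (ellipticK k) :=
  ⟨ellipticF_zero k ▸ strictMono_ellipticF hk hφ.1, strictMono_ellipticF hk hφ.2⟩

lemma jacobiCn_ellipticF_arccos (hk : k ^ 2 < 1) {x : ℝ} (hx : x ∈ Ioo 0 1) :
    ellipticF (arccos x) k ∈ Ioo 0 (ellipticK k) ∧ jacobiCn (ellipticF (arccos x) k) k = x := by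
  refine ⟨ellipticF_mem_Ioo hk ⟨arccos_pos.2 hx.2, arccos_lt_pi_div_two.2 hx.1⟩, ?_⟩
  rw [jacobiCn, jacobiAm_ellipticF hk, cos_arccos (by linarith [hx.1]) hx.2.le]

lemma eq_ellipticF_arccos_of_jacobiCn_eq (hk : k ^ 2 < 1) {x u : ℝ}
    (hu : u ∈ Ioo 0 (ellipticK k)) (h : jacobiCn u k = x) : u = ellipticF (arccos x) k := by
  have ha := jacobiAm_mem_Ioo hk hu
  rw [← h, jacobiCn, arccos_cos ha.1.le (by linarith [ha.2, pi_pos]), ellipticF_jacobiAm hk]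

/-- The choice inside `arcCn` is forced because `cos` is injective on `(0, π/2)`. The explicit form
later shows that `ν` is differentiable in the energy. -/
lemma arcCn_eq_ellipticF_arccos (hk : k ^ 2 < 1) {x : ℝ} (hx : x ∈ Ioo 0 1) :
    arcCn x k = ellipticF (arccos x) k := by
  have h : ∃ u ∈ Ioo 0 (ellipticK k), jacobiCn u k = x := ⟨_, jacobiCn_ellipticF_arccos hk hx⟩
  exact eq_ellipticF_arccos_of_jacobiCn_eq hk (Function.invFunOn_mem h) (Function.invFunOn_eq h)

lemma existsUnique_jacobiCn_eq (hk : k ^ 2 < 1) {x : ℝ} (hx : x ∈ Ioo 0 1) :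
    ∃! u : ℝ, u ∈ Ioo 0 (ellipticK k) ∧ jacobiCn u k = x :=
  ⟨_, jacobiCn_ellipticF_arccos hk hx, fun _ hu => eq_ellipticF_arccos_of_jacobiCn_eq hk hu.1 hu.2⟩

end EllipticIntegrals

/-! ### Differentiability of integrals with respect to parameters -/

section ParametricIntegral

variable {H : Type*} [NormedAddCommGroup H] [NormedSpace ℝ H] [ProperSpace H]

/-- On a small closed ball times `[0, 1]`, which is compact because `H` is proper, the derivative is
bounded; that constant serves as the dominating function. -/
lemma differentiableAt_integral_of_contDiffOn {f : H → ℝ → ℝ} {U : Set H} (hU : IsOpen U)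
    (hf : ContDiffOn ℝ 1 (Function.uncurry f) (U ×ˢ univ)) {x₀ : H} (hx₀ : x₀ ∈ U) :
    DifferentiableAt ℝ (fun x => ∫ t in (0 : ℝ)..1, f x t) x₀ := by
  have hUo : IsOpen (U ×ˢ (univ : Set ℝ)) := hU.prod isOpen_univ
  have hfd : ∀ x ∈ U, ∀ t, DifferentiableAt ℝ (Function.uncurry f) (x, t) := fun x hx t =>
    (hf.differentiableOn one_ne_zero).differentiableAt (hUo.mem_nhds ⟨hx, mem_univ _⟩)
  have hcont : ContinuousOn (fderiv ℝ (Function.uncurry f)) (U ×ˢ univ) :=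
    hf.continuousOn_fderiv_of_isOpen hUo le_rfl
  obtain ⟨ε, hε, hball⟩ := Metric.nhds_basis_closedBall.mem_iff.1 (hU.mem_nhds hx₀)
  have hK : IsCompact (Metric.closedBall x₀ ε ×ˢ Icc (0 : ℝ) 1) :=
    (isCompact_closedBall _ _).prod isCompact_Icc
  obtain ⟨B, hB⟩ := hK.exists_bound_of_continuousOn
    (hcont.mono (prod_mono hball (subset_univ _)))
  set L : ℝ → (H →L[ℝ] ℝ) := fun t =>
    (fderiv ℝ (Function.uncurry f) (x₀, t)).comp (ContinuousLinearMap.inl ℝ H ℝ)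
  have hslice : ∀ x ∈ U, Continuous (f x) := fun x hx => continuous_iff_continuousAt.2 fun t =>
    ((hfd x hx t).continuousAt.comp (f := fun t : ℝ => (x, t))
      (by fun_prop : Continuous fun t : ℝ => (x, t)).continuousAt)
  have hder : ∀ x ∈ U, ∀ t, HasFDerivAt (fun x => f x t)
      ((fderiv ℝ (Function.uncurry f) (x, t)).comp (ContinuousLinearMap.inl ℝ H ℝ)) x :=
    fun x hx t => HasFDerivAt.comp (g := Function.uncurry f) (f := fun x => (x, t)) x
      (hfd x hx t).hasFDerivAt (hasFDerivAt_prodMk_left x t)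
  have hLc : Continuous L := by
    have h : Continuous fun t : ℝ => fderiv ℝ (Function.uncurry f) (x₀, t) :=
      hcont.comp_continuous (by fun_prop) fun t => ⟨hx₀, mem_univ _⟩
    exact h.clm_comp continuous_const
  refine (intervalIntegral.hasFDerivAt_integral_of_dominated_of_fderiv_le (μ := volume)
    (F := f) (F' := fun x t => (fderiv ℝ (Function.uncurry f) (x, t)).comp
      (ContinuousLinearMap.inl ℝ H ℝ)) (bound := fun _ => B * ‖ContinuousLinearMap.inl ℝ H ℝ‖)
    (s := Metric.closedBall x₀ ε) (Metric.closedBall_mem_nhds x₀ hε) ?_ ?_ ?_ ?_ ?_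
      ?_).differentiableAt
  · filter_upwards [hU.mem_nhds hx₀] with x hx using (hslice x hx).aestronglyMeasurable
  · exact (hslice x₀ hx₀).intervalIntegrable _ _
  · exact hLc.aestronglyMeasurable
  · refine Eventually.of_forall fun t ht x hx => ?_
    rw [uIoc_of_le zero_le_one] at ht
    refine (ContinuousLinearMap.opNorm_comp_le _ _).trans ?_
    gcongr
    exact hB (x, t) ⟨hx, Ioc_subset_Icc_self ht⟩
  · simp
  · exact Eventually.of_forall fun t _ x hx => hder x (hball hx) t

end ParametricIntegral

/-- Rescaling to the fixed interval `[0, 1]` turns the amplitude into a parameter on the same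
footing as the modulus. -/
lemma ellipticF_eq_mul_integral (φ k : ℝ) :
    ellipticF φ k = ∫ t in (0 : ℝ)..1, φ * (1 / √(1 - k ^ 2 * sin (φ * t) ^ 2)) := by
  rw [intervalIntegral.integral_const_mul,
    intervalIntegral.mul_integral_comp_mul_left (f := fun t : ℝ => 1 / √(1 - k ^ 2 * sin t ^ 2))]
  simp [ellipticF]

lemma differentiableAt_uncurry_ellipticF {φ k : ℝ} (hk : k ^ 2 < 1) :
    DifferentiableAt ℝ (Function.uncurry ellipticF) (φ, k) := by
  have hU : IsOpen {x : ℝ × ℝ | x.2 ^ 2 < 1} := isOpen_lt (by fun_prop) (by fun_prop)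
  have h := differentiableAt_integral_of_contDiffOn (x₀ := (φ, k))
    (f := fun (x : ℝ × ℝ) t => x.1 * (1 / √(1 - x.2 ^ 2 * sin (x.1 * t) ^ 2))) hU ?_ hk
  · exact h.congr_of_eventuallyEq (Eventually.of_forall fun x => ellipticF_eq_mul_integral x.1 x.2)
  · rintro ⟨⟨φ', k'⟩, t⟩ ⟨hx, -⟩
    have hp : 0 < 1 - k' ^ 2 * sin (φ' * t) ^ 2 := one_sub_sq_mul_sin_sq_pos hx _
    refine ContDiffAt.contDiffWithinAt ?_
    have h1 : ContDiffAt ℝ 1 (fun y : (ℝ × ℝ) × ℝ => √(1 - y.1.2 ^ 2 * sin (y.1.1 * y.2) ^ 2))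
        ((φ', k'), t) := ContDiffAt.sqrt (by fun_prop) hp.ne'
    exact contDiffAt_fst.fst.mul (contDiffAt_const.div h1 (Real.sqrt_pos.2 hp).ne')

lemma differentiableAt_ellipticF_comp {φ k : ℝ → ℝ} {x : ℝ} (hφ : DifferentiableAt ℝ φ x)
    (hk : DifferentiableAt ℝ k x) (h : k x ^ 2 < 1) :
    DifferentiableAt ℝ (fun y => ellipticF (φ y) (k y)) x :=
  DifferentiableAt.comp (g := Function.uncurry ellipticF) (f := fun y => (φ y, k y)) x
    (differentiableAt_uncurry_ellipticF h) (hφ.prodMk hk)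

lemma differentiableAt_ellipticK_comp {k : ℝ → ℝ} {x : ℝ} (hk : DifferentiableAt ℝ k x)
    (h : k x ^ 2 < 1) : DifferentiableAt ℝ (fun y => ellipticK (k y)) x :=
  differentiableAt_ellipticF_comp (differentiableAt_const _) hk h

/-! ### The four turning points and their dependence on the energy -/

section Roots

variable {α β E a b c d : ℝ}

/-- A cubic with four distinct zeros vanishes identically; successive divided differences isolate
one coefficient at a time. -/
lemma cubic_coeffs_eq_zero {e₀ e₁ e₂ e₃ a b c d : ℝ} (hab : b < a) (hbc : c < b) (hcd : d < c)
    (ha : e₃ * a ^ 3 + e₂ * a ^ 2 + e₁ * a + e₀ = 0)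
    (hb : e₃ * b ^ 3 + e₂ * b ^ 2 + e₁ * b + e₀ = 0)
    (hc : e₃ * c ^ 3 + e₂ * c ^ 2 + e₁ * c + e₀ = 0)
    (hd : e₃ * d ^ 3 + e₂ * d ^ 2 + e₁ * d + e₀ = 0) :
    e₃ = 0 ∧ e₂ = 0 ∧ e₁ = 0 ∧ e₀ = 0 := by
  have h1 : e₃ * (a ^ 2 + a * b + b ^ 2) + e₂ * (a + b) + e₁ = 0 :=
    mul_left_cancel₀ (sub_pos.2 hab).ne' (by linear_combination ha - hb)
  have h2 : e₃ * (b ^ 2 + b * c + c ^ 2) + e₂ * (b + c) + e₁ = 0 :=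
    mul_left_cancel₀ (sub_pos.2 hbc).ne' (by linear_combination hb - hc)
  have h3 : e₃ * (c ^ 2 + c * d + d ^ 2) + e₂ * (c + d) + e₁ = 0 :=
    mul_left_cancel₀ (sub_pos.2 hcd).ne' (by linear_combination hc - hd)
  have h4 : e₃ * (a + b + c) + e₂ = 0 :=
    mul_left_cancel₀ (sub_pos.2 (hbc.trans hab)).ne' (by linear_combination h1 - h2)
  have h5 : e₃ * (b + c + d) + e₂ = 0 :=
    mul_left_cancel₀ (sub_pos.2 (hcd.trans hbc)).ne' (by linear_combination h2 - h3)
  have h6 : e₃ = 0 :=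
    mul_left_cancel₀ (sub_pos.2 (hcd.trans (hbc.trans hab))).ne' (by linear_combination h4 - h5)
  subst h6
  have h7 : e₂ = 0 := by linarith
  subst h7
  have h8 : e₁ = 0 := by linarith
  subst h8
  exact ⟨rfl, rfl, rfl, by linarith⟩

/-- `a > b > c > d` are the four roots of `E - V`. -/
structure IsOrderedRoots (α β E a b c d : ℝ) : Prop where
  hab : b < a
  hbc : c < b
  hcd : d < c
  va : V α β a = E
  vb : V α β b = E
  vc : V α β c = E
  vd : V α β d = E

namespace IsOrderedRoots

lemma vieta (h : IsOrderedRoots α β E a b c d) :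
    α / 3 = -(β / 4) * (a + b + c + d) ∧
    1 / 2 = β / 4 * (a * b + a * c + a * d + b * c + b * d + c * d) ∧
    β / 4 * (a * b * c + a * b * d + a * c * d + b * c * d) = 0 ∧
    E = -(β / 4) * (a * b * c * d) := by
  obtain ⟨hab, hbc, hcd, va, vb, vc, vd⟩ := h
  unfold V at va vb vc vd
  -- These are the coefficients of `V(q) - E - β/4 (q - a)(q - b)(q - c)(q - d)`, whose quartic
  -- terms cancel.
  have := cubic_coeffs_eq_zero (e₃ := α / 3 + β / 4 * (a + b + c + d))
    (e₂ := 1 / 2 - β / 4 * (a * b + a * c + a * d + b * c + b * d + c * d))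
    (e₁ := β / 4 * (a * b * c + a * b * d + a * c * d + b * c * d))
    (e₀ := -E - β / 4 * (a * b * c * d)) hab hbc hcd (by linear_combination va)
    (by linear_combination vb) (by linear_combination vc) (by linear_combination vd)
  refine ⟨?_, ?_, this.2.2.1, ?_⟩ <;> linarith

lemma sub_V (h : IsOrderedRoots α β E a b c d) (q : ℝ) :
    E - V α β q = β / 4 * ((a - q) * (b - q) * (c - q) * (q - d)) := by
  obtain ⟨h1, h2, h3, h4⟩ := h.vieta
  unfold V
  linear_combination h4 - q ^ 2 * h2 - q ^ 3 * h1 - q * h3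

lemma eq_of_V_eq (hβ : 0 < β) (h : IsOrderedRoots α β E a b c d) {q : ℝ} (hq : V α β q = E) :
    q = a ∨ q = b ∨ q = c ∨ q = d := by
  have := h.sub_V q
  rw [hq, sub_self, eq_comm] at this
  simp only [mul_eq_zero, sub_eq_zero] at this
  grind

end IsOrderedRoots

lemma V_roots (hex : ∃ a b c d, IsOrderedRoots α β E a b c d) :
    IsOrderedRoots α β E (rootA α β E) (rootB α β E) (rootC α β E) (rootD α β E) := by
  obtain ⟨a, b, c, d, h⟩ := hex
  have hs : StrictAnti (roots α β E) ∧ ∀ i, E - V α β (roots α β E i) = 0 := by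
    refine Classical.epsilon_spec
      (p := fun r : Fin 4 → ℝ => StrictAnti r ∧ ∀ i, E - V α β (r i) = 0) ⟨![a, b, c, d], ?_, ?_⟩
    · rw [Fin.strictAnti_iff_succ_lt]
      intro i
      fin_cases i
      exacts [h.hab, h.hbc, h.hcd]
    · intro i
      fin_cases i
      exacts [sub_eq_zero.2 h.va.symm, sub_eq_zero.2 h.vb.symm, sub_eq_zero.2 h.vc.symm,
        sub_eq_zero.2 h.vd.symm]
  have hv := fun i => (sub_eq_zero.1 (hs.2 i)).symm
  exact ⟨hs.1 (by decide), hs.1 (by decide), hs.1 (by decide), hv 0, hv 1, hv 2, hv 3⟩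

/-- A quartic has no fifth root and the ordering leaves only one labelling, so the choice made in
`roots` is unique. -/
lemma IsOrderedRoots.eq_roots (hβ : 0 < β) (h : IsOrderedRoots α β E a b c d) :
    rootA α β E = a ∧ rootB α β E = b ∧ rootC α β E = c ∧ rootD α β E = d := by
  have h' := V_roots ⟨a, b, c, d, h⟩
  have ha := h.eq_of_V_eq hβ h'.va
  have hb := h.eq_of_V_eq hβ h'.vb
  have hc := h.eq_of_V_eq hβ h'.vc
  have hd := h.eq_of_V_eq hβ h'.vd
  obtain ⟨x1, x2, x3, -⟩ := h
  obtain ⟨y1, y2, y3, -⟩ := h'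
  grind

lemma qThres_spec (hα : α < 0) (hβ : 0 < β) (hβα : β < 2 * α ^ 2 / 9) :
    β * qThres α β ^ 2 + α * qThres α β + 1 = 0 ∧ 0 < qThres α β ∧
      qThres α β < -(2 * α) / (3 * β) ∧ 0 < EMax α β := by
  have hD : 0 < α ^ 2 - 4 * β := by nlinarith [sq_pos_of_neg hα]
  set s := √(α ^ 2 - 4 * β) with hs
  have hs2 : s ^ 2 = α ^ 2 - 4 * β := Real.sq_sqrt hD.le
  have hs0 : 0 < s := Real.sqrt_pos.2 hD
  have hsα : s < -α := by nlinarith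
  have hs3 : -α < 3 * s := by nlinarith
  have ht : qThres α β = (-α - s) / (2 * β) := rfl
  have e1 : β * qThres α β ^ 2 + α * qThres α β + 1 = 0 := by
    rw [ht]; field_simp; linear_combination hs2
  have e2 : 0 < qThres α β := by rw [ht]; apply div_pos <;> linarith
  refine ⟨e1, e2, ?_, ?_⟩
  · rw [ht, div_lt_div_iff₀ (by positivity) (by positivity)]
    nlinarith
  · have h3 : 0 < 3 + α * qThres α β := by
      rw [ht, ← mul_div_assoc, ← sub_neg_eq_add, sub_pos, ← neg_div, div_lt_iff₀ (by positivity)]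
      nlinarith
    -- The critical-point equation eliminates `β q²` from `V`.
    have : EMax α β = qThres α β ^ 2 * (3 + α * qThres α β) / 12 := by
      unfold EMax V
      linear_combination qThres α β ^ 2 / 4 * e1
    rw [this]; positivity

/-- `V - E` changes sign between consecutive points of `-(E + 1) < 0 < qThres < r < 2 r + (E + 1)`,
which gives one root in each of the four gaps. -/
lemma exists_isOrderedRoots (hα : α < 0) (hβ : 0 < β) (hβα : β < 2 * α ^ 2 / 9)
    (hE : E ∈ Ioo 0 (EMax α β)) :
    ∃ a b c d, IsOrderedRoots α β E a b c d ∧ qThres α β < b ∧ c < qThres α β ∧ 0 < c ∧ d < 0 := by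
  obtain ⟨-, ht, htq, -⟩ := qThres_spec hα hβ hβα
  have hV : Continuous (V α β) := by unfold V; fun_prop
  have hV0 : V α β 0 = 0 := by simp [V]
  -- The vertex of the quadratic `V(q) / q²`. Its value there is negative precisely because `β < 2
  -- α² / 9`.
  set r := -(2 * α) / (3 * β) with hr
  have hVr : V α β r < 0 := by
    have hαβ : α = -(3 * β * r) / 2 := by rw [hr]; field_simp
    have : 0 < r := ht.trans htq
    have h2 : 1 < β * r ^ 2 / 2 := by
      rw [hαβ] at hβα
      have : β * 1 < β * (β * r ^ 2 / 2) := by linarith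
      exact lt_of_mul_lt_mul_left this hβ.le
    have h3 : V α β r = r ^ 2 * (1 / 2 - β * r ^ 2 / 4) := by
      unfold V; rw [hαβ]; ring
    rw [h3]
    exact mul_neg_of_pos_of_neg (by positivity) (by linarith)
  have hneg : E < V α β (-(E + 1)) := by
    unfold V
    have : 0 ≤ α * (-(E + 1)) ^ 3 := by
      have := pow_pos (show 0 < E + 1 by linarith [hE.1]) 3
      nlinarith
    have : 0 ≤ β * (-(E + 1)) ^ 4 := by positivity
    nlinarith [hE.1]
  -- The quadratic `V(q) / q²` is symmetric about `r`, so beyond `2 r` it exceeds its value `1/2` at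
  -- the origin.
  have hpos : E < V α β (2 * r + (E + 1)) := by
    have hr0 : 0 < r := ht.trans htq
    have hαβ : α = -(3 * β * r) / 2 := by rw [hr]; field_simp
    have h3 : V α β (2 * r + (E + 1)) = (2 * r + (E + 1)) ^ 2 / 2 +
        (2 * r + (E + 1)) ^ 3 * β * (E + 1) / 4 := by
      unfold V; rw [hαβ]; ring
    have h0 := hE.1
    have : 0 < (2 * r + (E + 1)) ^ 3 * β * (E + 1) / 4 := by positivity
    rw [h3]
    nlinarith
  have hEr : 2 * r + (E + 1) > r := by linarith [hE.1]
  obtain ⟨d, hd, hVd⟩ := intermediate_value_Ioo' (show -(E + 1) ≤ 0 by linarith [hE.1])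
    hV.continuousOn ⟨hV0.trans_lt hE.1, hneg⟩
  obtain ⟨c, hc, hVc⟩ := intermediate_value_Ioo ht.le hV.continuousOn ⟨hV0.trans_lt hE.1, hE.2⟩
  obtain ⟨b, hb, hVb⟩ := intermediate_value_Ioo' htq.le hV.continuousOn ⟨hVr.trans hE.1, hE.2⟩
  obtain ⟨a, ha, hVa⟩ := intermediate_value_Ioo hEr.le hV.continuousOn ⟨hVr.trans hE.1, hpos⟩
  exact ⟨a, b, c, d, ⟨hb.2.trans ha.1, hc.2.trans hb.1, hd.2.trans hc.1, hVa, hVb, hVc, hVd⟩,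
    hb.1, hc.2, hc.1, hd.2⟩

lemma isOrderedRoots_roots (hα : α < 0) (hβ : 0 < β) (hβα : β < 2 * α ^ 2 / 9)
    (hE : E ∈ Ioo 0 (EMax α β)) :
    IsOrderedRoots α β E (rootA α β E) (rootB α β E) (rootC α β E) (rootD α β E) ∧
      qThres α β < rootB α β E ∧ rootC α β E < qThres α β ∧ 0 < rootC α β E ∧ rootD α β E < 0 := by
  obtain ⟨a, b, c, d, h, hs⟩ := exists_isOrderedRoots hα hβ hβα hE
  obtain ⟨rfl, rfl, rfl, rfl⟩ := h.eq_roots hβ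
  exact ⟨h, hs⟩

lemma hasStrictDerivAt_V (q : ℝ) :
    HasStrictDerivAt (V α β) (q + α * q ^ 2 + β * q ^ 3) q := by
  have h : HasStrictDerivAt (fun q : ℝ => q ^ 2 / 2 + α * q ^ 3 / 3 + β * q ^ 4 / 4) _ q :=
    (((hasStrictDerivAt_id q).pow 2).div_const 2).add
      ((((hasStrictDerivAt_id q).pow 3).const_mul α).div_const 3) |>.add
      ((((hasStrictDerivAt_id q).pow 4).const_mul β).div_const 4)
  refine h.congr_deriv ?_
  simp
  ring

/-- The inverse function theorem for `V` supplies a differentiable branch of the root. -/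
lemma exists_local_root {q : ℝ} (h : q + α * q ^ 2 + β * q ^ 3 ≠ 0) :
    ∃ g : ℝ → ℝ, g (V α β q) = q ∧ DifferentiableAt ℝ g (V α β q) ∧
      ∀ᶠ E in 𝓝 (V α β q), V α β (g E) = E := by
  have hs := hasStrictDerivAt_V (α := α) (β := β) q
  exact ⟨hs.localInverse _ _ _ h, HasStrictFDerivAt.localInverse_apply_image _,
    (hs.to_localInverse h).hasDerivAt.differentiableAt, HasStrictFDerivAt.eventually_right_inverse _⟩

/-- Distinct roots are simple: differentiating the factorization and evaluating at a root leaves one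
nonzero product. -/
lemma IsOrderedRoots.deriv_V_ne_zero (hβ : 0 < β) (h : IsOrderedRoots α β E a b c d) :
    a + α * a ^ 2 + β * a ^ 3 ≠ 0 ∧ b + α * b ^ 2 + β * b ^ 3 ≠ 0 ∧
      c + α * c ^ 2 + β * c ^ 3 ≠ 0 ∧ d + α * d ^ 2 + β * d ^ 3 ≠ 0 := by
  have key : ∀ q, q + α * q ^ 2 + β * q ^ 3 = β / 4 * ((q - b) * (q - c) * (q - d) +
      (q - a) * (q - c) * (q - d) + (q - a) * (q - b) * (q - d) + (q - a) * (q - b) * (q - c)) := by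
    intro q
    obtain ⟨h1, h2, h3, h4⟩ := h.vieta
    linear_combination 3 * q ^ 2 * h1 + 2 * q * h2 + h3
  obtain ⟨hab, hbc, hcd, -⟩ := h
  have n1 : a - b ≠ 0 := by linarith
  have n2 : a - c ≠ 0 := by linarith
  have n3 : a - d ≠ 0 := by linarith
  have n4 : b - c ≠ 0 := by linarith
  have n5 : b - d ≠ 0 := by linarith
  have n6 : c - d ≠ 0 := by linarith
  have m1 : b - a ≠ 0 := by linarith
  have m2 : c - a ≠ 0 := by linarith
  have m3 : d - a ≠ 0 := by linarith
  have m4 : c - b ≠ 0 := by linarith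
  have m5 : d - b ≠ 0 := by linarith
  have m6 : d - c ≠ 0 := by linarith
  simp [*, hβ.ne']

lemma differentiableAt_roots (hα : α < 0) (hβ : 0 < β) (hβα : β < 2 * α ^ 2 / 9)
    (hE : E ∈ Ioo 0 (EMax α β)) :
    DifferentiableAt ℝ (rootA α β) E ∧ DifferentiableAt ℝ (rootB α β) E ∧
      DifferentiableAt ℝ (rootC α β) E ∧ DifferentiableAt ℝ (rootD α β) E := by
  obtain ⟨a, b, c, d, h, -⟩ := exists_isOrderedRoots hα hβ hβα hE
  obtain ⟨na, nb, nc, nd⟩ := h.deriv_V_ne_zero hβ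
  obtain ⟨ga, ga0, gad, gaV⟩ := exists_local_root na
  obtain ⟨gb, gb0, gbd, gbV⟩ := exists_local_root nb
  obtain ⟨gc, gc0, gcd, gcV⟩ := exists_local_root nc
  obtain ⟨gd, gd0, gdd, gdV⟩ := exists_local_root nd
  rw [h.va] at ga0 gad gaV
  rw [h.vb] at gb0 gbd gbV
  rw [h.vc] at gc0 gcd gcV
  rw [h.vd] at gd0 gdd gdV
  -- The four local branches stay ordered near `E`; uniqueness of the ordered quadruple then
  -- identifies them with `rootA`, ..., `rootD`.
  have o1 := gbd.continuousAt.eventually_lt gad.continuousAt (by rw [ga0, gb0]; exact h.hab)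
  have o2 := gcd.continuousAt.eventually_lt gbd.continuousAt (by rw [gb0, gc0]; exact h.hbc)
  have o3 := gdd.continuousAt.eventually_lt gcd.continuousAt (by rw [gc0, gd0]; exact h.hcd)
  have hev : ∀ᶠ E' in 𝓝 E, rootA α β E' = ga E' ∧ rootB α β E' = gb E' ∧ rootC α β E' = gc E' ∧
      rootD α β E' = gd E' := by
    filter_upwards [o1, o2, o3, gaV, gbV, gcV, gdV] with E' h1 h2 h3 h4 h5 h6 h7
    exact IsOrderedRoots.eq_roots hβ ⟨h1, h2, h3, h4, h5, h6, h7⟩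
  exact ⟨gad.congr_of_eventuallyEq (hev.mono fun _ h => h.1),
    gbd.congr_of_eventuallyEq (hev.mono fun _ h => h.2.1),
    gcd.congr_of_eventuallyEq (hev.mono fun _ h => h.2.2.1),
    gdd.congr_of_eventuallyEq (hev.mono fun _ h => h.2.2.2)⟩

end Roots

/-- The modulus `k` and the parameter `n = γ²` attached to four ordered points `a > b > c > d`. -/
structure EllipticParams (a b c d k n : ℝ) : Prop where
  hab : b < a
  hbc : c < b
  hcd : d < c
  hk0 : 0 < k
  hk : k ^ 2 = (a - b) * (c - d) / ((a - c) * (b - d))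
  hn : n = (d - c) / (a - c)

/-- The parametrization `φ ↦ a + (d - a) / (1 - n sin² φ)` of `[d, c]`. -/
noncomputable def wellPoint (a d n φ : ℝ) : ℝ := a + (d - a) / (1 - n * sin φ ^ 2)

/-- The inverse of `wellPoint`. -/
noncomputable def wellAmplitude (a c d q : ℝ) : ℝ :=
  arcsin √((a - c) * (q - d) / ((c - d) * (a - q)))

/-! ### The substitution that uniformizes the well -/

namespace EllipticParams

variable {a b c d k n : ℝ}

lemma ac_pos (h : EllipticParams a b c d k n) : 0 < a - c := by linarith [h.hab, h.hbc]
lemma bd_pos (h : EllipticParams a b c d k n) : 0 < b - d := by linarith [h.hcd, h.hbc]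
lemma ad_pos (h : EllipticParams a b c d k n) : 0 < a - d := by linarith [h.ac_pos, h.hcd]
lemma cd_pos (h : EllipticParams a b c d k n) : 0 < c - d := sub_pos.2 h.hcd
lemma ab_pos (h : EllipticParams a b c d k n) : 0 < a - b := sub_pos.2 h.hab

lemma n_neg (h : EllipticParams a b c d k n) : n < 0 := by
  rw [h.hn]; exact div_neg_of_neg_of_pos (by linarith [h.hcd]) h.ac_pos

lemma k_sq_lt_one (h : EllipticParams a b c d k n) : k ^ 2 < 1 := by
  rw [h.hk, div_lt_one (mul_pos h.ac_pos h.bd_pos)]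
  nlinarith [mul_pos h.ad_pos (sub_pos.2 h.hbc)]

lemma k_lt_one (h : EllipticParams a b c d k n) : k < 1 := by
  nlinarith [h.k_sq_lt_one, h.hk0]

lemma denom_pos (h : EllipticParams a b c d k n) (s : ℝ) : 0 < 1 - n * s ^ 2 := by
  nlinarith [h.n_neg, sq_nonneg s]

/-- The parameter `n` is chosen so that `c` corresponds to `sin² φ = 1`, and `k` so that the factor
`b - x` becomes proportional to `1 - k² sin² φ`. -/
lemma sub_wellPoint (h : EllipticParams a b c d k n) (φ : ℝ) :
    a - wellPoint a d n φ = (a - d) / (1 - n * sin φ ^ 2) ∧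
    b - wellPoint a d n φ = (b - d) * (1 - k ^ 2 * sin φ ^ 2) / (1 - n * sin φ ^ 2) ∧
    c - wellPoint a d n φ = (c - d) * cos φ ^ 2 / (1 - n * sin φ ^ 2) ∧
    wellPoint a d n φ - d = (a - d) * (c - d) / (a - c) * sin φ ^ 2 / (1 - n * sin φ ^ 2) := by
  have hD := (h.denom_pos (sin φ)).ne'
  have h1 := h.ac_pos.ne'
  have h2 := h.bd_pos.ne'
  have hn : n * (a - c) = d - c := by rw [h.hn]; field_simp
  have hk : k ^ 2 * (b - d) = (a - b) * (c - d) / (a - c) := by rw [h.hk]; field_simp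
  have hk' : k ^ 2 * (b - d) = -(a - b) * n := by
    rw [hk, h.hn]; ring
  unfold wellPoint
  refine ⟨?_, ?_, ?_, ?_⟩
  · ring
  · field_simp
    linear_combination sin φ ^ 2 * hk'
  · rw [cos_sq']
    field_simp
    linear_combination sin φ ^ 2 * hn
  · field_simp
    linear_combination -(a - d) * sin φ ^ 2 * hn

lemma wellPoint_zero : wellPoint a d n 0 = d := by simp [wellPoint]

lemma wellPoint_pi_div_two (h : EllipticParams a b c d k n) : wellPoint a d n (π / 2) = c := by
  have := (h.sub_wellPoint (π / 2)).2.2.1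
  simp at this
  linarith

lemma wellPoint_mem (h : EllipticParams a b c d k n) {φ : ℝ} (hφ : φ ∈ Ioo 0 (π / 2)) :
    wellPoint a d n φ ∈ Ioo d c := by
  have hs : 0 < sin φ := sin_pos_of_pos_of_lt_pi hφ.1 (by linarith [hφ.2, pi_pos])
  have hc : 0 < cos φ := cos_pos_of_mem_Ioo ⟨by linarith [hφ.1, pi_pos], hφ.2⟩
  have hD := h.denom_pos (sin φ)
  have h1 := h.ac_pos
  have h2 := h.cd_pos
  have h3 := h.ad_pos
  obtain ⟨-, -, e3, e4⟩ := h.sub_wellPoint φ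
  constructor
  · rw [← sub_pos, e4]; positivity
  · rw [← sub_pos, e3]; positivity

lemma wellAmplitude_wellPoint (h : EllipticParams a b c d k n) {φ : ℝ}
    (hφ : φ ∈ Icc 0 (π / 2)) : wellAmplitude a c d (wellPoint a d n φ) = φ := by
  have hs : 0 ≤ sin φ := sin_nonneg_of_nonneg_of_le_pi hφ.1 (by linarith [hφ.2, pi_pos])
  have hD := (h.denom_pos (sin φ)).ne'
  have h1 := h.ac_pos.ne'
  have h2 := h.cd_pos.ne'
  have h3 := h.ad_pos.ne'
  obtain ⟨e1, -, -, e4⟩ := h.sub_wellPoint φ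
  have : (a - c) * (wellPoint a d n φ - d) / ((c - d) * (a - wellPoint a d n φ)) = sin φ ^ 2 := by
    rw [e1, e4]
    generalize 1 - n * sin φ ^ 2 = D at *
    field_simp
  rw [wellAmplitude, this, Real.sqrt_sq hs, arcsin_sin (by linarith [hφ.1, pi_pos]) hφ.2]

lemma wellAmplitude_mem (h : EllipticParams a b c d k n) {q : ℝ} (hq : q ∈ Ioo d c) :
    wellAmplitude a c d q ∈ Ioo 0 (π / 2) := by
  have h1 := h.ac_pos
  have h2 := h.cd_pos
  have h3 : 0 < a - q := by linarith [hq.2]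
  have h4 : 0 < q - d := by linarith [hq.1]
  refine ⟨arcsin_pos.2 (by positivity), arcsin_lt_pi_div_two.2 ?_⟩
  rw [Real.sqrt_lt' one_pos, one_pow, div_lt_one (by positivity)]
  nlinarith [mul_pos h.ad_pos (sub_pos.2 hq.2)]

lemma wellPoint_wellAmplitude (h : EllipticParams a b c d k n) {q : ℝ} (hq : q ∈ Ioo d c) :
    wellPoint a d n (wellAmplitude a c d q) = q := by
  have h1 := h.ac_pos
  have h2 := h.cd_pos
  have h3 : 0 < a - q := by linarith [hq.2]
  have h4 : 0 < q - d := by linarith [hq.1]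
  have h5 : √((a - c) * (q - d) / ((c - d) * (a - q))) ≤ 1 := by
    rw [Real.sqrt_le_one, div_le_one (by positivity)]
    nlinarith [mul_pos h.ad_pos (sub_pos.2 hq.2)]
  have hs : sin (wellAmplitude a c d q) ^ 2 = (a - c) * (q - d) / ((c - d) * (a - q)) := by
    rw [wellAmplitude, sin_arcsin ((by norm_num : (-1 : ℝ) ≤ 0).trans (Real.sqrt_nonneg _)) h5,
      Real.sq_sqrt (by positivity)]
  have h6 : 1 - n * sin (wellAmplitude a c d q) ^ 2 = (a - d) / (a - q) := by
    rw [hs, h.hn]; field_simp; ring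
  have h7 := h.ad_pos
  rw [wellPoint, h6]
  field_simp
  ring

lemma hasDerivAt_wellPoint (h : EllipticParams a b c d k n) (φ : ℝ) :
    HasDerivAt (wellPoint a d n)
      (2 * (a - d) * (c - d) / (a - c) * (sin φ * cos φ) / (1 - n * sin φ ^ 2) ^ 2) φ := by
  have hD := (h.denom_pos (sin φ)).ne'
  have h1 := h.ac_pos.ne'
  have h2 := ((((hasDerivAt_sin φ).pow 2).const_mul n).const_sub 1)
  have h3 := (h2.fun_inv hD).const_mul (d - a) |>.const_add a
  refine (h3.congr_deriv ?_)
  rw [h.hn] at hD ⊢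
  simp only [Pi.pow_apply]
  field_simp
  ring

lemma continuous_wellPoint (h : EllipticParams a b c d k n) : Continuous (wellPoint a d n) :=
  continuous_iff_continuousAt.2 fun φ => (h.hasDerivAt_wellPoint φ).continuousAt

lemma strictMonoOn_wellPoint (h : EllipticParams a b c d k n) :
    StrictMonoOn (wellPoint a d n) (Icc 0 (π / 2)) := by
  refine strictMonoOn_of_deriv_pos (convex_Icc _ _) h.continuous_wellPoint.continuousOn ?_
  intro φ hφ
  rw [interior_Icc] at hφ
  have hs : 0 < sin φ := sin_pos_of_pos_of_lt_pi hφ.1 (by linarith [hφ.2, pi_pos])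
  have hc : 0 < cos φ := cos_pos_of_mem_Ioo ⟨by linarith [hφ.1, pi_pos], hφ.2⟩
  have hD := h.denom_pos (sin φ)
  have h1 := h.ac_pos
  have h2 := h.cd_pos
  have h3 := h.ad_pos
  rw [(h.hasDerivAt_wellPoint φ).deriv]
  positivity

/-- Change of variables `x = wellPoint a d n φ` in an integral starting at `d`. -/
lemma integral_comp_wellPoint (h : EllipticParams a b c d k n) {φ₀ : ℝ}
    (hφ₀ : φ₀ ∈ Icc 0 (π / 2)) {f g : ℝ → ℝ}
    (hfg : ∀ φ ∈ Ioo 0 φ₀, 2 * (a - d) * (c - d) / (a - c) * (sin φ * cos φ) /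
      (1 - n * sin φ ^ 2) ^ 2 * g (wellPoint a d n φ) = f φ) :
    ∫ x in d..wellPoint a d n φ₀, g x = ∫ φ in (0 : ℝ)..φ₀, f φ := by
  have hsub : ∀ {φ}, φ ∈ Ioo 0 φ₀ → φ ∈ Icc 0 (π / 2) := fun hφ =>
    ⟨hφ.1.le, hφ.2.le.trans hφ₀.2⟩
  have h0 : (0 : ℝ) ∈ Icc 0 (π / 2) := ⟨le_rfl, by positivity⟩
  have hmono := h.strictMonoOn_wellPoint
  have himg : wellPoint a d n '' Ioo 0 φ₀ = Ioo d (wellPoint a d n φ₀) := by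
    ext q
    constructor
    · rintro ⟨φ, hφ, rfl⟩
      refine ⟨?_, hmono (hsub hφ) hφ₀ hφ.2⟩
      have := hmono h0 (hsub hφ) hφ.1
      rwa [wellPoint_zero] at this
    · rintro ⟨h1, h2⟩
      have h3 : wellPoint a d n φ₀ ≤ c := by
        have := hmono.monotoneOn hφ₀ ⟨by positivity, le_rfl⟩ hφ₀.2
        rwa [h.wellPoint_pi_div_two] at this
      have hq : q ∈ Ioo d c := ⟨h1, h2.trans_le h3⟩
      have ha := h.wellAmplitude_mem hq
      refine ⟨wellAmplitude a c d q, ⟨ha.1, ?_⟩, h.wellPoint_wellAmplitude hq⟩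
      rw [← hmono.lt_iff_lt (Ioo_subset_Icc_self ha) hφ₀, h.wellPoint_wellAmplitude hq]
      exact h2
  have hle : d ≤ wellPoint a d n φ₀ := by
    have := hmono.monotoneOn h0 hφ₀ hφ₀.1
    rwa [wellPoint_zero] at this
  -- On open intervals the change-of-variables formula for injective maps asks nothing of `g`, so
  -- integrands singular at the turning points are allowed.
  rw [intervalIntegral.integral_of_le hle, intervalIntegral.integral_of_le hφ₀.1,
    integral_Ioc_eq_integral_Ioo, integral_Ioc_eq_integral_Ioo, ← himg,
    integral_image_eq_integral_abs_deriv_smul measurableSet_Ioo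
      (fun φ _ => (h.hasDerivAt_wellPoint φ).hasDerivWithinAt)
      (hmono.injOn.mono fun φ hφ => hsub hφ)]
  refine setIntegral_congr_fun measurableSet_Ioo fun φ hφ => ?_
  have hs : 0 < sin φ := sin_pos_of_pos_of_lt_pi hφ.1 (by linarith [(hsub hφ).2, pi_pos])
  have hc : 0 < cos φ := cos_pos_of_mem_Ioo ⟨by linarith [hφ.1, pi_pos], hφ.2.trans_le hφ₀.2⟩
  have hD := h.denom_pos (sin φ)
  have h1 := h.ac_pos
  have h2 := h.cd_pos
  have h3 := h.ad_pos
  change |_| • _ = _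
  rw [abs_of_pos (by positivity), smul_eq_mul, hfg φ hφ]

/-- The square root of the quartic along `wellPoint`. -/
lemma sqrt_quartic_wellPoint (h : EllipticParams a b c d k n) {φ B : ℝ} (hB : 0 ≤ B)
    (hφ : φ ∈ Icc 0 (π / 2)) :
    √(B * ((a - wellPoint a d n φ) * (b - wellPoint a d n φ) * (c - wellPoint a d n φ) *
      (wellPoint a d n φ - d))) =
    √(B / ((a - c) * (b - d))) * ((a - d) * (b - d) * (c - d)) *
      (sin φ * cos φ * √(1 - k ^ 2 * sin φ ^ 2)) / (1 - n * sin φ ^ 2) ^ 2 := by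
  have hs : 0 ≤ sin φ := sin_nonneg_of_nonneg_of_le_pi hφ.1 (by linarith [hφ.2, pi_pos])
  have hc : 0 ≤ cos φ := cos_nonneg_of_mem_Icc ⟨by linarith [hφ.1, pi_pos], hφ.2⟩
  have hD := h.denom_pos (sin φ)
  have h1 := h.ac_pos
  have h2 := h.cd_pos
  have h3 := h.ad_pos
  have h4 := h.bd_pos
  have hk := one_sub_sq_mul_sin_sq_pos h.k_sq_lt_one φ
  rw [Real.sqrt_eq_iff_mul_self_eq (by
    obtain ⟨e1, e2, e3, e4⟩ := h.sub_wellPoint φ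
    rw [e1, e2, e3, e4]; positivity) (by positivity), ← sq]
  obtain ⟨e1, e2, e3, e4⟩ := h.sub_wellPoint φ
  rw [e1, e2, e3, e4, div_pow, mul_pow, mul_pow, mul_pow _ (√_), Real.sq_sqrt hk.le,
    Real.sq_sqrt (by positivity)]
  field_simp

/-- The factors `sin φ cos φ` and `(1 - n sin² φ)²` cancel between the Jacobian and the root of the
quartic, leaving the integrand of `F`. -/
lemma integral_inv_sqrt_quartic (h : EllipticParams a b c d k n) {φ₀ B : ℝ} (hB : 0 < B)
    (hφ₀ : φ₀ ∈ Icc 0 (π / 2)) :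
    ∫ x in d..wellPoint a d n φ₀, 1 / √(B * ((a - x) * (b - x) * (c - x) * (x - d))) =
      2 / √(B * ((a - c) * (b - d))) * ellipticF φ₀ k := by
  rw [ellipticF, ← intervalIntegral.integral_const_mul]
  refine h.integral_comp_wellPoint hφ₀ fun φ hφ => ?_
  have hφ' : φ ∈ Icc 0 (π / 2) := ⟨hφ.1.le, hφ.2.le.trans hφ₀.2⟩
  have hs : 0 < sin φ := sin_pos_of_pos_of_lt_pi hφ.1 (by linarith [hφ'.2, pi_pos])
  have hc : 0 < cos φ := cos_pos_of_mem_Ioo ⟨by linarith [hφ.1, pi_pos], hφ.2.trans_le hφ₀.2⟩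
  have hD := h.denom_pos (sin φ)
  have h1 := h.ac_pos
  have h2 := h.cd_pos
  have h3 := h.ad_pos
  have h4 := h.bd_pos
  have hk := Real.sqrt_pos.2 (one_sub_sq_mul_sin_sq_pos h.k_sq_lt_one φ)
  rw [h.sqrt_quartic_wellPoint hB.le hφ']
  have e : √(B / ((a - c) * (b - d))) = √(B * ((a - c) * (b - d))) / ((a - c) * (b - d)) := by
    rw [Real.sqrt_eq_iff_mul_self_eq (by positivity) (by positivity), ← sq, div_pow,
      Real.sq_sqrt (by positivity)]
    field_simp
  rw [e]
  have hr : 0 < √(B * ((a - c) * (b - d))) := Real.sqrt_pos.2 (by positivity)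
  generalize √(B * ((a - c) * (b - d))) = r at *
  generalize √(1 - k ^ 2 * sin φ ^ 2) = Δ at *
  generalize 1 - n * sin φ ^ 2 = D at *
  field_simp

end EllipticParams

/-! ### Reduction of the action integral to the three complete elliptic integrals -/

section Reduction

/-- Coefficient of `E(k)` in the reduction of `∫ √((a - x)(b - x)(c - x)(x - d)) dx`. -/
def coeffE (a b c d : ℝ) : ℝ :=
  (a - c) * (b - d) * (3 * (a + b + c + d) ^ 2 -
    8 * (a * b + a * c + a * d + b * c + b * d + c * d))

/-- Coefficient of `K(k)`. -/
def coeffK (a b c d : ℝ) : ℝ :=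
  (a - c) * (a - d) *
    (3 * a ^ 2 - 6 * a * b - b ^ 2 + 4 * b * (c + d) - 3 * c ^ 2 + 2 * c * d - 3 * d ^ 2)

/-- Coefficient of `Π(n, k)`. -/
def coeffPi (a b c d : ℝ) : ℝ :=
  3 * (a - d) *
    (-3 * a ^ 3 + a * (a + b + c + d) ^ 2 + a ^ 2 * (a + b + c + d)
      - 2 * a * (a * b + a * c + a * d + b * c + b * d + c * d) - b ^ 3 +
      (c + d) * (b ^ 2 - (c - d) ^ 2) + b * (c ^ 2 + d ^ 2)
      - 2 * (a * b * c + a * b * d + a * c * d + b * c * d))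

/-- The polynomial form of the exact-derivative identity, with `S = sin² φ` and `D = 1 - n S`. The
numbers `x`, `y`, `z` are the coefficients of `1/D`, `1/D²`, `1/D³` in the primitive; `y` is read
off at `S = 0`, where the identity says `x + y + z = -(coeffE + coeffK + coeffPi)`. -/
lemma reduction_identity {a b c d : ℝ} (hac : a - c ≠ 0) (hbd : b - d ≠ 0) {k2 n D x y z κ S : ℝ}
    (hk : k2 = (a - b) * (c - d) / ((a - c) * (b - d))) (hn : n = (d - c) / (a - c))
    (hD : D = 1 - n * S) (hκ : κ = (b - d) * (a - d) ^ 2 * (c - d) ^ 2 / (a - c))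
    (hx : x = (b - d) * (c - d) * (3 * (a + b + c + d) ^ 2 -
      8 * (a * b + a * c + a * d + b * c + b * d + c * d)))
    (hz : z = -8 * (b - d) * (a - d) ^ 2 * (c - d))
    (hy : y = -coeffE a b c d - coeffK a b c d - coeffPi a b c d - x - z) :
    48 * κ * (S * (1 - S) * (1 - k2 * S)) - coeffE a b c d * (1 - k2 * S) * D ^ 4
      - coeffK a b c d * D ^ 4 - coeffPi a b c d * D ^ 3 =
    (x * D ^ 3 + y * D ^ 2 + z * D) * ((1 - 2 * S) * (1 - k2 * S) - k2 * (S * (1 - S))) +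
      2 * n * (S * (1 - S) * (1 - k2 * S)) * (x * D ^ 2 + 2 * y * D + 3 * z) := by
  unfold coeffE coeffK coeffPi at *
  subst hD hκ hy hx hz hk hn
  field_simp
  ring

namespace EllipticParams

variable {a b c d k n : ℝ}

/-- The primitive contains the factor `sin φ cos φ`, so integrating this over `[0, π/2]` produces no
boundary terms. -/
lemma hasDerivAt_reduction (h : EllipticParams a b c d k n) {x y z κ : ℝ}
    (hκ : κ = (b - d) * (a - d) ^ 2 * (c - d) ^ 2 / (a - c))
    (hx : x = (b - d) * (c - d) * (3 * (a + b + c + d) ^ 2 -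
      8 * (a * b + a * c + a * d + b * c + b * d + c * d)))
    (hz : z = -8 * (b - d) * (a - d) ^ 2 * (c - d))
    (hy : y = -coeffE a b c d - coeffK a b c d - coeffPi a b c d - x - z) (φ : ℝ) :
    HasDerivAt (fun φ => sin φ * cos φ * √(1 - k ^ 2 * sin φ ^ 2) *
        (x * (1 - n * sin φ ^ 2)⁻¹ + y * (1 - n * sin φ ^ 2)⁻¹ ^ 2 +
          z * (1 - n * sin φ ^ 2)⁻¹ ^ 3))
      (48 * κ * (sin φ ^ 2 * cos φ ^ 2 * √(1 - k ^ 2 * sin φ ^ 2) / (1 - n * sin φ ^ 2) ^ 4) -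
        (coeffE a b c d * √(1 - k ^ 2 * sin φ ^ 2) +
        coeffK a b c d * (1 / √(1 - k ^ 2 * sin φ ^ 2)) +
        coeffPi a b c d * (1 / ((1 - n * sin φ ^ 2) * √(1 - k ^ 2 * sin φ ^ 2))))) φ := by
  have hD := (h.denom_pos (sin φ)).ne'
  have hΔ := one_sub_sq_mul_sin_sq_pos h.k_sq_lt_one φ
  have id := reduction_identity h.ac_pos.ne' h.bd_pos.ne' h.hk h.hn (S := sin φ ^ 2) rfl hκ hx hz hy
  have h1 : HasDerivAt (fun φ => √(1 - k ^ 2 * sin φ ^ 2)) _ φ :=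
    ((((hasDerivAt_sin φ).fun_pow 2).const_mul (k ^ 2)).const_sub 1).sqrt hΔ.ne'
  have h2 : HasDerivAt (fun φ => (1 - n * sin φ ^ 2)⁻¹) _ φ :=
    ((((hasDerivAt_sin φ).fun_pow 2).const_mul n).const_sub 1).fun_inv hD
  have h3 := (((hasDerivAt_sin φ).fun_mul (hasDerivAt_cos φ)).fun_mul h1).fun_mul
    (((h2.const_mul x).fun_add ((h2.fun_pow 2).const_mul y)).fun_add ((h2.fun_pow 3).const_mul z))
  refine h3.congr_deriv ?_
  have hs : √(1 - k ^ 2 * sin φ ^ 2) ^ 2 = 1 - k ^ 2 * sin φ ^ 2 := Real.sq_sqrt hΔ.le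
  have hs0 := (Real.sqrt_pos.2 hΔ).ne'
  have hc : cos φ ^ 2 = 1 - sin φ ^ 2 := cos_sq' φ
  generalize √(1 - k ^ 2 * sin φ ^ 2) = Δ at *
  have hDe : n * sin φ ^ 2 = 1 - (1 - n * sin φ ^ 2) := by ring
  generalize 1 - n * sin φ ^ 2 = D at *
  generalize cos φ = C at *
  generalize sin φ = S at *
  generalize coeffE a b c d = A₁ at *
  generalize coeffK a b c d = A₂ at *
  generalize coeffPi a b c d = A₃ at *
  clear hx hy hz hκ h1 h2 h3 h
  have hk : k ^ 2 * S ^ 2 = 1 - Δ ^ 2 := by linarith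
  push_cast
  simp only [pow_one]
  rw [← sub_eq_zero]
  -- Each side is one of the two derivatives to be compared, multiplied by `Δ D⁴`; this turns
  -- `reduction_identity` into a statement about `C` and `Δ`.
  have key : 48 * κ * (S ^ 2 * C ^ 2 * Δ ^ 2) - A₁ * Δ ^ 2 * D ^ 4 - A₂ * D ^ 4 - A₃ * D ^ 3 =
      (x * D ^ 3 + y * D ^ 2 + z * D) * ((C ^ 2 - S ^ 2) * Δ ^ 2 - k ^ 2 * (S ^ 2 * C ^ 2)) +
      2 * n * (S ^ 2 * C ^ 2 * Δ ^ 2) * (x * D ^ 2 + 2 * y * D + 3 * z) := by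
    rw [hc, hs]
    linear_combination id
  field_simp
  linear_combination -key

end EllipticParams

end Reduction

namespace EllipticParams

variable {a b c d k n : ℝ}

/-- The substitution gives a multiple of the first integrand in `hasDerivAt_reduction`, and
integrating that lemma replaces it by `E`, `K` and `Π`. -/
lemma integral_sqrt_quartic (h : EllipticParams a b c d k n) {B : ℝ} (hB : 0 < B) :
    ∫ x in d..c, √(B * ((a - x) * (b - x) * (c - x) * (x - d))) =
      √(B / ((a - c) * (b - d))) / 24 * (coeffE a b c d * ellipticE k +
        coeffK a b c d * ellipticK k + coeffPi a b c d * ellipticPi n k) := by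
  set κ := (b - d) * (a - d) ^ 2 * (c - d) ^ 2 / (a - c) with hκ
  have hΔ := fun φ => Real.sqrt_pos.2 (one_sub_sq_mul_sin_sq_pos h.k_sq_lt_one φ)
  have hD := fun φ => h.denom_pos (sin φ)
  have c1 : Continuous fun φ : ℝ => √(1 - k ^ 2 * sin φ ^ 2) := by fun_prop
  have c2 : Continuous fun φ : ℝ => 1 / √(1 - k ^ 2 * sin φ ^ 2) :=
    continuous_const.div c1 fun φ => (hΔ φ).ne'
  have c3 : Continuous fun φ : ℝ => 1 / ((1 - n * sin φ ^ 2) * √(1 - k ^ 2 * sin φ ^ 2)) :=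
    continuous_const.div (by fun_prop) fun φ => (mul_pos (hD φ) (hΔ φ)).ne'
  have c4 : Continuous fun φ : ℝ =>
      sin φ ^ 2 * cos φ ^ 2 * √(1 - k ^ 2 * sin φ ^ 2) / (1 - n * sin φ ^ 2) ^ 4 :=
    Continuous.div (by fun_prop) (by fun_prop) fun φ => (pow_pos (hD φ) 4).ne'
  have c5 : Continuous fun φ : ℝ => coeffE a b c d * √(1 - k ^ 2 * sin φ ^ 2) +
      coeffK a b c d * (1 / √(1 - k ^ 2 * sin φ ^ 2)) := (c1.const_mul _).add (c2.const_mul _)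
  have c6 := c3.const_mul (coeffPi a b c d)
  have c7 : Continuous fun φ : ℝ => coeffE a b c d * √(1 - k ^ 2 * sin φ ^ 2) +
      coeffK a b c d * (1 / √(1 - k ^ 2 * sin φ ^ 2)) +
      coeffPi a b c d * (1 / ((1 - n * sin φ ^ 2) * √(1 - k ^ 2 * sin φ ^ 2))) := c5.add c6
  have hint := intervalIntegral.integral_eq_sub_of_hasDerivAt (a := 0) (b := π / 2)
    (fun φ _ => h.hasDerivAt_reduction hκ rfl rfl rfl φ)
    (((c4.const_mul _).sub c7).intervalIntegrable _ _)
  rw [intervalIntegral.integral_sub ((c4.const_mul _).intervalIntegrable _ _)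
    (c7.intervalIntegrable _ _), intervalIntegral.integral_add (c5.intervalIntegrable _ _)
    (c6.intervalIntegrable _ _), intervalIntegral.integral_add
    ((c1.const_mul _).intervalIntegrable _ _) ((c2.const_mul _).intervalIntegrable _ _)] at hint
  simp only [intervalIntegral.integral_const_mul, sin_zero, cos_pi_div_two, zero_mul, mul_zero,
    sub_zero] at hint
  have hsub : ∫ x in d..c, √(B * ((a - x) * (b - x) * (c - x) * (x - d))) =
      ∫ φ in (0 : ℝ)..(π / 2), √(B / ((a - c) * (b - d))) * (2 * κ) *
        (sin φ ^ 2 * cos φ ^ 2 * √(1 - k ^ 2 * sin φ ^ 2) / (1 - n * sin φ ^ 2) ^ 4) := by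
    have hm : π / 2 ∈ Icc 0 (π / 2) := ⟨by positivity, le_rfl⟩
    have := h.integral_comp_wellPoint (g := fun x => √(B * ((a - x) * (b - x) * (c - x) * (x - d))))
      (f := fun φ => √(B / ((a - c) * (b - d))) * (2 * κ) *
        (sin φ ^ 2 * cos φ ^ 2 * √(1 - k ^ 2 * sin φ ^ 2) / (1 - n * sin φ ^ 2) ^ 4)) hm ?_
    · rwa [h.wellPoint_pi_div_two] at this
    intro φ hφ
    rw [h.sqrt_quartic_wellPoint hB.le (Ioo_subset_Icc_self hφ), hκ]
    have h1 := h.ac_pos.ne'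
    have hD' := (hD φ).ne'
    generalize 1 - n * sin φ ^ 2 = D at *
    field_simp
  rw [hsub, intervalIntegral.integral_const_mul]
  unfold ellipticE ellipticK ellipticF ellipticPi
  linear_combination √(B / ((a - c) * (b - d))) / 24 * hint

end EllipticParams

/-! ### The closed form of the action -/

section Action

variable {α β E a b c d : ℝ}

lemma IsOrderedRoots.ellipticParams (h : IsOrderedRoots α β E a b c d) :
    EllipticParams a b c d √((a - b) * (c - d) / ((a - c) * (b - d))) ((d - c) / (a - c)) := by
  obtain ⟨hab, hbc, hcd, -⟩ := h
  have h1 := sub_pos.2 hab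
  have h2 := sub_pos.2 hcd
  have h3 := sub_pos.2 (hbc.trans hab)
  have h4 := sub_pos.2 (hcd.trans hbc)
  exact ⟨hab, hbc, hcd, Real.sqrt_pos.2 (by positivity), Real.sq_sqrt (by positivity), rfl⟩

lemma IsOrderedRoots.ellipticParams_roots
    (h : IsOrderedRoots α β E (rootA α β E) (rootB α β E) (rootC α β E) (rootD α β E)) :
    EllipticParams (rootA α β E) (rootB α β E) (rootC α β E) (rootD α β E) (modulus α β E)
      (gammaSq α β E) :=
  h.ellipticParams

lemma IsOrderedRoots.momentum_eq (h : IsOrderedRoots α β E a b c d) (q : ℝ) :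
    momentum α β E q = √(β / 2 * ((a - q) * (b - q) * (c - q) * (q - d))) := by
  rw [momentum, h.sub_V]
  ring_nf

lemma action_eq_integral (α β E : ℝ) :
    action α β E = 1 / π * ∫ q in (rootD α β E)..(rootC α β E), momentum α β E q := by
  rw [action, intervalIntegral.integral_neg, ← intervalIntegral.integral_symm]
  ring

/-- The reduction produces coefficients in the roots alone; Vieta's relations trade the first two
symmetric functions for `α` and `β`. -/
lemma action_eq_actionClosedForm (hβ : 0 < β)
    (h : IsOrderedRoots α β E (rootA α β E) (rootB α β E) (rootC α β E) (rootD α β E)) :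
    action α β E = actionClosedForm α β E := by
  have hp := h.ellipticParams_roots
  have h1 := hp.ac_pos
  have h2 := hp.bd_pos
  simp only [action_eq_integral, h.momentum_eq, hp.integral_sqrt_quartic (half_pos hβ)]
  unfold actionClosedForm
  obtain ⟨v1, v2, v3, -⟩ := h.vieta
  generalize rootA α β E = a at *
  generalize rootB α β E = b at *
  generalize rootC α β E = c at *
  generalize rootD α β E = d at *
  have hα : α = -(3 * β / 4) * (a + b + c + d) := by linarith
  have e2 : 1 / β = (a * b + a * c + a * d + b * c + b * d + c * d) / 2 := by
    field_simp; linarith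
  -- `V` has no linear term, so the third symmetric function vanishes; `coeffPi` contains a multiple
  -- of it that is absent from the closed form.
  have v3' : a * b * c + a * b * d + a * c * d + b * c * d = 0 := by
    simpa [hβ.ne'] using v3
  have f1 : 16 * (α ^ 2 - 3 * β) / (3 * β ^ 2) = 3 * (a + b + c + d) ^ 2 -
      8 * (a * b + a * c + a * d + b * c + b * d + c * d) := by
    rw [hα]
    have : 16 * ((-(3 * β / 4) * (a + b + c + d)) ^ 2 - 3 * β) / (3 * β ^ 2) =
      3 * (a + b + c + d) ^ 2 - 16 * (1 / β) := by field_simp; ring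
    rw [this, e2]; ring
  have f2 : 16 * α ^ 2 * a / (9 * β ^ 2) = a * (a + b + c + d) ^ 2 := by
    rw [hα]; field_simp; ring
  have f3 : 4 * a * (a * α + 3) / (3 * β) = -a ^ 2 * (a + b + c + d) + 2 * a *
      (a * b + a * c + a * d + b * c + b * d + c * d) := by
    rw [hα]
    have : 4 * a * (a * (-(3 * β / 4) * (a + b + c + d)) + 3) / (3 * β) =
      -a ^ 2 * (a + b + c + d) + 4 * a * (1 / β) := by field_simp
    rw [this, e2]; ring
  have f4 : √(β / 2 / ((a - c) * (b - d))) = √(2 * β / ((a - c) * (b - d))) / 2 := by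
    rw [show β / 2 / ((a - c) * (b - d)) = 2 * β / ((a - c) * (b - d)) / 2 ^ 2 by ring,
      Real.sqrt_div (by positivity), Real.sqrt_sq (by norm_num)]
  have hA : coeffE a b c d = (a - c) * (b - d) * (3 * (a + b + c + d) ^ 2 -
      8 * (a * b + a * c + a * d + b * c + b * d + c * d)) := rfl
  have hC : coeffPi a b c d = 3 * (a - d) * (-3 * a ^ 3 + a * (a + b + c + d) ^ 2 -
      (-a ^ 2 * (a + b + c + d) + 2 * a * (a * b + a * c + a * d + b * c + b * d + c * d))
       - b ^ 3 + (c + d) * (b ^ 2 - (c - d) ^ 2) + b * (c ^ 2 + d ^ 2)) := by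
    unfold coeffPi
    linear_combination -6 * (a - d) * v3'
  dsimp only
  rw [f1, f2, f3, f4, hA, hC]
  unfold coeffK
  have := pi_pos.ne'
  field_simp
  ring

end Action

/-! ### Differentiating `∫ p dx` in the energy -/

section Frequency

/-- Off `ξ = v` the integrand is the derivative of the monotone function `√(2(ξ - v))`, and
derivatives of monotone functions are integrable. Below `v` the conventions `√` of a negative number
`= 0` and `1 / 0 = 0` are consistent with this. -/
lemma intervalIntegrable_inv_sqrt (v E₁ E₂ : ℝ) :
    IntervalIntegrable (fun ξ => 1 / √(2 * (ξ - v))) volume E₁ E₂ := by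
  have hmono : Monotone fun ξ => √(2 * (ξ - v)) := fun x y hxy =>
    Real.sqrt_le_sqrt (by linarith)
  refine (hmono.monotoneOn (uIcc E₁ E₂)).intervalIntegrable_deriv.congr_ae ?_
  refine ae_restrict_of_ae ?_
  have : ∀ᵐ ξ : ℝ, ξ ≠ v := by simp [ae_iff, measure_singleton]
  filter_upwards [this] with ξ hξ
  have h : HasDerivAt (fun ξ => √(2 * (ξ - v))) _ ξ :=
    (((hasDerivAt_id ξ).sub_const v).const_mul 2).sqrt
      (mul_ne_zero two_ne_zero (sub_ne_zero.2 hξ))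
  rw [h.deriv]
  simp only [id, mul_one]
  rw [← div_div, div_self two_ne_zero]

lemma integral_inv_sqrt (v E₁ E₂ : ℝ) :
    ∫ ξ in E₁..E₂, 1 / √(2 * (ξ - v)) = √(2 * (E₂ - v)) - √(2 * (E₁ - v)) := by
  refine integral_eq_of_hasDerivAt_off_countable (fun ξ => √(2 * (ξ - v))) _
    (countable_singleton v) (by fun_prop) (fun ξ hξ => ?_) (intervalIntegrable_inv_sqrt v E₁ E₂)
  have h : HasDerivAt (fun ξ => √(2 * (ξ - v))) _ ξ :=
    (((hasDerivAt_id ξ).sub_const v).const_mul 2).sqrt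
      (mul_ne_zero two_ne_zero (sub_ne_zero.2 hξ.2))
  refine h.congr_deriv ?_
  simp only [id, mul_one]
  rw [← div_div, div_self two_ne_zero]

/-- Write the difference of square roots as an integral over the energy and exchange the order.
Integrability on the product is direct: the inner energy integral of the nonnegative integrand is a
continuous function of `x`. -/
lemma integral_sqrt_sub_integral_sqrt {U : ℝ → ℝ} (hU : Continuous U) (d₀ q₁ E₁ E₂ : ℝ) :
    (∫ x in d₀..q₁, √(2 * (E₂ - U x))) - (∫ x in d₀..q₁, √(2 * (E₁ - U x))) =
      ∫ ξ in E₁..E₂, ∫ x in d₀..q₁, 1 / √(2 * (ξ - U x)) := by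
  wlog hE : E₁ ≤ E₂ generalizing E₁ E₂
  · rw [intervalIntegral.integral_symm E₂ E₁, ← this E₂ E₁ (le_of_not_ge hE), neg_sub]
  have hc : ∀ E, Continuous fun x => √(2 * (E - U x)) := fun E => by fun_prop
  rw [← intervalIntegral.integral_sub ((hc _).intervalIntegrable _ _)
    ((hc _).intervalIntegrable _ _), intervalIntegral_intervalIntegral_swap]
  · exact intervalIntegral.integral_congr fun x _ => (integral_inv_sqrt (U x) E₁ E₂).symm
  · have hmeas : Measurable (Function.uncurry fun ξ x => 1 / √(2 * (ξ - U x))) := by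
      have := hU.measurable
      unfold Function.uncurry
      fun_prop
    have hint : ∀ x, IntegrableOn (fun ξ => 1 / √(2 * (ξ - U x))) (uIoc E₁ E₂) := fun x =>
      intervalIntegrable_iff.1 (intervalIntegrable_inv_sqrt (U x) E₁ E₂)
    rw [IntegrableOn, Measure.volume_eq_prod, ← Measure.prod_restrict, integrable_prod_iff'
      hmeas.aestronglyMeasurable]
    refine ⟨Eventually.of_forall hint, ?_⟩
    have : ∀ x, ∫ ξ in uIoc E₁ E₂, ‖Function.uncurry (fun ξ x => 1 / √(2 * (ξ - U x))) (ξ, x)‖ =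
        √(2 * (E₂ - U x)) - √(2 * (E₁ - U x)) := by
      intro x
      rw [← integral_inv_sqrt, intervalIntegral.integral_of_le hE, uIoc_of_le hE]
      refine setIntegral_congr_fun measurableSet_Ioc fun ξ _ => ?_
      exact Real.norm_of_nonneg (one_div_nonneg.2 (Real.sqrt_nonneg _))
    simp only [this]
    exact intervalIntegrable_iff.1 (((hc _).sub (hc _)).intervalIntegrable _ _)

/-- By the previous identity this is the fundamental theorem of calculus in the energy. Only
continuity of the period integral is required, and its closed form `T` provides that; no dominating
function near the turning points is needed. -/
lemma hasDerivAt_integral_sqrt {U T : ℝ → ℝ} (hU : Continuous U) {d₀ q₁ E : ℝ}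
    (hT : ∀ᶠ ξ in 𝓝 E, (∫ x in d₀..q₁, 1 / √(2 * (ξ - U x))) = T ξ ∧ ContinuousAt T ξ) :
    HasDerivAt (fun E => ∫ x in d₀..q₁, √(2 * (E - U x))) (T E) E := by
  obtain ⟨u, hu, huo, hEu⟩ := eventually_nhds_iff.1 hT
  have hfc : ∀ ξ ∈ u, ContinuousAt (fun ξ => ∫ x in d₀..q₁, 1 / √(2 * (ξ - U x))) ξ :=
    fun ξ hξ => (hu ξ hξ).2.congr (by
      filter_upwards [huo.mem_nhds hξ] with η hη using (hu η hη).1.symm)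
  have h := intervalIntegral.integral_hasDerivAt_right (a := E) (b := E)
    IntervalIntegrable.refl (ContinuousAt.stronglyMeasurableAtFilter huo hfc E hEu) (hfc E hEu)
  rw [(hu E hEu).1] at h
  have h2 := h.add_const (∫ x in d₀..q₁, √(2 * (E - U x)))
  refine h2.congr_of_eventuallyEq (Eventually.of_forall fun ξ => ?_)
  dsimp only
  rw [← integral_sqrt_sub_integral_sqrt hU, sub_add_cancel]

/-- Used to exchange the turning points, which depend on the energy, for fixed endpoints in the
forbidden region, where `√(2(E - V))` and its reciprocal are both `0`. -/
lemma integral_eq_of_forall_eq_zero {f : ℝ → ℝ} {d₀ d q q₁ : ℝ} (h₀ : d₀ ≤ d) (h : d ≤ q)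
    (h₁ : q ≤ q₁) (hl : ∀ x ∈ Icc d₀ d, f x = 0) (hr : ∀ x ∈ Ioc q q₁, f x = 0) :
    ∫ x in d₀..q₁, f x = ∫ x in d..q, f x := by
  rw [intervalIntegral.integral_of_le (h₀.trans (h.trans h₁)), intervalIntegral.integral_of_le h]
  refine setIntegral_eq_of_subset_of_forall_sdiff_eq_zero measurableSet_Ioc
    (Ioc_subset_Ioc h₀ h₁) fun x hx => ?_
  by_cases hxd : x ≤ d
  · exact hl x ⟨hx.1.1.le, hxd⟩
  · exact hr x ⟨not_le.1 fun hxq => hx.2 ⟨not_le.1 hxd, hxq⟩, hx.1.2⟩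

end Frequency

/-- `α, β` define a double well, and `E` is an energy of bounded motion around the origin. -/
structure IsWellEnergy (α β E : ℝ) : Prop where
  hα : α < 0
  hβ : 0 < β
  hβα : β < 2 * α ^ 2 / 9
  mem : E ∈ Ioo 0 (EMax α β)

/-- Half of the period of the motion divided by `K(k)`. -/
noncomputable def timeScale (α β E : ℝ) : ℝ := 2 / √(β / 2 * crossProd α β E)

/-! ### Frequency, inverse of the action, and the angle -/

namespace IsWellEnergy

variable {α β E q : ℝ}

lemma ordered (h : IsWellEnergy α β E) :
    IsOrderedRoots α β E (rootA α β E) (rootB α β E) (rootC α β E) (rootD α β E) :=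
  (isOrderedRoots_roots h.hα h.hβ h.hβα h.mem).1

lemma params (h : IsWellEnergy α β E) :
    EllipticParams (rootA α β E) (rootB α β E) (rootC α β E) (rootD α β E) (modulus α β E)
      (gammaSq α β E) := h.ordered.ellipticParams_roots

lemma eventually (h : IsWellEnergy α β E) : ∀ᶠ ξ in 𝓝 E, IsWellEnergy α β ξ := by
  filter_upwards [isOpen_Ioo.mem_nhds h.mem] with ξ hξ using ⟨h.hα, h.hβ, h.hβα, hξ⟩

lemma differentiableAt_rootA (h : IsWellEnergy α β E) : DifferentiableAt ℝ (rootA α β) E :=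
  (differentiableAt_roots h.hα h.hβ h.hβα h.mem).1

lemma differentiableAt_rootB (h : IsWellEnergy α β E) : DifferentiableAt ℝ (rootB α β) E :=
  (differentiableAt_roots h.hα h.hβ h.hβα h.mem).2.1

lemma differentiableAt_rootC (h : IsWellEnergy α β E) : DifferentiableAt ℝ (rootC α β) E :=
  (differentiableAt_roots h.hα h.hβ h.hβα h.mem).2.2.1

lemma differentiableAt_rootD (h : IsWellEnergy α β E) : DifferentiableAt ℝ (rootD α β) E :=
  (differentiableAt_roots h.hα h.hβ h.hβα h.mem).2.2.2

lemma crossProd_pos (h : IsWellEnergy α β E) : 0 < crossProd α β E :=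
  mul_pos h.params.ac_pos h.params.bd_pos

lemma differentiableAt_crossProd (h : IsWellEnergy α β E) :
    DifferentiableAt ℝ (crossProd α β) E :=
  (h.differentiableAt_rootA.sub h.differentiableAt_rootC).mul
    (h.differentiableAt_rootB.sub h.differentiableAt_rootD)

lemma differentiableAt_modulus (h : IsWellEnergy α β E) :
    DifferentiableAt ℝ (modulus α β) E := by
  have h1 := h.params.ab_pos
  have h2 := h.params.cd_pos
  have h3 := h.crossProd_pos
  exact (((h.differentiableAt_rootA.sub h.differentiableAt_rootB).mul
    (h.differentiableAt_rootC.sub h.differentiableAt_rootD)).fun_div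
    h.differentiableAt_crossProd h3.ne').sqrt
    (div_pos (mul_pos h1 h2) h3).ne'

lemma differentiableAt_coModulus (h : IsWellEnergy α β E) :
    DifferentiableAt ℝ (coModulus α β) E :=
  ((h.differentiableAt_modulus.pow 2).const_sub 1).sqrt (sub_pos.2 h.params.k_sq_lt_one).ne'

lemma coModulus_sq (h : IsWellEnergy α β E) : coModulus α β E ^ 2 = 1 - modulus α β E ^ 2 :=
  Real.sq_sqrt (sub_pos.2 h.params.k_sq_lt_one).le

lemma coModulus_sq_lt_one (h : IsWellEnergy α β E) : coModulus α β E ^ 2 < 1 := by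
  rw [h.coModulus_sq]
  have := pow_pos h.params.hk0 2
  linarith

lemma differentiableAt_amplitude (h : IsWellEnergy α β E)
    (hq : q ∈ Ioo (rootD α β E) (rootC α β E)) :
    DifferentiableAt ℝ (fun ξ => amplitude α β ξ q) E := by
  have h1 := h.params.ac_pos
  have h2 := h.params.cd_pos
  have h3 : 0 < rootA α β E - q := by linarith [hq.2]
  have h4 : 0 < q - rootD α β E := sub_pos.2 hq.1
  have hm := h.params.wellAmplitude_mem hq
  have hr : DifferentiableAt ℝ (fun ξ => √((rootA α β ξ - rootC α β ξ) * (q - rootD α β ξ) /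
      ((rootC α β ξ - rootD α β ξ) * (rootA α β ξ - q)))) E :=
    ((((h.differentiableAt_rootA.sub h.differentiableAt_rootC).mul
      (h.differentiableAt_rootD.const_sub q)).fun_div
      ((h.differentiableAt_rootC.sub h.differentiableAt_rootD).mul
      (h.differentiableAt_rootA.sub_const q)) (mul_pos h2 h3).ne').sqrt
      (div_pos (mul_pos h1 h4) (mul_pos h2 h3)).ne')
  refine DifferentiableAt.comp E (differentiableAt_arcsin.2 ⟨?_, ?_⟩) hr
  · exact ((by norm_num : (-1 : ℝ) < 0).trans_le (Real.sqrt_nonneg _)).ne'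
  · exact (arcsin_lt_pi_div_two.1 hm.2).ne

lemma timeScale_pos (h : IsWellEnergy α β E) : 0 < timeScale α β E :=
  div_pos two_pos (Real.sqrt_pos.2 (mul_pos (half_pos h.hβ) h.crossProd_pos))

lemma differentiableAt_timeScale (h : IsWellEnergy α β E) :
    DifferentiableAt ℝ (timeScale α β) E := by
  have hp := mul_pos (half_pos h.hβ) h.crossProd_pos
  exact (differentiableAt_const _).fun_div
    ((h.differentiableAt_crossProd.const_mul _).sqrt hp.ne') (Real.sqrt_pos.2 hp).ne'

lemma timeScale_eq (h : IsWellEnergy α β E) :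
    timeScale α β E = 2 * √(2 / (β * crossProd α β E)) := by
  have h1 := h.hβ
  have h2 := h.crossProd_pos
  rw [timeScale, show 2 / (β * crossProd α β E) = (β / 2 * crossProd α β E)⁻¹ by field_simp,
    Real.sqrt_inv, div_eq_mul_inv]

lemma sub_V_nonpos_of_le (h : IsWellEnergy α β E) {x : ℝ} (hx : x ≤ rootD α β E) :
    E - V α β x ≤ 0 := by
  have hp := h.params
  have h1 : 0 ≤ rootC α β E - x := by linarith [hp.hcd]
  have h2 : 0 ≤ rootB α β E - x := by linarith [hp.hbc]
  have h3 : 0 ≤ rootA α β E - x := by linarith [hp.hab]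
  have h4 : x - rootD α β E ≤ 0 := sub_nonpos.2 hx
  have hβ := h.hβ
  rw [h.ordered.sub_V]
  exact mul_nonpos_of_nonneg_of_nonpos (by positivity)
    (mul_nonpos_of_nonneg_of_nonpos (by positivity) h4)

lemma sub_V_nonpos_of_mem (h : IsWellEnergy α β E) {x : ℝ}
    (hx : x ∈ Icc (rootC α β E) (rootB α β E)) : E - V α β x ≤ 0 := by
  have hp := h.params
  have h1 : 0 ≤ x - rootD α β E := by linarith [hp.hcd, hx.1]
  have h2 : 0 ≤ rootB α β E - x := by linarith [hx.2]
  have h3 : 0 ≤ rootA α β E - x := by linarith [hp.hab, hx.2]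
  have h4 : rootC α β E - x ≤ 0 := sub_nonpos.2 hx.1
  have hβ := h.hβ
  rw [h.ordered.sub_V]
  exact mul_nonpos_of_nonneg_of_nonpos (by positivity)
    (mul_nonpos_of_nonpos_of_nonneg (mul_nonpos_of_nonneg_of_nonpos (by positivity) h4) h1)

lemma sub_V_pos (h : IsWellEnergy α β E) (hq : q ∈ Ioo (rootD α β E) (rootC α β E)) :
    0 < E - V α β q := by
  have hp := h.params
  have h1 : 0 < q - rootD α β E := sub_pos.2 hq.1
  have h2 : 0 < rootC α β E - q := sub_pos.2 hq.2
  have h3 : 0 < rootB α β E - q := by linarith [hp.hbc]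
  have h4 : 0 < rootA α β E - q := by linarith [hp.hab]
  have hβ := h.hβ
  rw [h.ordered.sub_V]
  positivity

lemma sqrt_sub_V_eq_zero_of_le (h : IsWellEnergy α β E) {x : ℝ} (hx : x ≤ rootD α β E) :
    √(2 * (E - V α β x)) = 0 :=
  Real.sqrt_eq_zero_of_nonpos (by linarith [h.sub_V_nonpos_of_le hx])

lemma sqrt_sub_V_eq_zero_of_mem (h : IsWellEnergy α β E) {x : ℝ}
    (hx : x ∈ Icc (rootC α β E) (rootB α β E)) : √(2 * (E - V α β x)) = 0 :=
  Real.sqrt_eq_zero_of_nonpos (by linarith [h.sub_V_nonpos_of_mem hx])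

lemma integral_inv_momentum (h : IsWellEnergy α β E) {φ₀ : ℝ} (hφ₀ : φ₀ ∈ Icc 0 (π / 2)) :
    ∫ x in (rootD α β E)..(wellPoint (rootA α β E) (rootD α β E) (gammaSq α β E) φ₀),
      1 / √(2 * (E - V α β x)) = timeScale α β E * ellipticF φ₀ (modulus α β E) := by
  rw [timeScale, crossProd, ← h.params.integral_inv_sqrt_quartic (half_pos h.hβ) hφ₀]
  refine intervalIntegral.integral_congr fun x _ => ?_
  rw [h.ordered.sub_V]
  congr 2
  ring

lemma continuous_V (α β : ℝ) : Continuous (V α β) := by unfold V; fun_prop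

/-- The derivative of the abbreviated action on the upper branch. -/
lemma hasDerivAt_integral_momentum (h : IsWellEnergy α β E)
    (hq : q ∈ Ioo (rootD α β E) (rootC α β E)) :
    HasDerivAt (fun ξ => ∫ x in (rootD α β ξ)..q, momentum α β ξ x)
      (timeScale α β E * ellipticF (amplitude α β E q) (modulus α β E)) E := by
  have hev : ∀ᶠ ξ in 𝓝 E, IsWellEnergy α β ξ ∧ rootD α β E - 1 < rootD α β ξ ∧
      rootD α β ξ < q ∧ q < rootC α β ξ :=
    h.eventually.and (((h.differentiableAt_rootD.continuousAt.eventually_const_lt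
      (sub_one_lt _))).and ((h.differentiableAt_rootD.continuousAt.eventually_lt_const hq.1).and
      (h.differentiableAt_rootC.continuousAt.eventually_const_lt hq.2)))
  -- The fixed left endpoint `rootD α β E - 1` lies below the turning point for all nearby energies,
  -- and the integrand vanishes in between.
  have h1 := hasDerivAt_integral_sqrt (continuous_V α β) (d₀ := rootD α β E - 1) (q₁ := q)
    (T := fun ξ => timeScale α β ξ * ellipticF (amplitude α β ξ q) (modulus α β ξ)) (E := E) ?_
  · refine h1.congr_of_eventuallyEq ?_
    filter_upwards [hev] with ξ hξ
    refine (integral_eq_of_forall_eq_zero hξ.2.1.le hξ.2.2.1.le le_rfl (fun x hx => ?_)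
      (fun x hx => ?_)).symm
    · exact hξ.1.sqrt_sub_V_eq_zero_of_le hx.2
    · exact absurd hx.1 (not_lt.2 hx.2)
  · filter_upwards [hev] with ξ hξ
    have hqξ : q ∈ Ioo (rootD α β ξ) (rootC α β ξ) := hξ.2.2
    refine ⟨?_, ?_⟩
    · rw [integral_eq_of_forall_eq_zero hξ.2.1.le hξ.2.2.1.le le_rfl (fun x hx => ?_)
        (fun x hx => absurd hx.1 (not_lt.2 hx.2))]
      · have hm := hξ.1.params.wellAmplitude_mem hqξ
        have := hξ.1.integral_inv_momentum (Ioo_subset_Icc_self hm)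
        rwa [hξ.1.params.wellPoint_wellAmplitude hqξ] at this
      · rw [hξ.1.sqrt_sub_V_eq_zero_of_le hx.2, div_zero]
    · exact (hξ.1.differentiableAt_timeScale.mul (differentiableAt_ellipticF_comp
        (hξ.1.differentiableAt_amplitude hqξ) hξ.1.differentiableAt_modulus
        hξ.1.params.k_sq_lt_one)).continuousAt

/-- The barrier top `qThres` separates `c` from `b` at every energy of the well, so it can serve as
the fixed right endpoint. -/
lemma hasDerivAt_integral_momentum_full (h : IsWellEnergy α β E) :
    HasDerivAt (fun ξ => ∫ x in (rootD α β ξ)..(rootC α β ξ), momentum α β ξ x)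
      (timeScale α β E * ellipticK (modulus α β E)) E := by
  have hs : ∀ {ξ}, IsWellEnergy α β ξ → rootC α β ξ < qThres α β ∧ qThres α β < rootB α β ξ :=
    fun hξ => ⟨(isOrderedRoots_roots hξ.hα hξ.hβ hξ.hβα hξ.mem).2.2.1,
      (isOrderedRoots_roots hξ.hα hξ.hβ hξ.hβα hξ.mem).2.1⟩
  have hev : ∀ᶠ ξ in 𝓝 E, IsWellEnergy α β ξ ∧ rootD α β E - 1 < rootD α β ξ :=
    h.eventually.and ((h.differentiableAt_rootD.continuousAt.eventually_const_lt (sub_one_lt _)))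
  have h1 := hasDerivAt_integral_sqrt (continuous_V α β) (d₀ := rootD α β E - 1)
    (q₁ := qThres α β)
    (T := fun ξ => timeScale α β ξ * ellipticK (modulus α β ξ)) (E := E) ?_
  · refine h1.congr_of_eventuallyEq ?_
    filter_upwards [hev] with ξ hξ
    refine (integral_eq_of_forall_eq_zero hξ.2.le hξ.1.params.hcd.le (hs hξ.1).1.le
      (fun x hx => ?_) (fun x hx => ?_)).symm
    · exact hξ.1.sqrt_sub_V_eq_zero_of_le hx.2
    · exact hξ.1.sqrt_sub_V_eq_zero_of_mem ⟨hx.1.le, hx.2.trans (hs hξ.1).2.le⟩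
  · filter_upwards [hev] with ξ hξ
    refine ⟨?_, ?_⟩
    · rw [integral_eq_of_forall_eq_zero hξ.2.le hξ.1.params.hcd.le (hs hξ.1).1.le
        (fun x hx => ?_) (fun x hx => ?_)]
      · have := hξ.1.integral_inv_momentum (φ₀ := π / 2) ⟨by positivity, le_rfl⟩
        rwa [hξ.1.params.wellPoint_pi_div_two] at this
      · rw [hξ.1.sqrt_sub_V_eq_zero_of_le hx.2, div_zero]
      · rw [hξ.1.sqrt_sub_V_eq_zero_of_mem ⟨hx.1.le, hx.2.trans (hs hξ.1).2.le⟩, div_zero]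
    · exact (hξ.1.differentiableAt_timeScale.mul (differentiableAt_ellipticK_comp
        hξ.1.differentiableAt_modulus hξ.1.params.k_sq_lt_one)).continuousAt

lemma hasDerivAt_action (h : IsWellEnergy α β E) :
    HasDerivAt (action α β) (1 / π * (timeScale α β E * ellipticK (modulus α β E))) E := by
  refine (h.hasDerivAt_integral_momentum_full.const_mul (1 / π)).congr_of_eventuallyEq ?_
  exact Eventually.of_forall fun ξ => action_eq_integral α β ξ

lemma deriv_action_pos (h : IsWellEnergy α β E) :
    0 < 1 / π * (timeScale α β E * ellipticK (modulus α β E)) :=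
  mul_pos (one_div_pos.2 pi_pos)
    (mul_pos h.timeScale_pos (ellipticK_pos h.params.k_sq_lt_one))

lemma strictMonoOn_action (hα : α < 0) (hβ : 0 < β) (hβα : β < 2 * α ^ 2 / 9) :
    StrictMonoOn (action α β) (Ioo 0 (EMax α β)) := by
  have hw : ∀ {ξ}, ξ ∈ Ioo 0 (EMax α β) → IsWellEnergy α β ξ := fun hξ => ⟨hα, hβ, hβα, hξ⟩
  refine strictMonoOn_of_deriv_pos (convex_Ioo _ _)
    (fun ξ hξ => (hw hξ).hasDerivAt_action.continuousAt.continuousWithinAt) fun ξ hξ => ?_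
  rw [interior_Ioo] at hξ
  rw [(hw hξ).hasDerivAt_action.deriv]
  exact (hw hξ).deriv_action_pos

lemma energyOfAction_action (h : IsWellEnergy α β E) : energyOfAction α β (action α β E) = E :=
  (strictMonoOn_action h.hα h.hβ h.hβα).injOn.leftInvOn_invFunOn h.mem

lemma hasDerivAt_energyOfAction (h : IsWellEnergy α β E) :
    HasDerivAt (energyOfAction α β) (1 / π * (timeScale α β E * ellipticK (modulus α β E)))⁻¹
      (action α β E) := by
  -- Continuity of the derivative in the energy upgrades it to a strict derivative, as the inverse
  -- function rule requires.
  have hs : HasStrictDerivAt (action α β)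
      (1 / π * (timeScale α β E * ellipticK (modulus α β E))) E := by
    refine hasStrictDerivAt_of_hasDerivAt_of_continuousAt
      (f' := fun ξ => 1 / π * (timeScale α β ξ * ellipticK (modulus α β ξ)))
      (h.eventually.mono fun ξ hξ => hξ.hasDerivAt_action) ?_
    exact ((h.differentiableAt_timeScale.mul (differentiableAt_ellipticK_comp
      h.differentiableAt_modulus h.params.k_sq_lt_one)).const_mul _).continuousAt
  exact (hs.to_local_left_inverse h.deriv_action_pos.ne'
    (h.eventually.mono fun ξ hξ => hξ.energyOfAction_action)).hasDerivAt

lemma hasDerivAt_comp_energyOfAction (h : IsWellEnergy α β E) {S : ℝ → ℝ} {S' : ℝ}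
    (hS : HasDerivAt S S' E) :
    HasDerivAt (fun J => S (energyOfAction α β J))
      (S' * (1 / π * (timeScale α β E * ellipticK (modulus α β E)))⁻¹) (action α β E) := by
  refine HasDerivAt.comp (h₂ := S) _ ?_ h.hasDerivAt_energyOfAction
  rwa [h.energyOfAction_action]

/-- By the chain rule the angle is the energy derivative of the abbreviated action divided by
`dI/dE`; `timeScale` cancels in the quotient. -/
lemma isAngle_of_pos (h : IsWellEnergy α β E) {p : ℝ} (hE : hamiltonian α β q p = E)
    (hq : q ∈ Ioo (rootD α β E) (rootC α β E)) (hp : 0 < p) :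
    IsAngle α β q p
      (π * ellipticF (amplitude α β E q) (modulus α β E) / ellipticK (modulus α β E)) := by
  have h1 := h.hasDerivAt_comp_energyOfAction (h.hasDerivAt_integral_momentum hq)
  rw [IsAngle, hE]
  simp only [abbreviatedAction, if_pos hp.le]
  refine h1.congr_deriv ?_
  have h2 := h.timeScale_pos.ne'
  have h3 := (ellipticK_pos h.params.k_sq_lt_one).ne'
  have h4 := pi_pos.ne'
  field_simp

lemma continuous_momentum (α β E : ℝ) : Continuous (momentum α β E) := by
  unfold momentum V; fun_prop

/-- On the way back the abbreviated action is twice the full integral over `[d, c]` minus the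
integral over `[d, q]`. -/
lemma isAngle_of_neg (h : IsWellEnergy α β E) {p : ℝ} (hE : hamiltonian α β q p = E)
    (hq : q ∈ Ioo (rootD α β E) (rootC α β E)) (hp : p < 0) :
    IsAngle α β q p (2 * π -
      π * ellipticF (amplitude α β E q) (modulus α β E) / ellipticK (modulus α β E)) := by
  have h1 := h.hasDerivAt_comp_energyOfAction
    ((h.hasDerivAt_integral_momentum_full.const_mul 2).sub (h.hasDerivAt_integral_momentum hq))
  rw [IsAngle, hE]
  simp only [abbreviatedAction, if_neg hp.not_ge]
  refine (h1.congr_deriv ?_).congr_of_eventuallyEq (Eventually.of_forall fun J => ?_)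
  · have h2 := h.timeScale_pos.ne'
    have h3 := (ellipticK_pos h.params.k_sq_lt_one).ne'
    have h4 := pi_pos.ne'
    field_simp
  · have hi := fun u v => (continuous_momentum α β (energyOfAction α β J)).intervalIntegrable
      (μ := volume) u v
    have := intervalIntegral.integral_add_adjacent_intervals
      (hi (rootD α β (energyOfAction α β J)) q) (hi q (rootC α β (energyOfAction α β J)))
    simp only [Pi.sub_apply]
    rw [intervalIntegral.integral_neg, intervalIntegral.integral_symm q, neg_neg]
    linarith

end IsWellEnergy

/-! ### The position as a function of the angle -/

namespace IsWellEnergy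

variable {α β E : ℝ}

/-- Exhibits the position as `wellPoint` after the Jacobi amplitude, so that monotonicity and
inversion reduce to those two maps. -/
lemma position_eq (α β E θ : ℝ) : position α β E θ = wellPoint (rootA α β E) (rootD α β E)
    (gammaSq α β E) (jacobiAm (ellipticK (modulus α β E) / π * θ) (modulus α β E)) := rfl

lemma continuous_position (h : IsWellEnergy α β E) : Continuous (position α β E) :=
  h.params.continuous_wellPoint.comp ((continuous_jacobiAm h.params.k_sq_lt_one).comp
    (continuous_const_mul _))

lemma periodic_position (h : IsWellEnergy α β E) :
    Function.Periodic (position α β E) (2 * π) := fun θ => by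
  have h1 : ellipticK (modulus α β E) / π * (θ + 2 * π) =
      ellipticK (modulus α β E) / π * θ + 2 * ellipticK (modulus α β E) := by
    have := pi_pos.ne'
    field_simp
  simp only [position]
  rw [h1, jacobiSn_add_two_mul_ellipticK h.params.k_sq_lt_one, neg_sq]

lemma position_neg (h : IsWellEnergy α β E) (θ : ℝ) :
    position α β E (-θ) = position α β E θ := by
  simp only [position]
  rw [mul_neg, jacobiSn_neg h.params.k_sq_lt_one, neg_sq]

lemma position_two_pi_sub (h : IsWellEnergy α β E) (θ : ℝ) :
    position α β E (2 * π - θ) = position α β E θ := by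
  rw [sub_eq_neg_add, h.periodic_position, h.position_neg]

lemma jacobiAm_mem (h : IsWellEnergy α β E) {θ : ℝ} (hθ : θ ∈ Ioo 0 π) :
    jacobiAm (ellipticK (modulus α β E) / π * θ) (modulus α β E) ∈ Ioo 0 (π / 2) := by
  have hK := ellipticK_pos h.params.k_sq_lt_one
  refine jacobiAm_mem_Ioo h.params.k_sq_lt_one ⟨mul_pos (div_pos hK pi_pos) hθ.1, ?_⟩
  rw [div_mul_eq_mul_div, div_lt_iff₀ pi_pos]
  exact mul_lt_mul_of_pos_left hθ.2 hK

lemma position_zero (h : IsWellEnergy α β E) : position α β E 0 = rootD α β E := by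
  rw [position_eq, mul_zero, jacobiAm_zero h.params.k_sq_lt_one, EllipticParams.wellPoint_zero]

lemma position_pi (h : IsWellEnergy α β E) : position α β E π = rootC α β E := by
  rw [position_eq, div_mul_cancel₀ _ pi_pos.ne', jacobiAm_ellipticK h.params.k_sq_lt_one,
    h.params.wellPoint_pi_div_two]

lemma strictMonoOn_position (h : IsWellEnergy α β E) :
    StrictMonoOn (position α β E) (Icc 0 π) := by
  have hk := h.params.k_sq_lt_one
  have hK := ellipticK_pos hk
  have hm : StrictMono fun θ => jacobiAm (ellipticK (modulus α β E) / π * θ) (modulus α β E) :=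
    (strictMono_jacobiAm hk).comp fun x y hxy => mul_lt_mul_of_pos_left hxy (div_pos hK pi_pos)
  refine h.params.strictMonoOn_wellPoint.comp (hm.strictMonoOn _) fun θ hθ => ⟨?_, ?_⟩
  · simpa [jacobiAm_zero hk] using hm.monotone hθ.1
  · have := hm.monotone hθ.2
    simpa only [div_mul_cancel₀ _ pi_pos.ne', jacobiAm_ellipticK hk] using this

lemma bijOn_position (h : IsWellEnergy α β E) :
    BijOn (position α β E) (Icc 0 π) (Icc (rootD α β E) (rootC α β E)) := by
  have hm := h.strictMonoOn_position
  have h0 : (0 : ℝ) ∈ Icc 0 π := ⟨le_rfl, pi_pos.le⟩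
  have hp : π ∈ Icc 0 π := ⟨pi_pos.le, le_rfl⟩
  refine ⟨fun θ hθ => ?_, hm.injOn, ?_⟩
  · rw [← h.position_zero, ← h.position_pi]
    exact ⟨hm.monotoneOn h0 hθ hθ.1, hm.monotoneOn hθ hp hθ.2⟩
  · rw [← h.position_zero, ← h.position_pi]
    exact intermediate_value_Icc pi_pos.le h.continuous_position.continuousOn

/-- The reflection `θ ↦ 2π - θ` leaves the position unchanged and exchanges the two half-periods. -/
lemma bijOn_position' (h : IsWellEnergy α β E) :
    BijOn (position α β E) (Icc π (2 * π)) (Icc (rootD α β E) (rootC α β E)) := by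
  have h1 : BijOn (fun θ => 2 * π - θ) (Icc π (2 * π)) (Icc 0 π) := by
    refine ⟨fun θ hθ => ⟨by linarith [hθ.2], by linarith [hθ.1]⟩, fun x _ y _ hxy => ?_,
      fun θ hθ => ⟨2 * π - θ, ⟨by linarith [hθ.2], by linarith [hθ.1]⟩, by ring⟩⟩
    simpa using hxy
  exact (h.bijOn_position.comp h1).congr fun θ _ => h.position_two_pi_sub θ

lemma position_mem (h : IsWellEnergy α β E) {θ : ℝ} (hθ : θ ∈ Ioo 0 π) :
    position α β E θ ∈ Ioo (rootD α β E) (rootC α β E) :=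
  h.params.wellPoint_mem (h.jacobiAm_mem hθ)

lemma angle_position (h : IsWellEnergy α β E) {θ : ℝ} (hθ : θ ∈ Ioo 0 π) :
    π * ellipticF (amplitude α β E (position α β E θ)) (modulus α β E) /
      ellipticK (modulus α β E) = θ := by
  have h1 : amplitude α β E (position α β E θ) =
      jacobiAm (ellipticK (modulus α β E) / π * θ) (modulus α β E) :=
    h.params.wellAmplitude_wellPoint (Ioo_subset_Icc_self (h.jacobiAm_mem hθ))
  have hK := (ellipticK_pos h.params.k_sq_lt_one).ne'
  rw [h1, ellipticF_jacobiAm h.params.k_sq_lt_one]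
  have := pi_pos.ne'
  field_simp

lemma momentum_pos (h : IsWellEnergy α β E) {q : ℝ}
    (hq : q ∈ Ioo (rootD α β E) (rootC α β E)) : 0 < momentum α β E q :=
  Real.sqrt_pos.2 (mul_pos two_pos (h.sub_V_pos hq))

lemma momentum_sq (h : IsWellEnergy α β E) {q : ℝ}
    (hq : q ∈ Ioo (rootD α β E) (rootC α β E)) :
    momentum α β E q ^ 2 = 2 * (E - V α β q) :=
  Real.sq_sqrt (mul_pos two_pos (h.sub_V_pos hq)).le

lemma isAngle_position (h : IsWellEnergy α β E) {θ : ℝ} (hθ : θ ∈ Ioo 0 π) :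
    IsAngle α β (position α β E θ) (momentum α β E (position α β E θ)) θ := by
  have hq := h.position_mem hθ
  have := h.isAngle_of_pos (by rw [hamiltonian, h.momentum_sq hq]; ring) hq (h.momentum_pos hq)
  rwa [h.angle_position hθ] at this

lemma isAngle_position' (h : IsWellEnergy α β E) {θ : ℝ} (hθ : θ ∈ Ioo π (2 * π)) :
    IsAngle α β (position α β E θ) (-momentum α β E (position α β E θ)) θ := by
  have hθ' : 2 * π - θ ∈ Ioo 0 π := ⟨by linarith [hθ.2], by linarith [hθ.1]⟩
  have hq := h.position_mem hθ'
  have := h.isAngle_of_neg (by rw [hamiltonian, neg_sq, h.momentum_sq hq]; ring) hq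
    (neg_lt_zero.2 (h.momentum_pos hq))
  rwa [h.angle_position hθ', h.position_two_pi_sub, sub_sub_cancel] at this

end IsWellEnergy

/-! ### Cauchy-Riemann equations and shifting horizontal contours -/

section CauchyRiemann

/-- Joint real differentiability is assumed, so partial derivatives determine the Fréchet
derivative; the Cauchy-Riemann equations make it complex linear. -/
lemma hasDerivAt_of_cauchyRiemann {U W : ℝ → ℝ → ℝ} {z : ℂ} {u v : ℝ}
    (hU : DifferentiableAt ℝ (Function.uncurry U) (z.re, z.im))
    (hW : DifferentiableAt ℝ (Function.uncurry W) (z.re, z.im))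
    (hUx : HasDerivAt (fun t => U t z.im) u z.re) (hUy : HasDerivAt (fun t => U z.re t) (-v) z.im)
    (hWx : HasDerivAt (fun t => W t z.im) v z.re) (hWy : HasDerivAt (fun t => W z.re t) u z.im) :
    HasDerivAt (fun w : ℂ => (U w.re w.im : ℂ) + W w.re w.im * Complex.I) (u + v * Complex.I) z := by
  have hx : ∀ {X : ℝ → ℝ → ℝ} {x' : ℝ} (hX : DifferentiableAt ℝ (Function.uncurry X) (z.re, z.im)),
      HasDerivAt (fun t => X t z.im) x' z.re →
      fderiv ℝ (Function.uncurry X) (z.re, z.im) (1, 0) = x' := by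
    intro X x' hX h
    have h1 := HasFDerivAt.comp_hasDerivAt (l := Function.uncurry X) (f := fun t : ℝ => (t, z.im))
      z.re hX.hasFDerivAt ((hasDerivAt_id z.re).prodMk (hasDerivAt_const z.re z.im))
    exact h1.unique h
  have hy : ∀ {X : ℝ → ℝ → ℝ} {x' : ℝ} (hX : DifferentiableAt ℝ (Function.uncurry X) (z.re, z.im)),
      HasDerivAt (fun t => X z.re t) x' z.im →
      fderiv ℝ (Function.uncurry X) (z.re, z.im) (0, 1) = x' := by
    intro X x' hX h
    have h1 := HasFDerivAt.comp_hasDerivAt (l := Function.uncurry X) (f := fun t : ℝ => (z.re, t))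
      z.im hX.hasFDerivAt ((hasDerivAt_const z.im z.re).prodMk (hasDerivAt_id z.im))
    exact h1.unique h
  have hc : ∀ {X : ℝ → ℝ → ℝ}, DifferentiableAt ℝ (Function.uncurry X) (z.re, z.im) →
      HasFDerivAt (fun w : ℂ => (X w.re w.im : ℂ)) (Complex.ofRealCLM ∘L
        (fderiv ℝ (Function.uncurry X) (z.re, z.im) ∘L
          (Complex.equivRealProdCLM : ℂ →L[ℝ] ℝ × ℝ))) z := by
    intro X hX
    have h1 : HasFDerivAt (fun w : ℂ => Function.uncurry X (Complex.equivRealProdCLM w))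
        (fderiv ℝ (Function.uncurry X) (z.re, z.im) ∘L
          (Complex.equivRealProdCLM : ℂ →L[ℝ] ℝ × ℝ)) z :=
      HasFDerivAt.comp (g := Function.uncurry X) z hX.hasFDerivAt
        Complex.equivRealProdCLM.hasFDerivAt
    exact Complex.ofRealCLM.hasFDerivAt.comp z h1
  have h := (hc hU).add ((hc hW).mul_const Complex.I)
  have h2 := HasFDerivAt.complexOfReal_hasFDerivAt h (by
    simp [hx hU hUx, hx hW hWx, hy hU hUy, hy hW hWy]
    linear_combination (-(v : ℂ)) * Complex.I_mul_I)
  refine h2.hasDerivAt.congr_deriv ?_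
  simp [hx hU hUx, hx hW hWx]
  ring

/-- A holomorphic function taking equal values on the two vertical sides of a rectangle has equal
integrals over the two horizontal sides. -/
lemma integral_horizontal_eq {g : ℂ → ℂ} {K y₁ y₂ : ℝ} (hK : 0 ≤ K) (hy : y₁ ≤ y₂)
    {s : Set ℂ} (hs : s.Countable)
    (hc : ContinuousOn g (Icc (-K) K ×ℂ Icc y₁ y₂))
    (hd : ∀ z ∈ Ioo (-K) K ×ℂ Ioo y₁ y₂ \ s, DifferentiableAt ℂ g z)
    (hp : ∀ y ∈ Icc y₁ y₂, g (K + y * Complex.I) = g (-K + y * Complex.I)) :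
    ∫ x in (-K)..K, g (x + y₁ * Complex.I) = ∫ x in (-K)..K, g (x + y₂ * Complex.I) := by
  have hKK : -K ≤ K := by linarith
  have h := Complex.integral_boundary_rect_eq_zero_of_differentiable_on_off_countable g
    ⟨-K, y₁⟩ ⟨K, y₂⟩ s hs (by simpa only [uIcc_of_le hKK, uIcc_of_le hy] using hc)
    (by simpa only [min_eq_left hKK, max_eq_right hKK, min_eq_left hy, max_eq_right hy] using hd)
  have hv : ∫ y in y₁..y₂, g (K + y * Complex.I) = ∫ y in y₁..y₂, g ((-K : ℝ) + y * Complex.I) :=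
    intervalIntegral.integral_congr fun y hy' => by
      rw [uIcc_of_le hy] at hy'
      simpa using hp y hy'
  dsimp only at h
  rw [hv, add_sub_cancel_right, sub_eq_zero] at h
  exact h

end CauchyRiemann

/-! ### The function `1 / sn` of a complex variable -/

section ComplexSn

/-- The squared modulus of the numerator of `sn(x + i y)`, up to the denominator. -/
noncomputable def nsDenom (k k' x y : ℝ) : ℝ :=
  jacobiSn x k ^ 2 * jacobiCn y k' ^ 2 + jacobiSn y k' ^ 2

noncomputable def nsRe (k k' x y : ℝ) : ℝ := jacobiSn x k * jacobiDn y k' / nsDenom k k' x y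

noncomputable def nsIm (k k' x y : ℝ) : ℝ :=
  -(jacobiCn x k * jacobiDn x k * (jacobiSn y k' * jacobiCn y k')) / nsDenom k k' x y

/-- The function `1 / sn(z, k)` of a complex variable. -/
noncomputable def jacobiNs (k k' : ℝ) (z : ℂ) : ℂ :=
  nsRe k k' z.re z.im + nsIm k k' z.re z.im * Complex.I

variable {k k' : ℝ}

lemma differentiableAt_jacobi_fst (hk : k ^ 2 < 1) (p : ℝ × ℝ) :
    DifferentiableAt ℝ (fun p : ℝ × ℝ => jacobiSn p.1 k) p ∧
    DifferentiableAt ℝ (fun p : ℝ × ℝ => jacobiCn p.1 k) p ∧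
    DifferentiableAt ℝ (fun p : ℝ × ℝ => jacobiDn p.1 k) p :=
  ⟨(hasDerivAt_jacobiSn hk p.1).differentiableAt.comp p differentiableAt_fst,
    (hasDerivAt_jacobiCn hk p.1).differentiableAt.comp p differentiableAt_fst,
    (hasDerivAt_jacobiDn hk p.1).differentiableAt.comp p differentiableAt_fst⟩

lemma differentiableAt_jacobi_snd (hk : k ^ 2 < 1) (p : ℝ × ℝ) :
    DifferentiableAt ℝ (fun p : ℝ × ℝ => jacobiSn p.2 k) p ∧
    DifferentiableAt ℝ (fun p : ℝ × ℝ => jacobiCn p.2 k) p ∧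
    DifferentiableAt ℝ (fun p : ℝ × ℝ => jacobiDn p.2 k) p :=
  ⟨(hasDerivAt_jacobiSn hk p.2).differentiableAt.comp p differentiableAt_snd,
    (hasDerivAt_jacobiCn hk p.2).differentiableAt.comp p differentiableAt_snd,
    (hasDerivAt_jacobiDn hk p.2).differentiableAt.comp p differentiableAt_snd⟩

/-- The Cauchy-Riemann equations follow from the real derivatives and `k² + k'² = 1`. Using `1 / sn`
avoids the pole of `sn` at `iK'`. The imaginary part `v` matters only on the imaginary axis, where
it is zero. -/
lemma hasDerivAt_jacobiNs (hk : k ^ 2 < 1) (hkk : k' ^ 2 = 1 - k ^ 2) (hk0 : k ≠ 0) {z : ℂ}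
    (hz : nsDenom k k' z.re z.im ≠ 0) :
    ∃ v : ℝ, HasDerivAt (jacobiNs k k')
      ((jacobiCn z.re k * jacobiDn z.re k * jacobiDn z.im k' *
        (jacobiSn z.im k' ^ 2 - jacobiSn z.re k ^ 2 * jacobiCn z.im k' ^ 2) /
          nsDenom k k' z.re z.im ^ 2 : ℝ) + v * Complex.I) z ∧ (jacobiSn z.re k = 0 → v = 0) := by
  have hk' : k' ^ 2 < 1 := by rw [hkk]; have := pow_pos (sq_pos_of_ne_zero hk0) 1; linarith
  obtain ⟨s1, c1, d1⟩ := differentiableAt_jacobi_fst hk (z.re, z.im)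
  obtain ⟨s2, c2, d2⟩ := differentiableAt_jacobi_snd hk' (z.re, z.im)
  have hP : DifferentiableAt ℝ (fun p : ℝ × ℝ => nsDenom k k' p.1 p.2) (z.re, z.im) :=
    ((s1.pow 2).mul (c2.pow 2)).add (s2.pow 2)
  have hU : DifferentiableAt ℝ (Function.uncurry (nsRe k k')) (z.re, z.im) :=
    (s1.fun_mul d2).fun_mul (hP.fun_inv hz)
  have hW : DifferentiableAt ℝ (Function.uncurry (nsIm k k')) (z.re, z.im) :=
    ((c1.fun_mul d1).fun_mul (s2.fun_mul c2)).fun_neg.fun_mul (hP.fun_inv hz)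
  have qc := jacobiCn_sq z.re k
  have qd := jacobiDn_sq hk z.re
  have qc' := jacobiCn_sq z.im k'
  have qd' := jacobiDn_sq hk' z.im
  have xs := hasDerivAt_jacobiSn hk z.re
  have xc := hasDerivAt_jacobiCn hk z.re
  have xd := hasDerivAt_jacobiDn hk z.re
  have ys := hasDerivAt_jacobiSn hk' z.im
  have yc := hasDerivAt_jacobiCn hk' z.im
  have yd := hasDerivAt_jacobiDn hk' z.im
  have xP : HasDerivAt (fun t => nsDenom k k' t z.im) _ z.re :=
    (((xs.fun_pow 2).mul_const (jacobiCn z.im k' ^ 2)).add_const (jacobiSn z.im k' ^ 2))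
  have yP : HasDerivAt (fun t => nsDenom k k' z.re t) _ z.im :=
    (((yc.fun_pow 2).const_mul (jacobiSn z.re k ^ 2)).fun_add (ys.fun_pow 2))
  have Ux : HasDerivAt (fun t => nsRe k k' t z.im) _ z.re :=
    (xs.mul_const (jacobiDn z.im k')).fun_div xP hz
  have Uy : HasDerivAt (fun t => nsRe k k' z.re t) _ z.im :=
    (yd.const_mul (jacobiSn z.re k)).fun_div yP hz
  have Wx : HasDerivAt (fun t => nsIm k k' t z.im) _ z.re :=
    ((xc.fun_mul xd).mul_const (jacobiSn z.im k' * jacobiCn z.im k')).fun_neg.fun_div xP hz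
  have Wy : HasDerivAt (fun t => nsIm k k' z.re t) _ z.im :=
    ((ys.fun_mul yc).const_mul (jacobiCn z.re k * jacobiDn z.re k)).fun_neg.fun_div yP hz
  have hPd : nsDenom k k' z.re z.im = jacobiSn z.re k ^ 2 * jacobiCn z.im k' ^ 2
    + jacobiSn z.im k' ^ 2 := rfl
  generalize nsDenom k k' z.re z.im = P at *
  generalize jacobiSn z.re k = s at *
  generalize jacobiCn z.re k = c at *
  generalize jacobiDn z.re k = d at *
  generalize jacobiSn z.im k' = S at *
  generalize jacobiCn z.im k' = C at *
  generalize jacobiDn z.im k' = D at *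
  refine ⟨s * S * C * (k' ^ 2 * P + 2 * D ^ 2 * c ^ 2) / P ^ 2,
    hasDerivAt_of_cauchyRiemann hU hW (Ux.congr_deriv ?_) (Uy.congr_deriv ?_) (Wx.congr_deriv ?_)
      (Wy.congr_deriv ?_), fun h => by simp [h]⟩
  · congr 1
    push_cast
    rw [pow_one]
    linear_combination c * d * D * hPd
  · rw [← neg_div]
    congr 1
    push_cast
    rw [pow_one, pow_one]
    linear_combination (2 * s * D ^ 2 * S * C) * qc
  · congr 1
    push_cast
    rw [pow_one]
    have e : k' ^ 2 * P + 2 * D ^ 2 * c ^ 2 = (d ^ 2 + k ^ 2 * c ^ 2) * P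
        + 2 * c ^ 2 * d ^ 2 * C ^ 2 := by
      rw [hPd, qc, qd, qc', qd', hkk]; ring
    linear_combination -(s * S * C) * e
  · congr 1
    push_cast
    rw [pow_one, pow_one]
    have e : (C ^ 2 - S ^ 2) * P - 2 * S ^ 2 * C ^ 2 * (1 - s ^ 2) = s ^ 2 * C ^ 2 - S ^ 2 := by
      rw [hPd, qc']; ring
    linear_combination -(c * d * D) * e

end ComplexSn

/-! ### Signs, symmetries and edge values of `sn` and `1 / sn` -/

section ComplexSn

variable {k k' : ℝ}

lemma jacobiAm_mem_Icc (hk : k ^ 2 < 1) {u : ℝ}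
    (hu : u ∈ Icc (-ellipticK k) (ellipticK k)) : jacobiAm u k ∈ Icc (-(π / 2)) (π / 2) := by
  rw [← jacobiAm_ellipticK hk, ← jacobiAm_neg hk]
  exact ⟨(strictMono_jacobiAm hk).monotone hu.1, (strictMono_jacobiAm hk).monotone hu.2⟩

lemma jacobiSn_pos (hk : k ^ 2 < 1) {u : ℝ} (hu : u ∈ Ioc 0 (ellipticK k)) :
    0 < jacobiSn u k := by
  have h1 := strictMono_jacobiAm hk hu.1
  have h2 := jacobiAm_mem_Icc hk ⟨by linarith [hu.1, hu.2], hu.2⟩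
  simp only [jacobiAm_zero hk] at h1
  exact sin_pos_of_pos_of_lt_pi h1 (by linarith [h2.2, pi_pos])

lemma jacobiCn_pos (hk : k ^ 2 < 1) {u : ℝ} (hu : u ∈ Ico 0 (ellipticK k)) :
    0 < jacobiCn u k := by
  have h1 := strictMono_jacobiAm hk hu.2
  have h2 := jacobiAm_mem_Icc hk ⟨by linarith [hu.1, hu.2], hu.2.le⟩
  have h3 := (strictMono_jacobiAm hk).monotone hu.1
  simp only [jacobiAm_zero hk] at h3
  simp only [jacobiAm_ellipticK hk] at h1
  exact cos_pos_of_mem_Ioo ⟨by linarith [pi_pos], h1⟩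

lemma jacobiCn_zero (hk : k ^ 2 < 1) : jacobiCn 0 k = 1 := by simp [jacobiCn, jacobiAm_zero hk]

lemma jacobiDn_zero (hk : k ^ 2 < 1) : jacobiDn 0 k = 1 := by simp [jacobiDn, jacobiSn_zero hk]

lemma eq_zero_of_jacobiSn_eq_zero (hk : k ^ 2 < 1) {u : ℝ}
    (hu : u ∈ Icc (-ellipticK k) (ellipticK k)) (h : jacobiSn u k = 0) : u = 0 := by
  have h2 := jacobiAm_mem_Icc hk hu
  have h3 : jacobiAm u k = 0 := (sin_eq_zero_iff_of_lt_of_lt (by linarith [h2.1, pi_pos])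
    (by linarith [h2.2, pi_pos])).1 h
  exact (strictMono_jacobiAm hk).injective (h3.trans (jacobiAm_zero hk).symm)

lemma strictAntiOn_jacobiCn (hk : k ^ 2 < 1) :
    StrictAntiOn (fun u => jacobiCn u k) (Icc 0 (ellipticK k)) := by
  refine strictAntiOn_of_deriv_neg (convex_Icc _ _)
    (fun u _ => (hasDerivAt_jacobiCn hk u).continuousAt.continuousWithinAt) fun u hu => ?_
  rw [interior_Icc] at hu
  rw [(hasDerivAt_jacobiCn hk u).deriv, neg_lt_zero]
  exact mul_pos (jacobiSn_pos hk ⟨hu.1, hu.2.le⟩) (jacobiDn_pos hk u)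

lemma continuous_jacobi (hk : k ^ 2 < 1) :
    (Continuous fun u => jacobiSn u k) ∧ (Continuous fun u => jacobiCn u k) ∧
      Continuous fun u => jacobiDn u k :=
  ⟨continuous_iff_continuousAt.2 fun u => (hasDerivAt_jacobiSn hk u).continuousAt,
    continuous_iff_continuousAt.2 fun u => (hasDerivAt_jacobiCn hk u).continuousAt,
    continuous_iff_continuousAt.2 fun u => (hasDerivAt_jacobiDn hk u).continuousAt⟩

/-- The denominator of `sn(x + i y)`. -/
noncomputable def snDenom (k k' x y : ℝ) : ℝ :=
  jacobiCn y k' ^ 2 + k ^ 2 * jacobiSn x k ^ 2 * jacobiSn y k' ^ 2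

/-- The function `sn(z, k)` of a complex variable. -/
noncomputable def complexSn (k k' : ℝ) (z : ℂ) : ℂ :=
  ((jacobiSn z.re k * jacobiDn z.im k' : ℝ) + (jacobiCn z.re k * jacobiDn z.re k *
    (jacobiSn z.im k' * jacobiCn z.im k') : ℝ) * Complex.I) / (snDenom k k' z.re z.im : ℝ)

lemma nsDenom_pos {x y : ℝ} (h : jacobiSn y k' ≠ 0) : 0 < nsDenom k k' x y :=
  add_pos_of_nonneg_of_pos (by positivity) (by positivity)

lemma snDenom_pos {x y : ℝ} (h : jacobiCn y k' ≠ 0) : 0 < snDenom k k' x y :=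
  add_pos_of_pos_of_nonneg (by positivity) (by positivity)

/-- The two numerators are complex conjugates, and their product is the product of the two
denominators. -/
lemma complexSn_mul_jacobiNs (hk : k ^ 2 < 1) (hk' : k' ^ 2 < 1) (hkk : k' ^ 2 = 1 - k ^ 2)
    {z : ℂ} (hs : jacobiSn z.im k' ≠ 0) (hc : jacobiCn z.im k' ≠ 0) :
    complexSn k k' z * jacobiNs k k' z = 1 := by
  have hP : (nsDenom k k' z.re z.im : ℂ) ≠ 0 := by exact_mod_cast (nsDenom_pos hs).ne'
  have hM : (snDenom k k' z.re z.im : ℂ) ≠ 0 := by exact_mod_cast (snDenom_pos hc).ne'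
  have e : (jacobiSn z.re k * jacobiDn z.im k') ^ 2 + (jacobiCn z.re k * jacobiDn z.re k *
      (jacobiSn z.im k' * jacobiCn z.im k')) ^ 2 = snDenom k k' z.re z.im * nsDenom k k' z.re z.im
      := by
    unfold snDenom nsDenom
    simp only [mul_pow, jacobiDn_sq hk, jacobiDn_sq hk', jacobiCn_sq, hkk]
    ring
  have e' : ((jacobiSn z.re k : ℂ) * jacobiDn z.im k') ^ 2 + (jacobiCn z.re k * jacobiDn z.re k *
      (jacobiSn z.im k' * jacobiCn z.im k')) ^ 2 = snDenom k k' z.re z.im * nsDenom k k' z.re z.im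
      := by exact_mod_cast e
  unfold complexSn jacobiNs nsRe nsIm
  push_cast
  field_simp
  linear_combination e' - (jacobiCn z.re k * jacobiDn z.re k *
      (jacobiSn z.im k' * jacobiCn z.im k')) ^ 2 * Complex.I_sq

lemma continuousAt_complexSn (hk : k ^ 2 < 1) (hk' : k' ^ 2 < 1) {z : ℂ}
    (hc : jacobiCn z.im k' ≠ 0) : ContinuousAt (complexSn k k') z := by
  obtain ⟨s1, c1, d1⟩ := continuous_jacobi hk
  obtain ⟨s2, c2, d2⟩ := continuous_jacobi hk'
  have h1 := Complex.continuous_re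
  have h2 := Complex.continuous_im
  have hs1 := s1.comp h1
  have hc1 := c1.comp h1
  have hd1 := d1.comp h1
  have hs2 := s2.comp h2
  have hc2 := c2.comp h2
  have hd2 := d2.comp h2
  simp only [Function.comp_def] at *
  have hM : Continuous fun z : ℂ => (snDenom k k' z.re z.im : ℂ) := by
    unfold snDenom; fun_prop
  refine ContinuousAt.div (Continuous.continuousAt ?_) hM.continuousAt
    (by exact_mod_cast (snDenom_pos hc).ne')
  fun_prop

lemma complexSn_ofReal (hk' : k' ^ 2 < 1) (x : ℝ) : complexSn k k' x = jacobiSn x k := by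
  simp [complexSn, snDenom, jacobiSn_zero hk', jacobiCn_zero hk', jacobiDn_zero hk']

/-- At `y = K'` one has `sn = 1`, `cn = 0`, `dn = k` for the modulus `k'`. Thus on the upper edge
the square of `1 / sn` is again real and even in `x`. -/
lemma jacobiNs_add_ellipticK (hk' : k' ^ 2 < 1) (hkk : k' ^ 2 = 1 - k ^ 2)
    (hk0 : 0 < k) (x : ℝ) :
    jacobiNs k k' (x + ellipticK k' * Complex.I) = (k * jacobiSn x k : ℝ) := by
  have hd : jacobiDn (ellipticK k') k' = k := by
    rw [jacobiDn, jacobiSn_ellipticK hk', hkk, show 1 - (1 - k ^ 2) * 1 ^ 2 = k ^ 2 by ring,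
      Real.sqrt_sq hk0.le]
  simp [jacobiNs, nsRe, nsIm, nsDenom, jacobiSn_ellipticK hk', jacobiCn_ellipticK hk', hd]
  ring

lemma jacobiNs_periodic (hk : k ^ 2 < 1) (y : ℝ) :
    jacobiNs k k' (ellipticK k + y * Complex.I) =
      -jacobiNs k k' (-ellipticK k + y * Complex.I) := by
  have h : -ellipticK k + 2 * ellipticK k = ellipticK k := by ring
  have hs := jacobiSn_add_two_mul_ellipticK hk (-ellipticK k)
  have hc := jacobiCn_add_two_mul_ellipticK hk (-ellipticK k)
  have hd := jacobiDn_add_two_mul_ellipticK hk (-ellipticK k)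
  rw [h] at hs hc hd
  simp [jacobiNs, nsRe, nsIm, nsDenom, hs, hc, hd]
  ring

lemma complexSn_periodic (hk : k ^ 2 < 1) (y : ℝ) :
    complexSn k k' (ellipticK k + y * Complex.I) =
      -complexSn k k' (-ellipticK k + y * Complex.I) := by
  have h : -ellipticK k + 2 * ellipticK k = ellipticK k := by ring
  have hs := jacobiSn_add_two_mul_ellipticK hk (-ellipticK k)
  have hc := jacobiCn_add_two_mul_ellipticK hk (-ellipticK k)
  have hd := jacobiDn_add_two_mul_ellipticK hk (-ellipticK k)
  rw [h] at hs hc hd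
  simp [complexSn, snDenom, hs, hc, hd]
  ring

lemma jacobiNs_I_mul (hk : k ^ 2 < 1) {y : ℝ} (hs : jacobiSn y k' ≠ 0) :
    jacobiNs k k' (y * Complex.I) = -(jacobiCn y k' / jacobiSn y k' : ℝ) * Complex.I := by
  have : (jacobiSn y k' : ℂ) ≠ 0 := by exact_mod_cast hs
  simp [jacobiNs, nsRe, nsIm, nsDenom, jacobiSn_zero hk, jacobiCn_zero hk, jacobiDn_zero hk]
  field_simp

/-- `1 / sn` takes a square-negative value only on the imaginary axis. -/
lemma eq_of_jacobiNs_sq_eq (hk : k ^ 2 < 1) (hk' : k' ^ 2 < 1) {n ν : ℝ} (hn : n < 0)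
    (hν : ν ∈ Ioo 0 (ellipticK k')) (hcn : jacobiCn ν k' ^ 2 * (1 - n) = -n) {z : ℂ}
    (hx : z.re ∈ Icc (-ellipticK k) (ellipticK k)) (hy : z.im ∈ Ioc 0 (ellipticK k'))
    (h : jacobiNs k k' z ^ 2 = n) : z = ν * Complex.I := by
  have hs := jacobiSn_pos hk' hy
  have hP := (nsDenom_pos (k := k) (x := z.re) hs.ne').ne'
  have hre := congrArg Complex.re h
  have him := congrArg Complex.im h
  simp [jacobiNs, sq] at hre him
  -- The square is real, so one of the two parts vanishes; it is negative, so the real part does.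
  have hA : nsRe k k' z.re z.im = 0 := by
    by_contra hA
    have hB : nsIm k k' z.re z.im = 0 := by
      have : nsRe k k' z.re z.im * nsIm k k' z.re z.im = 0 := by linarith
      exact (mul_eq_zero.1 this).resolve_left hA
    rw [hB] at hre
    nlinarith [mul_self_nonneg (nsRe k k' z.re z.im)]
  have hx0 : z.re = 0 := by
    refine eq_zero_of_jacobiSn_eq_zero hk hx ?_
    rw [nsRe, div_eq_zero_iff, or_iff_left hP, mul_eq_zero] at hA
    exact hA.resolve_right (jacobiDn_pos hk' _).ne'
  rw [hA] at hre
  have hB : nsIm k k' z.re z.im = -(jacobiCn z.im k' / jacobiSn z.im k') := by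
    simp [hx0, nsIm, nsDenom, jacobiSn_zero hk, jacobiCn_zero hk, jacobiDn_zero hk]
    field_simp
  have hc2 : jacobiCn z.im k' ^ 2 * (1 - n) = -n := by
    rw [hB] at hre
    field_simp at hre
    have hs2 : jacobiSn z.im k' ^ 2 = 1 - jacobiCn z.im k' ^ 2 := by
      rw [jacobiCn_sq]; ring
    rw [hs2] at hre
    linarith
  have hc3 : jacobiCn z.im k' = jacobiCn ν k' := by
    have hc0 : 0 ≤ jacobiCn z.im k' := by
      rcases hy.2.lt_or_eq with h1 | h1
      · exact (jacobiCn_pos hk' ⟨hy.1.le, h1⟩).le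
      · rw [h1, jacobiCn_ellipticK hk']
    have hc1 := (jacobiCn_pos hk' ⟨hν.1.le, hν.2⟩).le
    rw [← sq_eq_sq₀ hc0 hc1]
    exact mul_right_cancel₀ (by linarith : 1 - n ≠ 0) (hc2.trans hcn.symm)
  have hyν : z.im = ν := (strictAntiOn_jacobiCn hk').injOn ⟨hy.1.le, hy.2⟩
    ⟨hν.1.le, hν.2.le⟩ hc3
  apply Complex.ext <;> simp [hx0, hyν]

end ComplexSn

/-! ### Exponential modes and a model function with one pole -/

section ExponentialKernel

/-- The exponential `exp (i π m z / K)`. -/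
noncomputable def expMode (K : ℝ) (m : ℤ) (z : ℂ) : ℂ := Complex.exp (Complex.I * π * m * z / K)

lemma expMode_add (K : ℝ) (m l : ℤ) (z : ℂ) :
    expMode K (m + l) z = expMode K m z * expMode K l z := by
  unfold expMode
  rw [← Complex.exp_add]
  push_cast
  ring_nf

lemma differentiable_expMode (K : ℝ) (m : ℤ) : Differentiable ℂ (expMode K m) := by
  unfold expMode; fun_prop

lemma expMode_zero (K : ℝ) (z : ℂ) : expMode K 0 z = 1 := by simp [expMode]

lemma expMode_periodic {K : ℝ} (hK : K ≠ 0) (m : ℤ) (y : ℝ) :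
    expMode K m (K + y * Complex.I) = expMode K m (-K + y * Complex.I) := by
  have hK' : (K : ℂ) ≠ 0 := by exact_mod_cast hK
  unfold expMode
  rw [Complex.exp_eq_exp_iff_exists_int]
  refine ⟨m, ?_⟩
  field_simp
  ring

lemma expMode_add_mul_I (K : ℝ) (m : ℤ) (x y : ℝ) :
    expMode K m (x + y * Complex.I) = expMode K m x * (Real.exp (-(m * (π * y / K))) : ℝ) := by
  unfold expMode
  rw [Complex.ofReal_exp, ← Complex.exp_add]
  congr 1
  push_cast
  linear_combination (π * m * y / K : ℂ) * Complex.I_mul_I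

lemma norm_expMode_one (K : ℝ) (z : ℂ) : ‖expMode K 1 z‖ = Real.exp (-(π * z.im / K)) := by
  rw [expMode, Complex.norm_exp]
  congr 1
  have : Complex.I * π * (1 : ℤ) * z / K = ((π / K : ℝ) : ℂ) * (Complex.I * z) := by
    push_cast; ring
  rw [this, Complex.re_ofReal_mul]
  simp
  ring

lemma eq_of_expMode_one_eq {K y : ℝ} (hK : 0 < K) {z : ℂ} (hx : z.re ∈ Icc (-K) K)
    (h : expMode K 1 z = Real.exp (-(π * y / K))) : z = y * Complex.I := by
  have hn := congrArg norm h
  rw [norm_expMode_one, Complex.norm_real, Real.norm_of_nonneg (Real.exp_pos _).le,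
    Real.exp_eq_exp, neg_inj] at hn
  have hπ := pi_pos
  have hy : z.im = y := by
    field_simp at hn
    exact hn
  have hK' : (K : ℂ) ≠ 0 := by exact_mod_cast hK.ne'
  have hπ' : (π : ℂ) ≠ 0 := by exact_mod_cast hπ.ne'
  rw [expMode, Complex.ofReal_exp, Complex.exp_eq_exp_iff_exists_int] at h
  obtain ⟨l, hl⟩ := h
  have hre : z = (2 * l * K : ℝ) + (y : ℂ) * Complex.I := by
    push_cast at hl ⊢
    field_simp at hl
    linear_combination (-Complex.I) * hl + (z - 2 * l * K) * Complex.I_sq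
  have h1 := congrArg Complex.re hre
  simp at h1
  have hl0 : l = 0 := by
    rw [h1] at hx
    have h2 : (l : ℝ) < 1 := by nlinarith [hx.2]
    have h3 : (-1 : ℝ) < l := by nlinarith [hx.1]
    have h4 : l < 1 := by exact_mod_cast h2
    have h5 : -1 < l := by exact_mod_cast h3
    omega
  rw [hre, hl0]
  simp

lemma integral_expMode_horizontal {K : ℝ} (hK : 0 < K) (m : ℤ) {y₁ y₂ : ℝ} (hy : y₁ ≤ y₂) :
    ∫ x in (-K)..K, expMode K m (x + y₁ * Complex.I) =
      ∫ x in (-K)..K, expMode K m (x + y₂ * Complex.I) :=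
  integral_horizontal_eq hK.le hy countable_empty (differentiable_expMode K m).continuous.continuousOn
    (fun z _ => differentiable_expMode K m z) fun y _ => expMode_periodic hK.ne' m y

/-- The model function with a simple pole at `i ν`, where `ρ = exp (-π ν / K)`. -/
noncomputable def poleModel (K ρ : ℝ) (z : ℂ) : ℂ := expMode K 1 z / (expMode K 1 z - ρ)

lemma continuous_poleModel_line {K ρ y : ℝ} (h : Real.exp (-(π * y / K)) ≠ ρ) (hρ : 0 < ρ) (m : ℤ) :
    Continuous fun x : ℝ => poleModel K ρ (x + y * Complex.I) *
      expMode K m (x + y * Complex.I) := by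
  have he : ∀ m, Continuous fun x : ℝ => expMode K m (x + y * Complex.I) := fun m =>
    (differentiable_expMode K m).continuous.comp (by fun_prop)
  refine ((he 1).div ((he 1).sub continuous_const) fun x => ?_).mul (he m)
  intro h0
  have hn := congrArg norm (sub_eq_zero.1 h0)
  rw [norm_expMode_one, Complex.norm_real, Real.norm_of_nonneg hρ.le] at hn
  simp at hn
  exact h hn

/-- The map `z ↦ exp(iπz/K)` wraps a horizontal segment of length `2K` once around the circle of
radius `exp(-πy/K)`. -/
lemma integral_poleModel {K ρ y : ℝ} (hK : 0 < K) :
    ∫ x in (-K)..K, poleModel K ρ (x + y * Complex.I) = (K / π : ℂ) *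
      (-Complex.I * ∮ z in C(0, Real.exp (-(π * y / K))), (z - ρ)⁻¹) := by
  set r := Real.exp (-(π * y / K)) with hr
  have h1 : ∀ x : ℝ, poleModel K ρ (x + y * Complex.I) =
      circleMap 0 r (π / K * x) / (circleMap 0 r (π / K * x) - ρ) := by
    intro x
    have : expMode K 1 (x + y * Complex.I) = circleMap 0 r (π / K * x) := by
      have he : Real.exp (-(((1 : ℤ) : ℝ) * (π * y / K))) = r := by rw [hr, Int.cast_one, one_mul]
      rw [expMode_add_mul_I, he, circleMap, expMode, zero_add, mul_comm]
      push_cast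
      congr 2
      ring
    rw [poleModel, this]
  simp only [h1]
  have hπ := pi_pos.ne'
  have h2 := intervalIntegral.integral_comp_mul_left (a := -K) (b := K)
    (fun θ => circleMap 0 r θ / (circleMap 0 r θ - ρ)) (div_ne_zero hπ hK.ne')
  rw [h2, show π / K * -K = -π by field_simp, show π / K * K = π by field_simp]
  have hper : Function.Periodic (fun θ => circleMap 0 r θ / (circleMap 0 r θ - ρ)) (2 * π) :=
    fun θ => by simp only [periodic_circleMap 0 r θ]
  have h3 := hper.intervalIntegral_add_eq (-π) 0
  rw [zero_add, show -π + 2 * π = π by ring] at h3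
  rw [h3, circleIntegral, ← intervalIntegral.integral_const_mul, inv_div, Complex.real_smul]
  push_cast
  congr 1
  refine intervalIntegral.integral_congr fun θ _ => ?_
  simp only [deriv_circleMap, smul_eq_mul, div_eq_mul_inv]
  linear_combination (circleMap 0 r θ * (circleMap 0 r θ - ρ)⁻¹) * Complex.I_mul_I

/-- The jump of the Fourier modes of `poleModel` across its pole. -/
lemma integral_poleModel_sub {K ν y₁ y₂ : ℝ} (hK : 0 < K) (h₁ : y₁ < ν) (h₂ : ν < y₂) (m : ℤ) :
    (∫ x in (-K)..K, poleModel K (Real.exp (-(π * ν / K))) (x + y₁ * Complex.I) *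
      expMode K (-m) (x + y₁ * Complex.I)) -
    (∫ x in (-K)..K, poleModel K (Real.exp (-(π * ν / K))) (x + y₂ * Complex.I) *
      expMode K (-m) (x + y₂ * Complex.I)) = (2 * K * Real.exp (m * (π * ν / K)) : ℝ) := by
  set ρ := Real.exp (-(π * ν / K)) with hρ
  have hρ0 : 0 < ρ := Real.exp_pos _
  have hπ := pi_pos
  have hlt : ∀ {u v : ℝ}, u < v → Real.exp (-(π * v / K)) < Real.exp (-(π * u / K)) := by
    intro u v huv
    rw [Real.exp_lt_exp, neg_lt_neg_iff]
    gcongr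
  have r₁ := hlt h₁
  have r₂ := hlt h₂
  set D : ℤ → ℂ := fun m => (∫ x in (-K)..K, poleModel K ρ (x + y₁ * Complex.I) *
      expMode K (-m) (x + y₁ * Complex.I)) -
    (∫ x in (-K)..K, poleModel K ρ (x + y₂ * Complex.I) *
      expMode K (-m) (x + y₂ * Complex.I)) with hD
  -- Combining consecutive modes cancels the pole and leaves a pure exponential.
  have hstep : ∀ {y : ℝ}, Real.exp (-(π * y / K)) ≠ ρ → ∀ m : ℤ,
      (∫ x in (-K)..K, poleModel K ρ (x + y * Complex.I) * expMode K (-m) (x + y * Complex.I)) -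
      ρ * (∫ x in (-K)..K, poleModel K ρ (x + y * Complex.I) *
        expMode K (-(m + 1)) (x + y * Complex.I)) =
      ∫ x in (-K)..K, expMode K (-m) (x + y * Complex.I) := by
    intro y hy m
    rw [← intervalIntegral.integral_const_mul, ← intervalIntegral.integral_sub
      ((continuous_poleModel_line hy hρ0 _).intervalIntegrable _ _)
      (((continuous_poleModel_line hy hρ0 _).const_mul _).intervalIntegrable _ _)]
    refine intervalIntegral.integral_congr fun x _ => ?_
    have hne : expMode K 1 (x + y * Complex.I) - ρ ≠ 0 := by
      intro h0
      have hn := congrArg norm (sub_eq_zero.1 h0)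
      rw [norm_expMode_one, Complex.norm_real, Real.norm_of_nonneg hρ0.le] at hn
      simp at hn
      exact hy hn
    have he : expMode K (-m) (x + y * Complex.I) = expMode K 1 (x + y * Complex.I) *
        expMode K (-(m + 1)) (x + y * Complex.I) := by
      rw [← expMode_add]; congr 1; ring
    rw [he, poleModel]
    field_simp
  -- The integral of a pure exponential mode does not depend on the height, so the difference of the
  -- two heights obeys a homogeneous recursion.
  have hrec : ∀ m, D m = ρ * D (m + 1) := by
    intro m
    have e1 := hstep (hρ ▸ r₁.ne') m
    have e2 := hstep (hρ ▸ r₂.ne) m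
    rw [integral_expMode_horizontal hK (-m) (h₁.trans h₂).le] at e1
    simp only [hD]
    linear_combination e1 - e2
  -- The point `ρ` lies inside the circle for height `y₁` and outside the circle for height `y₂`.
  have hD0 : D 0 = 2 * K := by
    have c1 : ∮ z in C(0, Real.exp (-(π * y₁ / K))), (z - (ρ : ℂ))⁻¹ = 2 * π * Complex.I := by
      refine circleIntegral.integral_sub_inv_of_mem_ball ?_
      rw [mem_ball_zero_iff, Complex.norm_real, Real.norm_of_nonneg hρ0.le]
      exact r₁
    have c2 : ∮ z in C(0, Real.exp (-(π * y₂ / K))), (z - (ρ : ℂ))⁻¹ = 0 := by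
      have hne : ∀ z ∈ Metric.closedBall (0 : ℂ) (Real.exp (-(π * y₂ / K))), z - (ρ : ℂ) ≠ 0 := by
        intro z hz h0
        rw [sub_eq_zero.1 h0, mem_closedBall_zero_iff, Complex.norm_real,
          Real.norm_of_nonneg hρ0.le] at hz
        exact absurd hz (not_le.2 r₂)
      refine Complex.circleIntegral_eq_zero_of_differentiable_on_off_countable
        (Real.exp_pos _).le countable_empty ?_ ?_
      · exact ContinuousOn.inv₀ (by fun_prop) hne
      · intro z hz
        exact (differentiableAt_id.sub_const _).inv (hne z (Metric.ball_subset_closedBall hz.1))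
    have hπ' : (π : ℂ) ≠ 0 := by exact_mod_cast hπ.ne'
    simp only [hD, neg_zero, expMode_zero, mul_one]
    rw [integral_poleModel hK, integral_poleModel hK, c1, c2]
    field_simp
    linear_combination (-2 * K * π : ℂ) * Complex.I_sq
  have hexp : ∀ m : ℤ, (ρ : ℂ) * (2 * K * Real.exp ((m + 1 : ℤ) * (π * ν / K)) : ℝ) =
      (2 * K * Real.exp (m * (π * ν / K)) : ℝ) := by
    intro m
    rw [← Complex.ofReal_mul, hρ]
    congr 1
    have : Real.exp (m * (π * ν / K)) = Real.exp (-(π * ν / K)) *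
        Real.exp ((m + 1 : ℤ) * (π * ν / K)) := by
      rw [← Real.exp_add]; congr 1; push_cast; ring
    rw [this]; ring
  have hρ' : (ρ : ℂ) ≠ 0 := by exact_mod_cast hρ0.ne'
  change D m = _
  induction m using Int.induction_on with
  | zero => rw [hD0]; simp
  | succ i ih =>
    have := hrec i
    rw [ih, ← hexp] at this
    exact (mul_left_cancel₀ hρ' this).symm
  | pred i ih =>
    have := hrec (-(i : ℤ) - 1)
    rw [sub_add_cancel, ih] at this
    rw [this, ← hexp (-(i : ℤ) - 1), sub_add_cancel]

end ExponentialKernel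

/-! ### Contour shift across a removable singularity -/

section RemovableSingularity

/-- The reciprocal of the difference quotient; it gives the residue of `1 / F` at a simple zero of
`F`. -/
lemma tendsto_sub_div {F : ℂ → ℂ} {F' z₀ : ℂ} (hF : HasDerivAt F F' z₀) (h0 : F z₀ = 0)
    (hF' : F' ≠ 0) : Tendsto (fun z => (z - z₀) / F z) (𝓝[≠] z₀) (𝓝 F'⁻¹) := by
  have h := (hasDerivAt_iff_tendsto_slope.1 hF).inv₀ hF'
  refine h.congr fun z => ?_
  rw [slope_def_field, h0, sub_zero, inv_div]

lemma exists_tendsto_of_tendsto_sub_mul {g : ℂ → ℂ} {z₀ : ℂ}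
    (hd : ∀ᶠ z in 𝓝[≠] z₀, DifferentiableAt ℂ g z)
    (h : Tendsto (fun z => (z - z₀) * g z) (𝓝[≠] z₀) (𝓝 0)) :
    ∃ L, Tendsto g (𝓝[≠] z₀) (𝓝 L) := by
  refine ⟨_, Complex.tendsto_limUnder_of_differentiable_on_punctured_nhds_of_isLittleO hd ?_⟩
  refine (Asymptotics.isLittleO_iff_tendsto' ?_).2 ?_
  · filter_upwards [self_mem_nhdsWithin] with z hz h0
    exact absurd (inv_eq_zero.1 h0) (sub_ne_zero.2 hz)
  · have h1 : Tendsto (fun z => (z - z₀) * g z₀) (𝓝[≠] z₀) (𝓝 0) := by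
      have : Tendsto (fun z => (z - z₀) * g z₀) (𝓝 z₀) (𝓝 ((z₀ - z₀) * g z₀)) :=
        Continuous.tendsto (by fun_prop) z₀
      rw [sub_self, zero_mul] at this
      exact this.mono_left nhdsWithin_le_nhds
    have h2 := h.sub h1
    rw [sub_zero] at h2
    refine h2.congr fun z => ?_
    rw [div_inv_eq_mul]
    ring

/-- The two horizontal integrals of a function with a removable singularity in a rectangle. -/
lemma integral_horizontal_eq_of_removable {g : ℂ → ℂ} {K y₁ y₂ : ℝ} {z₀ : ℂ} (hK : 0 ≤ K)
    (hz₀ : z₀ ∈ Ioo (-K) K ×ℂ Ioo y₁ y₂)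
    (hd : ∀ z ∈ Icc (-K) K ×ℂ Icc y₁ y₂, z ≠ z₀ → DifferentiableAt ℂ g z)
    (hr : Tendsto (fun z => (z - z₀) * g z) (𝓝[≠] z₀) (𝓝 0))
    (hp : ∀ y ∈ Icc y₁ y₂, g (K + y * Complex.I) = g (-K + y * Complex.I)) :
    ∫ x in (-K)..K, g (x + y₁ * Complex.I) = ∫ x in (-K)..K, g (x + y₂ * Complex.I) := by
  have hsub : Ioo (-K) K ×ℂ Ioo y₁ y₂ ⊆ Icc (-K) K ×ℂ Icc y₁ y₂ := fun z hz =>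
    ⟨Ioo_subset_Icc_self hz.1, Ioo_subset_Icc_self hz.2⟩
  have hopen : IsOpen (Ioo (-K) K ×ℂ Ioo y₁ y₂) := isOpen_Ioo.reProdIm isOpen_Ioo
  -- The value at `z₀` is replaced by this limit. No edge of the rectangle meets `z₀`, so the
  -- integrals and the side condition are unaffected.
  obtain ⟨L, hL⟩ := exists_tendsto_of_tendsto_sub_mul (g := g) (z₀ := z₀) (by
    filter_upwards [self_mem_nhdsWithin, mem_nhdsWithin_of_mem_nhds (hopen.mem_nhds hz₀)]
      with z hz hz' using hd z (hsub hz') hz) hr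
  have hdiff : ∀ z ∈ Icc (-K) K ×ℂ Icc y₁ y₂, z ≠ z₀ →
      DifferentiableAt ℂ (Function.update g z₀ L) z := fun z hz hne => by
    refine (hd z hz hne).congr_of_eventuallyEq ?_
    filter_upwards [isOpen_ne.mem_nhds hne] with w hw using Function.update_of_ne hw _ _
  have him : z₀.im ∈ Ioo y₁ y₂ := hz₀.2
  have hre : z₀.re ∈ Ioo (-K) K := hz₀.1
  have hy₁ : ∀ x : ℝ, (x : ℂ) + y₁ * Complex.I ≠ z₀ := fun x hx => by
    have := congrArg Complex.im hx
    simp at this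
    linarith [him.1]
  have hy₂ : ∀ x : ℝ, (x : ℂ) + y₂ * Complex.I ≠ z₀ := fun x hx => by
    have := congrArg Complex.im hx
    simp at this
    linarith [him.2]
  have key := integral_horizontal_eq (g := Function.update g z₀ L) hK (him.1.trans him.2).le
    (countable_singleton z₀) (fun z hz => ?_) (fun z hz => ?_) (fun y hy => ?_)
  · simpa only [Function.update_of_ne (hy₁ _), Function.update_of_ne (hy₂ _)] using key
  · by_cases hne : z = z₀
    · rw [hne]
      exact (continuousAt_update_same.2 hL).continuousWithinAt
    · exact (hdiff z hz hne).continuousAt.continuousWithinAt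
  · exact hdiff z (hsub hz.1) hz.2
  · have n1 : (K : ℂ) + y * Complex.I ≠ z₀ := fun hx => by
      have := congrArg Complex.re hx
      simp at this
      linarith [hre.2]
    have n2 : (-K : ℂ) + y * Complex.I ≠ z₀ := fun hx => by
      have := congrArg Complex.re hx
      simp at this
      linarith [hre.1]
    rw [Function.update_of_ne n1, Function.update_of_ne n2, hp y hy]

end RemovableSingularity

/-! ### The pole of the complexified position and its residue -/

namespace EllipticParams

variable {a b c d k n k' ν : ℝ}

lemma coModulus_facts (h : EllipticParams a b c d k n) (hkk : k' ^ 2 = 1 - k ^ 2) :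
    k' ^ 2 < 1 := by
  have := pow_pos h.hk0 2
  linarith

lemma one_sub_n (h : EllipticParams a b c d k n) : 1 - n = (a - d) / (a - c) := by
  have := h.ac_pos.ne'
  rw [h.hn]; field_simp; ring

lemma jacobiCn_nu_sq (h : EllipticParams a b c d k n)
    (hcn : jacobiCn ν k' = √((c - d) / (a - d))) : jacobiCn ν k' ^ 2 = (c - d) / (a - d) := by
  rw [hcn, Real.sq_sqrt (div_pos h.cd_pos h.ad_pos).le]

lemma jacobiCn_nu_sq' (h : EllipticParams a b c d k n)
    (hcn : jacobiCn ν k' = √((c - d) / (a - d))) : jacobiCn ν k' ^ 2 * (1 - n) = -n := by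
  have h1 := h.ac_pos.ne'
  have h2 := h.ad_pos.ne'
  rw [h.jacobiCn_nu_sq hcn, h.one_sub_n, h.hn]
  field_simp
  ring

/-- Both sides are nonnegative, and at `ν` the squares of `sn`, `cn`, `dn` are rational in the
roots: `(a - c)/(a - d)`, `(c - d)/(a - d)`, `(c - d)/(b - d)`. -/
lemma residue_identity (h : EllipticParams a b c d k n) (hkk : k' ^ 2 = 1 - k ^ 2)
    (hν : ν ∈ Ioo 0 (ellipticK k')) (hcn : jacobiCn ν k' = √((c - d) / (a - d))) :
    -(a - d) * n * jacobiSn ν k' ^ 3 =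
      jacobiCn ν k' * jacobiDn ν k' * √((b - d) * (a - c)) := by
  have hk' := h.coModulus_facts hkk
  have hs := jacobiSn_pos hk' ⟨hν.1, hν.2.le⟩
  have hc := jacobiCn_pos hk' ⟨hν.1.le, hν.2⟩
  have hd := jacobiDn_pos hk' ν
  have h1 := h.ac_pos
  have h2 := h.ad_pos
  have h3 := h.bd_pos
  have h4 := h.cd_pos
  have hn := h.n_neg
  have hc2 := h.jacobiCn_nu_sq hcn
  have hs2 : jacobiSn ν k' ^ 2 = (a - c) / (a - d) := by
    have := jacobiCn_sq ν k'
    rw [hc2] at this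
    have e : (a - c) / (a - d) = 1 - (c - d) / (a - d) := by field_simp; ring
    linarith
  have hd2 : jacobiDn ν k' ^ 2 = (c - d) / (b - d) := by
    rw [jacobiDn_sq hk', hs2, hkk, h.hk]
    field_simp
    ring
  rw [← sq_eq_sq₀ (mul_nonneg (by nlinarith) (by positivity)) (by positivity), mul_pow, mul_pow,
    mul_pow, mul_pow, Real.sq_sqrt (by positivity), hc2, hd2, ← pow_mul,
    show 3 * 2 = 2 * 3 from rfl, pow_mul, hs2, h.hn]
  field_simp
  ring

/-- Says that `iν` is a simple pole of `wellUpper`; the last clause is its residue, `i √((b - d)(a -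
c)) / 2`. -/
lemma hasDerivAt_jacobiNs_sq_sub (h : EllipticParams a b c d k n) (hkk : k' ^ 2 = 1 - k ^ 2)
    (hν : ν ∈ Ioo 0 (ellipticK k')) (hcn : jacobiCn ν k' = √((c - d) / (a - d))) :
    ∃ F' : ℂ, F' ≠ 0 ∧ HasDerivAt (fun z => jacobiNs k k' z ^ 2 - n) F' (ν * Complex.I) ∧
      jacobiNs k k' (ν * Complex.I) ^ 2 = n ∧
      (d - a) * n * F'⁻¹ = √((b - d) * (a - c)) / 2 * Complex.I := by
  have hk := h.k_sq_lt_one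
  have hk' := h.coModulus_facts hkk
  have hs := jacobiSn_pos hk' ⟨hν.1, hν.2.le⟩
  have hc := jacobiCn_pos hk' ⟨hν.1.le, hν.2⟩
  have hd := jacobiDn_pos hk' ν
  obtain ⟨v, hv, hv0⟩ := hasDerivAt_jacobiNs (z := ν * Complex.I) hk hkk h.hk0.ne'
    (by simpa using (nsDenom_pos hs.ne').ne')
  have hv0 : v = 0 := hv0 (by simpa using jacobiSn_zero hk)
  have hZ := jacobiNs_I_mul (k := k) (y := ν) hk hs.ne'
  have hsC : (jacobiSn ν k' : ℂ) ≠ 0 := by exact_mod_cast hs.ne'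
  have hcC : (jacobiCn ν k' : ℂ) ≠ 0 := by exact_mod_cast hc.ne'
  have hdC : (jacobiDn ν k' : ℂ) ≠ 0 := by exact_mod_cast hd.ne'
  have hF : HasDerivAt (fun z => jacobiNs k k' z ^ 2 - n)
      (-2 * Complex.I * (jacobiCn ν k' * jacobiDn ν k' / jacobiSn ν k' ^ 3)) (ν * Complex.I) := by
    refine ((hv.fun_pow 2).sub_const _).congr_deriv ?_
    rw [hZ, hv0]
    simp [nsDenom, jacobiSn_zero hk, jacobiCn_zero hk, jacobiDn_zero hk]
    field_simp
  refine ⟨_, ?_, hF, ?_, ?_⟩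
  · have := Complex.I_ne_zero
    simp [hsC, hcC, hdC]
  · have e : (jacobiCn ν k' / jacobiSn ν k') ^ 2 = -n := by
      have h1 := h.jacobiCn_nu_sq' hcn
      have h2 := jacobiCn_sq ν k'
      rw [div_pow, div_eq_iff (by positivity)]
      linear_combination h1 + n * h2
    have e' : ((jacobiCn ν k' / jacobiSn ν k' : ℝ) : ℂ) ^ 2 = -n := by exact_mod_cast e
    rw [hZ, mul_pow, Complex.I_sq, neg_sq, e']
    ring
  · have e := h.residue_identity hkk hν hcn
    have e' : -((a : ℂ) - d) * n * jacobiSn ν k' ^ 3 =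
      jacobiCn ν k' * jacobiDn ν k' * √((b - d) * (a - c)) := by exact_mod_cast e
    have := Complex.I_ne_zero
    field_simp
    linear_combination -e' - jacobiCn ν k' * jacobiDn ν k' * √((b - d) * (a - c)) * Complex.I_sq

end EllipticParams

/-- `a + (d - a) / (1 - n sn² z)` near the real axis. -/
noncomputable def wellLower (a d n k k' : ℝ) (z : ℂ) : ℂ :=
  a + (d - a) / (1 - n * complexSn k k' z ^ 2)

/-- `a + (d - a) / (1 - n sn² z)` away from the real axis. -/
noncomputable def wellUpper (a d n k k' : ℝ) (z : ℂ) : ℂ :=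
  a + (d - a) * (jacobiNs k k' z ^ 2 / (jacobiNs k k' z ^ 2 - n))

/-! ### Moving the contour from the real axis to the line `Im z = K'` -/

namespace EllipticParams

variable {a b c d k n k' ν : ℝ}

lemma wellLower_eq_wellUpper (h : EllipticParams a b c d k n) (hkk : k' ^ 2 = 1 - k ^ 2) {z : ℂ}
    (hs : jacobiSn z.im k' ≠ 0) (hc : jacobiCn z.im k' ≠ 0) :
    wellLower a d n k k' z = wellUpper a d n k k' z := by
  have e := complexSn_mul_jacobiNs h.k_sq_lt_one (h.coModulus_facts hkk) hkk hs hc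
  have hZ : jacobiNs k k' z ≠ 0 := right_ne_zero_of_mul_eq_one e
  have hS : complexSn k k' z = (jacobiNs k k' z)⁻¹ := eq_inv_of_mul_eq_one_left e
  have h1 : 1 - (n : ℂ) * (jacobiNs k k' z)⁻¹ ^ 2 =
      (jacobiNs k k' z ^ 2 - n) / jacobiNs k k' z ^ 2 := by
    field_simp
  rw [wellLower, wellUpper, hS, h1, div_div_eq_mul_div, mul_div_assoc]

lemma differentiableAt_wellUpper (h : EllipticParams a b c d k n) (hkk : k' ^ 2 = 1 - k ^ 2) {z : ℂ}
    (hs : jacobiSn z.im k' ≠ 0) (hn : jacobiNs k k' z ^ 2 ≠ n) :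
    DifferentiableAt ℂ (wellUpper a d n k k') z := by
  obtain ⟨v, hv, -⟩ := hasDerivAt_jacobiNs h.k_sq_lt_one hkk h.hk0.ne' (nsDenom_pos hs).ne'
  have hd := hv.differentiableAt.fun_pow 2
  exact ((hd.fun_mul ((hd.sub_const _).fun_inv (sub_ne_zero.2 hn))).const_mul _).const_add _

lemma wellUpper_periodic (h : EllipticParams a b c d k n) (y : ℝ) :
    wellUpper a d n k k' (ellipticK k + y * Complex.I) =
      wellUpper a d n k k' (-ellipticK k + y * Complex.I) := by
  rw [wellUpper, wellUpper, jacobiNs_periodic h.k_sq_lt_one, neg_sq]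

lemma wellLower_periodic (h : EllipticParams a b c d k n) (y : ℝ) :
    wellLower a d n k k' (ellipticK k + y * Complex.I) =
      wellLower a d n k k' (-ellipticK k + y * Complex.I) := by
  rw [wellLower, wellLower, complexSn_periodic h.k_sq_lt_one, neg_sq]

lemma jacobiNs_sq_ne (h : EllipticParams a b c d k n) (hkk : k' ^ 2 = 1 - k ^ 2)
    (hν : ν ∈ Ioo 0 (ellipticK k')) (hcn : jacobiCn ν k' = √((c - d) / (a - d))) {z : ℂ}
    (hx : z.re ∈ Icc (-ellipticK k) (ellipticK k)) (hy : z.im ∈ Ioc 0 (ellipticK k'))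
    (hz : z ≠ ν * Complex.I) : jacobiNs k k' z ^ 2 ≠ n := fun h0 =>
  hz (eq_of_jacobiNs_sq_eq h.k_sq_lt_one (h.coModulus_facts hkk) h.n_neg hν
    (h.jacobiCn_nu_sq' hcn) hx hy h0)

/-- Near the real axis `1 / sn` has a pole, so the expression in `sn` is used there. Only continuity
of `sn` is needed: inside the rectangle holomorphy is borrowed from `wellUpper`, which agrees with
it. -/
lemma integral_lower (h : EllipticParams a b c d k n) (hkk : k' ^ 2 = 1 - k ^ 2)
    (hν : ν ∈ Ioo 0 (ellipticK k')) (hcn : jacobiCn ν k' = √((c - d) / (a - d))) {Y : ℝ}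
    (hY : Y ∈ Ioo 0 ν) (m : ℤ) :
    ∫ x in (-ellipticK k)..(ellipticK k),
        (wellPoint a d n (jacobiAm x k) : ℂ) * expMode (ellipticK k) m x =
      ∫ x in (-ellipticK k)..(ellipticK k), wellUpper a d n k k' (x + Y * Complex.I) *
        expMode (ellipticK k) m (x + Y * Complex.I) := by
  have hk := h.k_sq_lt_one
  have hk' := h.coModulus_facts hkk
  have hK := ellipticK_pos hk
  have hden : ∀ z : ℂ, z.re ∈ Icc (-ellipticK k) (ellipticK k) → z.im ∈ Icc 0 Y →
      1 - (n : ℂ) * complexSn k k' z ^ 2 ≠ 0 := by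
    intro z hx hy h0
    -- On the real axis `n < 0` keeps the denominator positive; above it a zero would mean `1 / sn²
    -- = n`, which occurs only at height `ν`.
    rcases hy.1.eq_or_lt with h1 | h1
    · have hz : z = (z.re : ℂ) := by apply Complex.ext <;> simp [← h1]
      rw [hz, complexSn_ofReal hk'] at h0
      have : 1 - n * jacobiSn z.re k ^ 2 = 0 := by exact_mod_cast h0
      exact absurd this (h.denom_pos _).ne'
    · have hyK : z.im ∈ Ioo 0 (ellipticK k') := ⟨h1, hy.2.trans_lt (hY.2.trans hν.2)⟩
      have e := complexSn_mul_jacobiNs (z := z) hk hk' hkk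
        (jacobiSn_pos hk' ⟨hyK.1, hyK.2.le⟩).ne' (jacobiCn_pos hk' ⟨hyK.1.le, hyK.2⟩).ne'
      refine h.jacobiNs_sq_ne hkk hν hcn hx ⟨hyK.1, hyK.2.le⟩ (fun hz => ?_) ?_
      · have := congrArg Complex.im hz
        simp at this
        linarith [hy.2, hY.2]
      · linear_combination jacobiNs k k' z ^ 2 * h0 +
          (n : ℂ) * (complexSn k k' z * jacobiNs k k' z + 1) * e
  have hcn0 : ∀ {y}, y ∈ Icc 0 Y → jacobiCn y k' ≠ 0 := fun hy =>
    (jacobiCn_pos hk' ⟨hy.1, hy.2.trans_lt (hY.2.trans hν.2)⟩).ne'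
  have hsn0 : ∀ {y}, y ∈ Ioc 0 Y → jacobiSn y k' ≠ 0 := fun hy =>
    (jacobiSn_pos hk' ⟨hy.1, hy.2.trans (hY.2.trans hν.2).le⟩).ne'
  have key := integral_horizontal_eq
    (g := fun z => wellLower a d n k k' z * expMode (ellipticK k) m z) hK.le hY.1.le countable_empty
    (fun z hz => ?_) (fun z hz => ?_) (fun y hy => ?_)
  · refine Eq.trans ?_ (key.trans ?_)
    · refine intervalIntegral.integral_congr fun x _ => ?_
      have hw : wellPoint a d n (jacobiAm x k) = a + (d - a) / (1 - n * jacobiSn x k ^ 2) := rfl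
      simp only [hw, Complex.ofReal_zero, zero_mul, add_zero, wellLower, complexSn_ofReal hk']
      push_cast
      rfl
    · refine intervalIntegral.integral_congr fun x _ => ?_
      have him : ((x : ℂ) + Y * Complex.I).im = Y := by simp
      rw [h.wellLower_eq_wellUpper hkk (by rw [him]; exact hsn0 ⟨hY.1, le_rfl⟩)
        (by rw [him]; exact hcn0 ⟨hY.1.le, le_rfl⟩)]
  · have hc := continuousAt_complexSn (z := z) hk hk' (hcn0 hz.2)
    refine ContinuousAt.continuousWithinAt (ContinuousAt.mul ?_
      (differentiable_expMode _ m).continuous.continuousAt)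
    exact continuousAt_const.add (continuousAt_const.div
      (continuousAt_const.sub (continuousAt_const.mul (hc.pow 2))) (hden z hz.1 hz.2))
  · have hx : z.re ∈ Ioo (-ellipticK k) (ellipticK k) := hz.1.1
    have hy : z.im ∈ Ioo 0 Y := hz.1.2
    refine DifferentiableAt.mul ?_ (differentiable_expMode _ m z)
    refine (h.differentiableAt_wellUpper hkk (hsn0 ⟨hy.1, hy.2.le⟩) ?_).congr_of_eventuallyEq ?_
    · refine h.jacobiNs_sq_ne hkk hν hcn (Ioo_subset_Icc_self hx)
        ⟨hy.1, (hy.2.trans (hY.2.trans hν.2)).le⟩ fun hz => ?_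
      have := congrArg Complex.im hz
      simp at this
      linarith [hy.2, hY.2]
    · filter_upwards [(isOpen_Ioo.preimage Complex.continuous_im).mem_nhds hy] with w hw
      exact h.wellLower_eq_wellUpper hkk (hsn0 ⟨hw.1, hw.2.le⟩) (hcn0 ⟨hw.1.le, hw.2.le⟩)
  · rw [h.wellLower_periodic, expMode_periodic hK.ne']

/-- The model has residue `K / (iπ)` at `iν`; the constant `κ` makes the residue of `κ * poleModel`
equal to that of `wellUpper`, so their difference has a removable singularity. -/
lemma integral_upper (h : EllipticParams a b c d k n) (hkk : k' ^ 2 = 1 - k ^ 2)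
    (hν : ν ∈ Ioo 0 (ellipticK k')) (hcn : jacobiCn ν k' = √((c - d) / (a - d))) {Y : ℝ}
    (hY : Y ∈ Ioo 0 ν) {κ ρ : ℝ} (hκ : κ = -(π * √((b - d) * (a - c)) / (2 * ellipticK k)))
    (hρ : ρ = Real.exp (-(π * ν / ellipticK k))) (m : ℤ) :
    ∫ x in (-ellipticK k)..(ellipticK k), (wellUpper a d n k k' (x + Y * Complex.I) -
        κ * poleModel (ellipticK k) ρ (x + Y * Complex.I)) *
        expMode (ellipticK k) m (x + Y * Complex.I) =
      ∫ x in (-ellipticK k)..(ellipticK k),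
        (wellUpper a d n k k' (x + ellipticK k' * Complex.I) -
        κ * poleModel (ellipticK k) ρ (x + ellipticK k' * Complex.I)) *
        expMode (ellipticK k) m (x + ellipticK k' * Complex.I) := by
  have hk := h.k_sq_lt_one
  have hk' := h.coModulus_facts hkk
  have hK := ellipticK_pos hk
  set K := ellipticK k with hKdef
  have hρ0 : 0 < ρ := hρ ▸ Real.exp_pos _
  refine integral_horizontal_eq_of_removable (z₀ := ν * Complex.I)
    (g := fun z => (wellUpper a d n k k' z - κ * poleModel K ρ z) * expMode K m z) hK.le
    ⟨?_, ?_⟩ (fun z hz hne => ?_) ?_ (fun y hy => ?_)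
  · simpa using hK
  · simpa using ⟨hY.2, hν.2⟩
  · have hx : z.re ∈ Icc (-K) K := hz.1
    have hy : z.im ∈ Icc Y (ellipticK k') := hz.2
    have hy' : z.im ∈ Ioc 0 (ellipticK k') := ⟨hY.1.trans_le hy.1, hy.2⟩
    refine DifferentiableAt.mul (DifferentiableAt.sub ?_ (DifferentiableAt.const_mul ?_ _))
      (differentiable_expMode _ m z)
    · exact h.differentiableAt_wellUpper hkk (jacobiSn_pos hk' hy').ne'
        (h.jacobiNs_sq_ne hkk hν hcn hx hy' hne)
    · refine (differentiable_expMode K 1 z).fun_mul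
        (((differentiable_expMode K 1 z).sub_const _).fun_inv (sub_ne_zero.2 fun h0 => hne ?_))
      exact eq_of_expMode_one_eq hK hx (h0.trans (by rw [hρ]))
  · obtain ⟨F', hF', hF, hF0, hres⟩ := h.hasDerivAt_jacobiNs_sq_sub hkk hν hcn
    have hπ : (π : ℂ) ≠ 0 := by exact_mod_cast pi_pos.ne'
    have hKC : (K : ℂ) ≠ 0 := by exact_mod_cast hK.ne'
    have hρC : (ρ : ℂ) ≠ 0 := by exact_mod_cast hρ0.ne'
    have he : expMode K 1 (ν * Complex.I) = ρ := by
      have := expMode_add_mul_I K 1 0 ν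
      rw [Complex.ofReal_zero, zero_add] at this
      rw [this, hρ]
      simp [expMode]
    have hH : HasDerivAt (fun z => expMode K 1 z - ρ) (ρ * (Complex.I * π / K)) (ν * Complex.I) := by
      have h1 : HasDerivAt (fun z : ℂ => Complex.I * π * (1 : ℤ) * z / K) (Complex.I * π / K)
          (ν * Complex.I) := by
        refine (((hasDerivAt_id _).const_mul (Complex.I * π * (1 : ℤ))).div_const _).congr_deriv ?_
        push_cast
        ring
      have h2 := h1.cexp.sub_const (ρ : ℂ)
      change HasDerivAt (fun z => expMode K 1 z - ρ)
        (expMode K 1 (ν * Complex.I) * (Complex.I * π / K)) (ν * Complex.I) at h2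
      rwa [he] at h2
    have hI := Complex.I_ne_zero
    have l1 := tendsto_sub_div hF (by rw [hF0, sub_self]) hF'
    have l2 := tendsto_sub_div hH (by rw [he, sub_self]) (by positivity)
    obtain ⟨v, hv, -⟩ := hasDerivAt_jacobiNs (z := ν * Complex.I) hk hkk h.hk0.ne'
      (by simpa using (nsDenom_pos (jacobiSn_pos hk' ⟨hν.1, hν.2.le⟩).ne').ne')
    have l3 : Tendsto (fun z => jacobiNs k k' z ^ 2) (𝓝[≠] (ν * Complex.I)) (𝓝 n) := by
      rw [← hF0]
      exact (hv.continuousAt.pow 2).tendsto.mono_left nhdsWithin_le_nhds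
    have l4 : Tendsto (fun z => expMode K 1 z) (𝓝[≠] (ν * Complex.I)) (𝓝 ρ) := by
      rw [← he]
      exact (differentiable_expMode K 1).continuous.continuousAt.tendsto.mono_left
        nhdsWithin_le_nhds
    have l5 : Tendsto (fun z => expMode K m z) (𝓝[≠] (ν * Complex.I))
        (𝓝 (expMode K m (ν * Complex.I))) :=
      (differentiable_expMode K m).continuous.continuousAt.tendsto.mono_left nhdsWithin_le_nhds
    have l6 : Tendsto (fun z : ℂ => (z - ν * Complex.I) * a) (𝓝[≠] (ν * Complex.I)) (𝓝 0) := by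
      have : Tendsto (fun z : ℂ => (z - ν * Complex.I) * a) (𝓝 (ν * Complex.I))
          (𝓝 ((ν * Complex.I - ν * Complex.I) * a)) := Continuous.tendsto (by fun_prop) _
      rw [sub_self, zero_mul] at this
      exact this.mono_left nhdsWithin_le_nhds
    have l := ((l6.add ((l3.const_mul ((d : ℂ) - a)).mul l1)).sub
      ((l4.const_mul (κ : ℂ)).mul l2)).mul l5
    have hlim : (0 + ((d : ℂ) - a) * n * F'⁻¹ - κ * ρ * (ρ * (Complex.I * π / K))⁻¹) *
        expMode K m (ν * Complex.I) = 0 := by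
      rw [hres, hκ]
      generalize expMode K m (ν * Complex.I) = e
      push_cast
      field_simp
      linear_combination (√((b - d) * (a - c)) * e : ℂ) * Complex.I_sq
    rw [hlim] at l
    refine l.congr fun z => ?_
    rw [wellUpper, poleModel]
    ring
  · rw [h.wellUpper_periodic, poleModel, poleModel, expMode_periodic hK.ne', expMode_periodic hK.ne']

end EllipticParams

/-- Evenness in `x` is evenness in the mode number; this is what later supplies a second equation.
-/
lemma integral_mul_expMode_neg {f : ℝ → ℂ} (hf : ∀ x, f (-x) = f x) (K : ℝ) (m : ℤ) :
    ∫ x in (-K)..K, f x * expMode K (-m) x = ∫ x in (-K)..K, f x * expMode K m x := by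
  have h := intervalIntegral.integral_comp_neg (a := -K) (b := K) fun x : ℝ => f x * expMode K m x
  rw [neg_neg] at h
  rw [← h]
  refine intervalIntegral.integral_congr fun x _ => ?_
  simp only [hf, expMode]
  push_cast
  ring_nf

namespace EllipticParams

variable {a b c d k n k' ν : ℝ}

lemma intervalIntegrable_wellUpper (h : EllipticParams a b c d k n) (hkk : k' ^ 2 = 1 - k ^ 2)
    (hν : ν ∈ Ioo 0 (ellipticK k')) (hcn : jacobiCn ν k' = √((c - d) / (a - d))) {y : ℝ}
    (hy : y ∈ Ioc 0 (ellipticK k')) (hne : y ≠ ν) (m : ℤ) :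
    IntervalIntegrable (fun x : ℝ => wellUpper a d n k k' (x + y * Complex.I) *
      expMode (ellipticK k) m (x + y * Complex.I)) volume (-ellipticK k) (ellipticK k) := by
  have hK := ellipticK_pos h.k_sq_lt_one
  refine ContinuousOn.intervalIntegrable fun x hx => ContinuousAt.continuousWithinAt ?_
  rw [uIcc_of_le (by linarith)] at hx
  have hline : ContinuousAt (fun x : ℝ => (x : ℂ) + y * Complex.I) x := by fun_prop
  have him : ((x : ℂ) + y * Complex.I).im = y := by simp
  refine ContinuousAt.comp (f := fun x : ℝ => (x : ℂ) + y * Complex.I)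
    (g := fun z => wellUpper a d n k k' z * expMode (ellipticK k) m z) ?_ hline
  refine ((h.differentiableAt_wellUpper hkk ?_ ?_).mul
    (differentiable_expMode _ m _)).continuousAt
  · rw [him]
    exact (jacobiSn_pos (h.coModulus_facts hkk) hy).ne'
  · refine h.jacobiNs_sq_ne hkk hν hcn (by simpa using hx) (by rwa [him]) fun h0 => hne ?_
    simpa using congrArg Complex.im h0

/-- The contour passes below the pole, then across it with the jump of the model, up to height `K'`,
where the mode acquires the factor `exp(mπK'/K)`. -/
lemma integral_wellPoint_sub (h : EllipticParams a b c d k n) (hkk : k' ^ 2 = 1 - k ^ 2)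
    (hν : ν ∈ Ioo 0 (ellipticK k')) (hcn : jacobiCn ν k' = √((c - d) / (a - d))) (m : ℤ) :
    (∫ x in (-ellipticK k)..(ellipticK k),
        (wellPoint a d n (jacobiAm x k) : ℂ) * expMode (ellipticK k) (-m) x) -
      Real.exp (m * (π * ellipticK k' / ellipticK k)) *
        (∫ x in (-ellipticK k)..(ellipticK k),
          ((a + (d - a) * ((k * jacobiSn x k) ^ 2 / ((k * jacobiSn x k) ^ 2 - n)) : ℝ) : ℂ) *
            expMode (ellipticK k) (-m) x) =
      -(π * √((b - d) * (a - c)) * Real.exp (m * (π * ν / ellipticK k)) : ℝ) := by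
  have hk := h.k_sq_lt_one
  have hk' := h.coModulus_facts hkk
  have hK := ellipticK_pos hk
  have hY : ν / 2 ∈ Ioo 0 ν := ⟨by linarith [hν.1], by linarith [hν.1]⟩
  have hL : ellipticK k' ∈ Ioc 0 (ellipticK k') := ⟨hν.1.trans hν.2, le_rfl⟩
  set ρ := Real.exp (-(π * ν / ellipticK k)) with hρ
  set κ := -(π * √((b - d) * (a - c)) / (2 * ellipticK k)) with hκ
  have hρ0 : 0 < ρ := Real.exp_pos _
  have e1 := h.integral_lower hkk hν hcn hY (-m)
  have e2 := h.integral_upper hkk hν hcn hY hκ hρ (-m)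
  have e3 := integral_poleModel_sub hK hY.2 hν.2 m
  rw [← hρ] at e3
  have hexp : ∀ {y}, y ≠ ν → Real.exp (-(π * y / ellipticK k)) ≠ ρ := by
    intro y hy h0
    rw [hρ, Real.exp_eq_exp, neg_inj] at h0
    have := pi_pos.ne'
    field_simp at h0
    exact hy h0
  have hsplit : ∀ {y}, y ∈ Ioc 0 (ellipticK k') → y ≠ ν →
      ∫ x in (-ellipticK k)..(ellipticK k), (wellUpper a d n k k' (x + y * Complex.I) -
        κ * poleModel (ellipticK k) ρ (x + y * Complex.I)) *
        expMode (ellipticK k) (-m) (x + y * Complex.I) =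
      (∫ x in (-ellipticK k)..(ellipticK k), wellUpper a d n k k' (x + y * Complex.I) *
        expMode (ellipticK k) (-m) (x + y * Complex.I)) -
      κ * ∫ x in (-ellipticK k)..(ellipticK k), poleModel (ellipticK k) ρ (x + y * Complex.I) *
        expMode (ellipticK k) (-m) (x + y * Complex.I) := by
    intro y hy hne
    rw [← intervalIntegral.integral_const_mul, ← intervalIntegral.integral_sub
      (h.intervalIntegrable_wellUpper hkk hν hcn hy hne (-m))
      (((continuous_poleModel_line (hexp hne) hρ0 _).const_mul _).intervalIntegrable _ _)]
    exact intervalIntegral.integral_congr fun x _ => by ring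
  rw [hsplit ⟨hY.1, (hY.2.trans hν.2).le⟩ hY.2.ne, hsplit hL hν.2.ne'] at e2
  have e4 : ∫ x in (-ellipticK k)..(ellipticK k),
      wellUpper a d n k k' (x + ellipticK k' * Complex.I) *
        expMode (ellipticK k) (-m) (x + ellipticK k' * Complex.I) =
      Real.exp (m * (π * ellipticK k' / ellipticK k)) *
        (∫ x in (-ellipticK k)..(ellipticK k),
          ((a + (d - a) * ((k * jacobiSn x k) ^ 2 / ((k * jacobiSn x k) ^ 2 - n)) : ℝ) : ℂ) *
            expMode (ellipticK k) (-m) x) := by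
    rw [← intervalIntegral.integral_const_mul]
    refine intervalIntegral.integral_congr fun x _ => ?_
    rw [wellUpper, jacobiNs_add_ellipticK hk' hkk h.hk0 x, expMode_add_mul_I]
    push_cast
    rw [neg_mul, neg_neg]
    ring
  have hκ' : (κ : ℂ) * (2 * ellipticK k * Real.exp (m * (π * ν / ellipticK k)) : ℝ) =
      -(π * √((b - d) * (a - c)) * Real.exp (m * (π * ν / ellipticK k)) : ℝ) := by
    rw [← Complex.ofReal_mul, ← Complex.ofReal_neg, hκ]
    congr 1
    field_simp
  rw [← hκ', ← e3, ← e4, e1]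
  linear_combination e2

/-- The Fourier modes of `a + (d - a) / (1 - n sn²)` over a period. -/
lemma integral_wellPoint_mul_expMode (h : EllipticParams a b c d k n) (hkk : k' ^ 2 = 1 - k ^ 2)
    (hν : ν ∈ Ioo 0 (ellipticK k')) (hcn : jacobiCn ν k' = √((c - d) / (a - d))) {m : ℤ}
    (hm : m ≠ 0) :
    ∫ x in (-ellipticK k)..(ellipticK k),
        (wellPoint a d n (jacobiAm x k) : ℂ) * expMode (ellipticK k) (-m) x =
      (-(π * √((b - d) * (a - c)) * Real.sinh (m * (π * (ellipticK k' - ν) / ellipticK k)) /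
        Real.sinh (m * (π * ellipticK k' / ellipticK k))) : ℝ) := by
  have hk := h.k_sq_lt_one
  have hK := ellipticK_pos hk
  have hL : 0 < ellipticK k' := hν.1.trans hν.2
  have e1 := h.integral_wellPoint_sub hkk hν hcn m
  have e2 := h.integral_wellPoint_sub hkk hν hcn (-m)
  have hA : ∀ x, ((wellPoint a d n (jacobiAm (-x) k) : ℝ) : ℂ) = wellPoint a d n (jacobiAm x k) := by
    intro x
    rw [jacobiAm_neg hk, wellPoint, wellPoint, Real.sin_neg, neg_sq]
  have hB : ∀ x, ((a + (d - a) * ((k * jacobiSn (-x) k) ^ 2 / ((k * jacobiSn (-x) k) ^ 2 - n)) : ℝ)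
      : ℂ) = ((a + (d - a) * ((k * jacobiSn x k) ^ 2 / ((k * jacobiSn x k) ^ 2 - n)) : ℝ) : ℂ) := by
    intro x
    rw [jacobiSn_neg hk, mul_neg, neg_sq]
  -- The unknown integrals on the two lines are the same for `m` and `-m`, so `e2` is a second
  -- equation for the pair in `e1`.
  rw [neg_neg, ← integral_mul_expMode_neg hA, ← integral_mul_expMode_neg (f := fun x =>
    ((a + (d - a) * ((k * jacobiSn x k) ^ 2 / ((k * jacobiSn x k) ^ 2 - n)) : ℝ) : ℂ)) hB] at e2
  have hs : Real.sinh (m * (π * ellipticK k' / ellipticK k)) ≠ 0 := by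
    rw [Ne, Real.sinh_eq_zero]
    have := pi_pos
    positivity
  have hs' : (Real.sinh (m * (π * ellipticK k' / ellipticK k)) : ℂ) ≠ 0 := by exact_mod_cast hs
  set C := ∫ x in (-ellipticK k)..(ellipticK k),
        (wellPoint a d n (jacobiAm x k) : ℂ) * expMode (ellipticK k) (-m) x
  set T := ∫ x in (-ellipticK k)..(ellipticK k),
    ((a + (d - a) * ((k * jacobiSn x k) ^ 2 / ((k * jacobiSn x k) ^ 2 - n)) : ℝ) : ℂ) *
            expMode (ellipticK k) (-m) x
  have hH : m * (π * (ellipticK k' - ν) / ellipticK k) =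
      m * (π * ellipticK k' / ellipticK k) - m * (π * ν / ellipticK k) := by ring
  rw [hH]
  have hm1 : ((-m : ℤ) : ℝ) * (π * ellipticK k' / ellipticK k) =
    -(m * (π * ellipticK k' / ellipticK k)) := by push_cast; ring
  have hm2 : ((-m : ℤ) : ℝ) * (π * ν / ellipticK k) = -(m * (π * ν / ellipticK k)) := by
    push_cast; ring
  rw [hm1, hm2] at e2
  generalize (m : ℝ) * (π * ellipticK k' / ellipticK k) = H at *
  generalize (m : ℝ) * (π * ν / ellipticK k) = η at *
  have hHH : (Real.exp H : ℂ) * Real.exp (-H) = 1 := by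
    rw [← Complex.ofReal_mul, ← Real.exp_add, add_neg_cancel, Real.exp_zero, Complex.ofReal_one]
  rw [Real.sinh_eq H] at hs hs'
  rw [Real.sinh_eq H, Real.sinh_eq, neg_sub, Real.exp_sub, Real.exp_sub, div_eq_mul_inv (Real.exp H),
    div_eq_mul_inv (Real.exp η), ← Real.exp_neg, ← Real.exp_neg]
  push_cast at *
  rw [← neg_div, eq_div_iff hs']
  -- These weights eliminate the integral `T` on the upper line and give `C` the coefficient `sinh
  -- H`.
  linear_combination (-Complex.exp (-H) / 2) * e1 + (Complex.exp H / 2) * e2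

end EllipticParams

/-! ### Summability and pointwise convergence of the cosine series -/

lemma sinh_le_exp_mul_sinh {x y : ℝ} (hxy : x ≤ y) :
    Real.sinh x ≤ Real.exp (x - y) * Real.sinh y := by
  have h : Real.exp (x - y) * Real.sinh y = (Real.exp x - Real.exp (x - 2 * y)) / 2 := by
    rw [Real.sinh_eq, mul_div_assoc', mul_sub, ← Real.exp_add, ← Real.exp_add]
    ring_nf
  rw [h, Real.sinh_eq]
  have : Real.exp (x - 2 * y) ≤ Real.exp (-x) := Real.exp_le_exp.2 (by linarith)
  linarith

/-- The quotients are dominated by the geometric series with ratio `exp(u - v)`. -/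
lemma summable_sinh_div_sinh {u v : ℝ} (hu : 0 < u) (huv : u < v) :
    Summable fun n : ℕ => Real.sinh ((n + 1 : ℝ) * u) / Real.sinh ((n + 1 : ℝ) * v) := by
  have hs : Summable fun n : ℕ => Real.exp ((n : ℝ) * (u - v)) :=
    Real.summable_exp_nat_mul_iff.2 (sub_neg.2 huv)
  have hs' := (summable_nat_add_iff 1).2 hs
  have hv := hu.trans huv
  refine Summable.of_nonneg_of_le (fun n => ?_) (fun n => ?_) hs'
  · exact div_nonneg (Real.sinh_nonneg_iff.2 (by positivity)) (Real.sinh_nonneg_iff.2 (by positivity))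
  · rw [div_le_iff₀ (Real.sinh_pos_iff.2 (by positivity))]
    have := sinh_le_exp_mul_sinh (x := (n + 1 : ℝ) * u) (y := (n + 1 : ℝ) * v) (by gcongr)
    rw [← mul_sub] at this
    push_cast
    exact this

/-- A continuous even function with summable Fourier coefficients is the sum of its cosine series. -/
lemma hasSum_cosine_series {f : ℝ → ℝ} (hf : Continuous f) (hp : Function.Periodic f (2 * π))
    {q : ℤ → ℝ}
    (hq : ∀ m : ℤ, 1 / (2 * (π : ℂ)) * ∫ θ in (0 : ℝ)..(2 * π),
      (f θ : ℂ) * Complex.exp (-(Complex.I * m * θ)) = q m)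
    (heven : ∀ m, q (-m) = q m) (hs : Summable fun n : ℕ => q (n + 1)) (θ : ℝ) :
    HasSum (fun n : ℕ => 2 * q (n + 1) * Real.cos ((n + 1 : ℝ) * θ)) (f θ - q 0) := by
  have : Fact (0 < 2 * π) := ⟨two_pi_pos⟩
  have hpC : Function.Periodic (fun θ => (f θ : ℂ)) (2 * π) := fun θ => by simp only [hp θ]
  have hcont : Continuous hpC.lift :=
    continuous_coinduced_dom.2 (Complex.continuous_ofReal.comp hf)
  set g : C(AddCircle (2 * π), ℂ) := ⟨hpC.lift, hcont⟩ with hg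
  have hcoeff : ∀ m : ℤ, fourierCoeff g m = q m := by
    intro m
    rw [fourierCoeff_eq_intervalIntegral g m 0, ← hq m, zero_add, Complex.real_smul]
    push_cast
    congr 1
    refine intervalIntegral.integral_congr fun x _ => ?_
    simp only [hg, ContinuousMap.coe_mk, Function.Periodic.lift_coe, smul_eq_mul, fourier_coe_apply]
    rw [mul_comm]
    congr 2
    have : (π : ℂ) ≠ 0 := by exact_mod_cast pi_pos.ne'
    push_cast
    field_simp
  have hsum : Summable (fourierCoeff g) := by
    have h1 : Summable fun n : ℕ => q n := (summable_nat_add_iff 1).1 (by push_cast; exact hs)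
    have h2 : Summable q := Summable.of_nat_of_neg h1 (by simpa only [heven] using h1)
    rw [funext hcoeff]
    exact Complex.ofRealCLM.summable h2
  -- Pairing `n` with `-n` counts the zero mode twice; dropping the index `0` afterwards removes
  -- both copies and leaves `f θ - q 0`.
  have h := (has_pointwise_sum_fourier_series_of_summable hsum θ).nat_add_neg
  have h2 := (hasSum_nat_add_iff' 1).2 h
  have hval : g (θ : AddCircle (2 * π)) = f θ := by
    simp only [hg, ContinuousMap.coe_mk, Function.Periodic.lift_coe]
  rw [Finset.sum_range_one, Nat.cast_zero, neg_zero, hcoeff, hval, fourier_zero, smul_eq_mul,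
    mul_one, add_sub_add_right_eq_sub] at h2
  rw [← Complex.hasSum_ofReal]
  rw [Complex.ofReal_sub]
  refine h2.congr_fun fun n => ?_
  rw [hcoeff, hcoeff, heven, ← smul_add, smul_eq_mul, fourier_coe_apply, fourier_coe_apply]
  have hπ : (π : ℂ) ≠ 0 := by exact_mod_cast pi_pos.ne'
  have e1 : 2 * π * Complex.I * ((n + 1 : ℕ) : ℤ) * θ / (2 * π : ℝ) = ((n + 1) * θ) * Complex.I := by
    push_cast
    field_simp
  have e2 : 2 * π * Complex.I * (-((n + 1 : ℕ) : ℤ) : ℤ) * θ / (2 * π : ℝ) =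
      -((n + 1) * θ) * Complex.I := by
    push_cast
    field_simp
  rw [e1, e2]
  push_cast
  have := Complex.two_cos ((n + 1) * θ)
  linear_combination (q (n + 1) : ℂ) * this

namespace EllipticParams

variable {a b c d k n : ℝ}

/-- The mean value: the substitution `x = F(φ, k)` turns the two terms of `wellPoint` into the
integrands of `K` and `Π`. -/
lemma integral_wellPoint_jacobiAm (h : EllipticParams a b c d k n) :
    ∫ x in (-ellipticK k)..(ellipticK k), wellPoint a d n (jacobiAm x k) =
      2 * (a * ellipticK k + (d - a) * ellipticPi n k) := by
  have hk := h.k_sq_lt_one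
  have hc : Continuous fun x => wellPoint a d n (jacobiAm x k) :=
    h.continuous_wellPoint.comp (continuous_jacobiAm hk)
  have hneg : ∫ x in (-ellipticK k)..0, wellPoint a d n (jacobiAm x k) =
      ∫ x in (0 : ℝ)..(ellipticK k), wellPoint a d n (jacobiAm x k) := by
    have := intervalIntegral.integral_comp_neg (a := 0) (b := ellipticK k)
      fun x => wellPoint a d n (jacobiAm x k)
    rw [neg_zero] at this
    rw [← this]
    refine intervalIntegral.integral_congr fun x _ => ?_
    simp only [jacobiAm_neg hk, wellPoint, Real.sin_neg, neg_sq]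
  have hsub := intervalIntegral.integral_comp_mul_deriv (a := 0) (b := π / 2)
    (f := fun φ => ellipticF φ k) (f' := fun φ => 1 / √(1 - k ^ 2 * sin φ ^ 2))
    (g := fun x => wellPoint a d n (jacobiAm x k)) (fun φ _ => hasDerivAt_ellipticF hk φ)
    (continuous_ellipticF_integrand hk).continuousOn hc
  rw [ellipticF_zero, ← ellipticK] at hsub
  have hden : Continuous fun φ => 1 / ((1 - n * sin φ ^ 2) * √(1 - k ^ 2 * sin φ ^ 2)) := by
    refine continuous_const.div (by fun_prop) fun φ => (mul_pos (h.denom_pos _) ?_).ne'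
    exact Real.sqrt_pos.2 (one_sub_sq_mul_sin_sq_pos hk φ)
  rw [← intervalIntegral.integral_add_adjacent_intervals (hc.intervalIntegrable _ 0)
    (hc.intervalIntegrable _ _), hneg, ← hsub, ← two_mul, ellipticK, ellipticF, ellipticPi,
    ← intervalIntegral.integral_const_mul a, ← intervalIntegral.integral_const_mul (d - a),
    ← intervalIntegral.integral_add
      (((continuous_ellipticF_integrand hk).const_mul a).intervalIntegrable _ _)
      ((hden.const_mul _).intervalIntegrable _ _)]
  congr 1
  refine intervalIntegral.integral_congr fun φ _ => ?_
  simp only [Function.comp, jacobiAm_ellipticF hk, wellPoint]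
  rw [add_mul, ← one_div_mul_one_div, div_eq_mul_one_div (d - a), mul_assoc]

end EllipticParams

/-! ### Fourier coefficients of the position -/

namespace IsWellEnergy

variable {α β E : ℝ}

/-- By periodicity the interval is moved to `[-π, π]`, then `x = Kθ/π` rescales it to the symmetric
rectangle base `[-K, K]`. -/
lemma fourierQ_eq_integral (h : IsWellEnergy α β E) (m : ℤ) :
    fourierQ α β m E = 1 / (2 * ellipticK (modulus α β E)) *
      ∫ x in (-ellipticK (modulus α β E))..(ellipticK (modulus α β E)),
        (wellPoint (rootA α β E) (rootD α β E) (gammaSq α β E) (jacobiAm x (modulus α β E)) : ℂ) *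
          expMode (ellipticK (modulus α β E)) (-m) x := by
  have hK := ellipticK_pos h.params.k_sq_lt_one
  set K := ellipticK (modulus α β E) with hKdef
  have hπ := pi_pos.ne'
  have hπC : (π : ℂ) ≠ 0 := by exact_mod_cast hπ
  have hKC : (K : ℂ) ≠ 0 := by exact_mod_cast hK.ne'
  have hper : Function.Periodic (fun θ => (position α β E θ : ℂ) *
      Complex.exp (-(Complex.I * m * θ))) (2 * π) := by
    intro θ
    simp only [h.periodic_position θ]
    congr 1
    rw [Complex.exp_eq_exp_iff_exists_int]
    refine ⟨-m, ?_⟩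
    push_cast
    ring
  have h3 := hper.intervalIntegral_add_eq 0 (-π)
  rw [zero_add, show -π + 2 * π = π by ring] at h3
  have h2 := intervalIntegral.integral_comp_mul_left (a := -π) (b := π)
    (fun x : ℝ => (wellPoint (rootA α β E) (rootD α β E) (gammaSq α β E)
      (jacobiAm x (modulus α β E)) : ℂ) * expMode K (-m) x) (div_ne_zero hK.ne' hπ)
  rw [show K / π * -π = -K by field_simp, show K / π * π = K by field_simp] at h2
  rw [fourierQ, h3]
  have h4 : ∀ θ : ℝ, (position α β E θ : ℂ) * Complex.exp (-(Complex.I * m * θ)) =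
      (wellPoint (rootA α β E) (rootD α β E) (gammaSq α β E)
      (jacobiAm (K / π * θ) (modulus α β E)) : ℂ) * expMode K (-m) (K / π * θ : ℝ) := by
    intro θ
    rw [position_eq, expMode]
    congr 2
    push_cast
    field_simp
  simp only [h4]
  rw [h2, Complex.real_smul]
  push_cast
  field_simp

lemma sqrt_ratio_mem (h : IsWellEnergy α β E) :
    √((rootC α β E - rootD α β E) / (rootA α β E - rootD α β E)) ∈ Ioo 0 1 := by
  have h1 := h.params.cd_pos
  have h2 := h.params.ad_pos
  refine ⟨Real.sqrt_pos.2 (div_pos h1 h2), ?_⟩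
  rw [Real.sqrt_lt' one_pos, one_pow, div_lt_one h2]
  linarith [h.params.ac_pos]

lemma nu_eq (h : IsWellEnergy α β E) : nu α β E =
    ellipticF (arccos √((rootC α β E - rootD α β E) / (rootA α β E - rootD α β E)))
      (coModulus α β E) :=
  arcCn_eq_ellipticF_arccos h.coModulus_sq_lt_one h.sqrt_ratio_mem

lemma nu_mem (h : IsWellEnergy α β E) : nu α β E ∈ Ioo 0 (ellipticK (coModulus α β E)) := by
  rw [h.nu_eq]
  exact (jacobiCn_ellipticF_arccos h.coModulus_sq_lt_one h.sqrt_ratio_mem).1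

lemma jacobiCn_nu (h : IsWellEnergy α β E) : jacobiCn (nu α β E) (coModulus α β E) =
    √((rootC α β E - rootD α β E) / (rootA α β E - rootD α β E)) := by
  rw [h.nu_eq]
  exact (jacobiCn_ellipticF_arccos h.coModulus_sq_lt_one h.sqrt_ratio_mem).2

lemma omega_pos (h : IsWellEnergy α β E) : 0 < omega α β E := by
  have hK := ellipticK_pos h.params.k_sq_lt_one
  exact div_pos (mul_pos pi_pos (sub_pos.2 h.nu_mem.2)) (by positivity)

lemma omega_lt_omegaZero (h : IsWellEnergy α β E) : omega α β E < omegaZero α β E := by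
  have hK := ellipticK_pos h.params.k_sq_lt_one
  have := h.nu_mem.1
  have := pi_pos
  unfold omega omegaZero
  gcongr
  linarith

lemma fourierQ_of_ne_zero (h : IsWellEnergy α β E) {m : ℤ} (hm : m ≠ 0) :
    fourierQ α β m E =
      (-(π * √((rootB α β E - rootD α β E) * (rootA α β E - rootC α β E)) /
        (2 * ellipticK (modulus α β E))) * (Real.sinh (m * (2 * omega α β E)) /
          Real.sinh (m * (2 * omegaZero α β E))) : ℝ) := by
  have hK := ellipticK_pos h.params.k_sq_lt_one
  have e1 : 2 * omega α β E = π * (ellipticK (coModulus α β E) - nu α β E) /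
      ellipticK (modulus α β E) := by unfold omega; field_simp
  have e2 : 2 * omegaZero α β E = π * ellipticK (coModulus α β E) /
      ellipticK (modulus α β E) := by unfold omegaZero; field_simp
  rw [h.fourierQ_eq_integral, h.params.integral_wellPoint_mul_expMode h.coModulus_sq h.nu_mem
    h.jacobiCn_nu hm, e1, e2]
  push_cast
  ring

lemma fourierQ_zero (h : IsWellEnergy α β E) :
    fourierQ α β 0 E = (rootA α β E + (rootD α β E - rootA α β E) *
      ellipticPi (gammaSq α β E) (modulus α β E) / ellipticK (modulus α β E) : ℝ) := by
  have hK := (ellipticK_pos h.params.k_sq_lt_one).ne'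
  have hKC : (ellipticK (modulus α β E) : ℂ) ≠ 0 := by exact_mod_cast hK
  rw [h.fourierQ_eq_integral]
  simp only [neg_zero, expMode_zero, mul_one]
  rw [intervalIntegral.integral_ofReal, h.params.integral_wellPoint_jacobiAm]
  push_cast
  field_simp

lemma hasSum_position (h : IsWellEnergy α β E) (θ : ℝ) :
    HasSum (fun n : ℕ => -(π * √((rootB α β E - rootD α β E) * (rootA α β E - rootC α β E)) /
        ellipticK (modulus α β E)) * (Real.sinh (2 * ((n : ℝ) + 1) * omega α β E) /
          Real.sinh (2 * ((n : ℝ) + 1) * omegaZero α β E) * Real.cos (((n : ℝ) + 1) * θ)))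
      (position α β E θ - (rootA α β E + (rootD α β E - rootA α β E) *
        ellipticPi (gammaSq α β E) (modulus α β E) / ellipticK (modulus α β E))) := by
  set A := -(π * √((rootB α β E - rootD α β E) * (rootA α β E - rootC α β E)) /
        (2 * ellipticK (modulus α β E))) with hA
  -- The zero mode is separate because the quotient of hyperbolic sines degenerates to `0 / 0` at `m
  -- = 0`.
  set q : ℤ → ℝ := fun m => if m = 0 then rootA α β E + (rootD α β E - rootA α β E) *
        ellipticPi (gammaSq α β E) (modulus α β E) / ellipticK (modulus α β E)
    else A * (Real.sinh (m * (2 * omega α β E)) / Real.sinh (m * (2 * omegaZero α β E))) with hq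
  have hq1 : ∀ n : ℕ, q (n + 1) = A * (Real.sinh ((n + 1 : ℝ) * (2 * omega α β E)) /
      Real.sinh ((n + 1 : ℝ) * (2 * omegaZero α β E))) := by
    intro n
    rw [hq]
    simp only
    rw [if_neg (by omega)]
    push_cast
    rfl
  have key := hasSum_cosine_series h.continuous_position h.periodic_position (q := q)
    (fun m => ?_) (fun m => ?_) ?_ θ
  · convert key using 1
    · funext n
      rw [hq1, hA, show 2 * ((n : ℝ) + 1) * omega α β E = (n + 1 : ℝ) * (2 * omega α β E) by ring,
        show 2 * ((n : ℝ) + 1) * omegaZero α β E = (n + 1 : ℝ) * (2 * omegaZero α β E) by ring]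
      ring
    · rw [hq]
      simp
  · change fourierQ α β m E = _
    by_cases hm : m = 0
    · rw [hm, h.fourierQ_zero, hq]
      simp
    · rw [h.fourierQ_of_ne_zero hm, hq]
      simp [hm, hA]
  · simp only [hq, neg_eq_zero, Int.cast_neg, neg_mul, Real.sinh_neg, neg_div_neg_eq]
  · simp only [hq1]
    exact (summable_sinh_div_sinh (by linarith [h.omega_pos])
      (by linarith [h.omega_lt_omegaZero])).mul_left A

lemma fourierQ_one (h : IsWellEnergy α β E) : fourierQ α β 1 E = (-G α β E : ℝ) := by
  rw [h.fourierQ_of_ne_zero one_ne_zero, G, Int.cast_one, one_mul, one_mul]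
  congr 1
  ring

end IsWellEnergy

/-! ### Regularity of `G` and the three forms of the first integral -/

namespace IsWellEnergy

variable {α β E : ℝ}

lemma differentiableAt_nu (h : IsWellEnergy α β E) : DifferentiableAt ℝ (nu α β) E := by
  have hx := h.sqrt_ratio_mem
  have hr : DifferentiableAt ℝ (fun ξ => arccos
      √((rootC α β ξ - rootD α β ξ) / (rootA α β ξ - rootD α β ξ))) E := by
    refine DifferentiableAt.comp (g := arccos) E (differentiableAt_arccos.2
      ⟨by linarith [hx.1], hx.2.ne⟩) (DifferentiableAt.sqrt ?_ ?_)
    · exact (h.differentiableAt_rootC.sub h.differentiableAt_rootD).fun_div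
        (h.differentiableAt_rootA.sub h.differentiableAt_rootD) h.params.ad_pos.ne'
    · exact (div_pos h.params.cd_pos h.params.ad_pos).ne'
  refine (differentiableAt_ellipticF_comp hr h.differentiableAt_coModulus
    h.coModulus_sq_lt_one).congr_of_eventuallyEq ?_
  exact h.eventually.mono fun ξ hξ => hξ.nu_eq

lemma differentiableAt_G (h : IsWellEnergy α β E) : DifferentiableAt ℝ (G α β) E := by
  have hK := differentiableAt_ellipticK_comp h.differentiableAt_modulus h.params.k_sq_lt_one
  have hK' := differentiableAt_ellipticK_comp h.differentiableAt_coModulus h.coModulus_sq_lt_one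
  have hKp := ellipticK_pos h.params.k_sq_lt_one
  have hω : DifferentiableAt ℝ (omega α β) E :=
    ((hK'.sub h.differentiableAt_nu).const_mul π).fun_div (hK.const_mul 2) (by positivity)
  have hω0 : DifferentiableAt ℝ (omegaZero α β) E :=
    (hK'.const_mul π).fun_div (hK.const_mul 2) (by positivity)
  have hs : 0 < sinh (2 * omegaZero α β E) :=
    Real.sinh_pos_iff.2 (by linarith [h.omega_pos, h.omega_lt_omegaZero])
  refine DifferentiableAt.fun_div (DifferentiableAt.fun_mul (DifferentiableAt.const_mul
    (DifferentiableAt.sqrt ?_ ?_) π) (hω.const_mul 2).sinh)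
    ((hK.const_mul 2).fun_mul (hω0.const_mul 2).sinh) (by positivity)
  · exact (h.differentiableAt_rootB.sub h.differentiableAt_rootD).fun_mul
      (h.differentiableAt_rootA.sub h.differentiableAt_rootC)
  · exact (mul_pos h.params.bd_pos h.params.ac_pos).ne'

lemma eventually_energyOfAction (h : IsWellEnergy α β E) :
    ∀ᶠ J in 𝓝 (action α β E), IsWellEnergy α β (energyOfAction α β J) := by
  have hc := h.hasDerivAt_energyOfAction.continuousAt
  rw [ContinuousAt, h.energyOfAction_action] at hc
  exact hc.eventually h.eventually

lemma hasDerivAt_firstCoeffOfAction (h : IsWellEnergy α β E) :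
    HasDerivAt (firstCoeffOfAction α β)
      (-(deriv (G α β) E * deriv (energyOfAction α β) (action α β E)) : ℝ) (action α β E) := by
  rw [h.hasDerivAt_energyOfAction.deriv]
  refine (h.hasDerivAt_comp_energyOfAction h.differentiableAt_G.hasDerivAt).neg.ofReal_comp
    |>.congr_of_eventuallyEq ?_
  exact h.eventually_energyOfAction.mono fun J hJ => hJ.fourierQ_one

/-- Stating the derivative as the reciprocal of `H₀'` lets the term `Ω J(H₀(J))` contribute exactly
`Ω` along the slow flow. -/
lemma hasDerivAt_actionClosedForm (h : IsWellEnergy α β E) :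
    HasDerivAt (actionClosedForm α β) (deriv (energyOfAction α β) (action α β E))⁻¹ E := by
  rw [h.hasDerivAt_energyOfAction.deriv, inv_inv]
  refine h.hasDerivAt_action.congr_of_eventuallyEq ?_
  exact h.eventually.mono fun ξ hξ => (action_eq_actionClosedForm hξ.hβ hξ.ordered).symm

lemma firstIntegral_eq_fourierQ (h : IsWellEnergy α β E) (F Ω ϑ : ℝ) :
    (firstIntegral α β F Ω ϑ E : ℂ) = (E : ℂ) - Complex.I * F / 2 *
      (fourierQ α β 1 E * Complex.exp (Complex.I * ϑ) -
        star (fourierQ α β 1 E) * Complex.exp (-(Complex.I * ϑ))) - Ω * action α β E := by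
  have hs := Complex.two_sin ϑ
  rw [show -(ϑ : ℂ) * Complex.I = -(Complex.I * ϑ) by ring, mul_comm (ϑ : ℂ)] at hs
  rw [h.fourierQ_one, Complex.star_def, Complex.conj_ofReal, firstIntegral,
    action_eq_actionClosedForm h.hβ h.ordered]
  push_cast
  linear_combination (-(F * G α β E / 2 : ℂ)) * hs

/-- Real and imaginary parts of the formula for `q₁`, which is real. -/
lemma integral_position_mul_cos_sin (h : IsWellEnergy α β E) :
    ∫ θ in (0 : ℝ)..(2 * π), position α β E θ * cos θ = -(2 * π * G α β E) ∧
      ∫ θ in (0 : ℝ)..(2 * π), position α β E θ * sin θ = 0 := by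
  have hq := h.continuous_position
  have hπ := pi_pos.ne'
  have e := h.fourierQ_one
  have hint : ∫ θ in (0 : ℝ)..(2 * π), (position α β E θ : ℂ) *
      Complex.exp (-(Complex.I * (1 : ℤ) * θ)) =
      ((∫ θ in (0 : ℝ)..(2 * π), position α β E θ * cos θ : ℝ) : ℂ) -
        (∫ θ in (0 : ℝ)..(2 * π), position α β E θ * sin θ : ℝ) * Complex.I := by
    rw [← intervalIntegral.integral_ofReal, ← intervalIntegral.integral_ofReal,
      ← intervalIntegral.integral_mul_const, ← intervalIntegral.integral_sub
        (Continuous.intervalIntegrable (by fun_prop) _ _)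
        (Continuous.intervalIntegrable (by fun_prop) _ _)]
    refine intervalIntegral.integral_congr fun θ _ => ?_
    rw [show -(Complex.I * (1 : ℤ) * θ) = (-θ : ℂ) * Complex.I by push_cast; ring, Complex.exp_mul_I,
      Complex.cos_neg, Complex.sin_neg]
    push_cast
    ring
  rw [fourierQ, hint] at e
  have hπC : (π : ℂ) ≠ 0 := by exact_mod_cast hπ
  have e2 : ((∫ θ in (0 : ℝ)..(2 * π), position α β E θ * cos θ : ℝ) : ℂ) -
        (∫ θ in (0 : ℝ)..(2 * π), position α β E θ * sin θ : ℝ) * Complex.I =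
        (-(2 * π * G α β E) : ℝ) := by
    field_simp at e
    rw [e]
    push_cast
    ring
  have hre := congrArg Complex.re e2
  have him := congrArg Complex.im e2
  rw [Complex.sub_re, Complex.ofReal_re, Complex.re_ofReal_mul, Complex.I_re, mul_zero, sub_zero,
    Complex.ofReal_re] at hre
  rw [Complex.sub_im, Complex.ofReal_im, Complex.im_ofReal_mul, Complex.I_im, mul_one, zero_sub,
    Complex.ofReal_im, neg_eq_zero] at him
  exact ⟨hre, him⟩

/-- Translating by `ϑ` within a period and expanding `sin(ψ - ϑ)` leaves only the cosine moment of
the position. -/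
lemma integral_position_add_mul_sin (h : IsWellEnergy α β E) (ϑ : ℝ) :
    ∫ φ in (0 : ℝ)..(2 * π), position α β E (ϑ + φ) * sin φ = 2 * π * G α β E * sin ϑ := by
  have hq := h.continuous_position
  obtain ⟨hc, hs⟩ := h.integral_position_mul_cos_sin
  have hper : Function.Periodic (fun ψ => position α β E ψ * sin (ψ - ϑ)) (2 * π) := fun ψ => by
    simp only [h.periodic_position ψ]
    rw [add_sub_right_comm, sin_add_two_pi]
  have h1 := intervalIntegral.integral_comp_add_left (a := 0) (b := 2 * π)
    (fun ψ => position α β E ψ * sin (ψ - ϑ)) ϑ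
  have h2 := hper.intervalIntegral_add_eq ϑ 0
  rw [zero_add] at h2
  simp only [add_sub_cancel_left] at h1
  rw [h1, add_zero, h2]
  simp only [sin_sub, mul_sub, ← mul_assoc]
  rw [intervalIntegral.integral_sub (Continuous.intervalIntegrable (by fun_prop) _ _)
    (Continuous.intervalIntegrable (by fun_prop) _ _), intervalIntegral.integral_mul_const,
    intervalIntegral.integral_mul_const, hc, hs]
  ring

lemma firstIntegral_eq_average (h : IsWellEnergy α β E) (F Ω ϑ : ℝ) :
    firstIntegral α β F Ω ϑ E = 1 / (2 * π) * (∫ φ in (0 : ℝ)..(2 * π),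
      (E - F * position α β E (ϑ + φ) * sin φ)) - Ω * action α β E := by
  have hq := h.continuous_position
  have hπ := pi_pos.ne'
  simp only [mul_assoc F]
  rw [intervalIntegral.integral_sub (Continuous.intervalIntegrable (by fun_prop) _ _)
    (Continuous.intervalIntegrable (by fun_prop) _ _), intervalIntegral.integral_const_mul,
    h.integral_position_add_mul_sin, intervalIntegral.integral_const, smul_eq_mul, firstIntegral,
    action_eq_actionClosedForm h.hβ h.ordered]
  field_simp
  ring

end IsWellEnergy

/-! ### Conservation along the slow flow -/

lemma firstIntegral_const {α β F Ω : ℝ} (hα : α < 0) (hβ : 0 < β) (hβα : β < 2 * α ^ 2 / 9)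
    {T : Set ℝ} {J ϑ : ℝ → ℝ} (hT : T.OrdConnected) (h : IsSlowFlowSolution α β F Ω T J ϑ) :
    ∃ C₀ : ℝ, ∀ t ∈ T, firstIntegral α β F Ω (ϑ t) (energyOfAction α β (J t)) = C₀ := by
  have hd : ∀ t ∈ T, HasDerivWithinAt
      (fun t => firstIntegral α β F Ω (ϑ t) (energyOfAction α β (J t))) 0 T t := by
    intro t ht
    obtain ⟨⟨E, hE, hEJ⟩, J₁, ϑ₁, hJ, hϑ, e1, e2⟩ := h t ht
    have hw : IsWellEnergy α β E := ⟨hα, hβ, hβα, hE⟩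
    have hH := hw.hasDerivAt_energyOfAction
    have hH0 : deriv (energyOfAction α β) (action α β E) ≠ 0 := by
      rw [hH.deriv]
      exact inv_ne_zero hw.deriv_action_pos.ne'
    have hH := hH.differentiableAt.hasDerivAt
    have hC := hw.hasDerivAt_actionClosedForm
    have hGd := hw.differentiableAt_G.hasDerivAt
    have hq : firstCoeffOfAction α β (J t) = (-G α β E : ℝ) := by
      rw [firstCoeffOfAction, ← hEJ, hw.energyOfAction_action, hw.fourierQ_one]
    have hq' : deriv (firstCoeffOfAction α β) (J t) =
        (-(deriv (G α β) E * deriv (energyOfAction α β) (J t)) : ℝ) := by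
      rw [← hEJ, hw.hasDerivAt_firstCoeffOfAction.deriv]
    have hEt : energyOfAction α β (J t) = E := by rw [← hEJ, hw.energyOfAction_action]
    rw [hEJ] at hH hH0 hC
    generalize deriv (energyOfAction α β) (J t) = W at *
    generalize deriv (G α β) E = g at *
    rw [hq, Complex.star_def, Complex.conj_ofReal] at e1
    rw [hq', Complex.star_def, Complex.conj_ofReal] at e2
    have hs := Complex.two_sin (ϑ t)
    have hc := Complex.two_cos (ϑ t)
    rw [show -(ϑ t : ℂ) * Complex.I = -(Complex.I * ϑ t) by ring, mul_comm (ϑ t : ℂ)] at hs hc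
    have e1' : J₁ = F * G α β E * cos (ϑ t) := by
      have : (J₁ : ℂ) = (F * G α β E * cos (ϑ t) : ℝ) := by
        rw [e1]
        push_cast
        linear_combination (-(F * G α β E / 2 : ℂ)) * hc
      exact_mod_cast this
    have e2' : ϑ₁ = W - F * (g * W) * sin (ϑ t) - Ω := by
      have : (ϑ₁ : ℂ) = (W - F * (g * W) * sin (ϑ t) - Ω : ℝ) := by
        rw [e2]
        push_cast
        linear_combination (F * (g * W) / 2 : ℂ) * hs
      exact_mod_cast this
    have hξ : HasDerivWithinAt (fun t => energyOfAction α β (J t)) (W * J₁) T t :=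
      hH.comp_hasDerivWithinAt t hJ
    have hG1 : HasDerivWithinAt (fun t => G α β (energyOfAction α β (J t))) (g * (W * J₁)) T t :=
      HasDerivAt.comp_hasDerivWithinAt (h₂ := G α β) t (by rwa [hEt]) hξ
    have hC1 : HasDerivWithinAt (fun t => actionClosedForm α β (energyOfAction α β (J t)))
        (W⁻¹ * (W * J₁)) T t :=
      HasDerivAt.comp_hasDerivWithinAt (h₂ := actionClosedForm α β) t (by rwa [hEt]) hξ
    -- With `J' = F G cos ϑ = -∂C/∂ϑ` and `ϑ' = W - F g W sin ϑ - Ω = ∂C/∂J`, the two contributions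
    -- to the derivative of `C` cancel.
    refine ((hξ.sub ((hG1.const_mul F).mul hϑ.sin)).sub (hC1.const_mul Ω)).congr_deriv ?_
    rw [hEt, inv_mul_cancel_left₀ hH0, e2']
    linear_combination (W - F * (g * W) * sin (ϑ t) - Ω) * e1'
  rcases T.eq_empty_or_nonempty with rfl | ⟨t₀, ht₀⟩
  · exact ⟨0, fun t ht => ht.elim⟩
  · refine ⟨firstIntegral α β F Ω (ϑ t₀) (energyOfAction α β (J t₀)), fun t ht => ?_⟩
    -- An order-connected set of reals is convex, so the mean value inequality with constant `0`
    -- applies, including at endpoints belonging to `T`.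
    have := Convex.norm_image_sub_le_of_norm_hasDerivWithin_le (C := 0) hd
      (fun _ _ => norm_zero.le) hT.convex ht₀ ht
    rw [zero_mul] at this
    exact sub_eq_zero.1 (norm_le_zero_iff.1 this)

end QuarticWell

theorem mainTheorem1 (α β : ℝ) (hα : α < 0) (hβ : 0 < β) (hβα : β < 2 * α ^ 2 / 9) :
    0 < EMax α β ∧
    -- the four ordered roots; the shallow well is `[d, c]`
    (∀ E ∈ Set.Ioo 0 (EMax α β),
      rootB α β E < rootA α β E ∧
      qThres α β < rootB α β E ∧
      rootC α β E < qThres α β ∧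
      0 < rootC α β E ∧ rootD α β E < 0 ∧
      ∀ q : ℝ, E - V α β q =
        β / 4 * ((rootA α β E - q) * (rootB α β E - q) *
          (rootC α β E - q) * (q - rootD α β E))) ∧
    -- elliptic parameters
    (∀ E ∈ Set.Ioo 0 (EMax α β),
      modulus α β E ∈ Set.Ioo 0 1 ∧ gammaSq α β E < 0 ∧
      ∃! ν : ℝ, ν ∈ Set.Ioo 0 (ellipticK (coModulus α β E)) ∧
        jacobiCn ν (coModulus α β E) =
          √((rootC α β E - rootD α β E) /
            (rootA α β E - rootD α β E))) ∧
    -- the action in closed form, and the frequency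
    (∀ E ∈ Set.Ioo 0 (EMax α β),
      action α β E = actionClosedForm α β E ∧
      HasDerivAt (action α β)
        (2 / Real.pi * √(2 / (β * crossProd α β E)) *
          ellipticK (modulus α β E)) E) ∧
    StrictMonoOn (action α β) (Set.Ioo 0 (EMax α β)) ∧
    -- the angle variable on the two branches of the closed level curve
    (∀ E ∈ Set.Ioo 0 (EMax α β), ∀ q p : ℝ,
      hamiltonian α β q p = E →
      q ∈ Set.Ioo (rootD α β E) (rootC α β E) →
      (0 < p → IsAngle α β q p
        (Real.pi * ellipticF (amplitude α β E q)
            (modulus α β E) /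
          ellipticK (modulus α β E))) ∧
      (p < 0 → IsAngle α β q p
        (2 * Real.pi - Real.pi * ellipticF (amplitude α β E q)
            (modulus α β E) /
          ellipticK (modulus α β E)))) ∧
    -- the inverse transformation
    (∀ E ∈ Set.Ioo 0 (EMax α β),
      Function.Periodic (position α β E) (2 * Real.pi) ∧
      position α β E 0 = rootD α β E ∧
      position α β E Real.pi = rootC α β E ∧
      Set.BijOn (position α β E) (Set.Icc 0 Real.pi)
        (Set.Icc (rootD α β E) (rootC α β E)) ∧
      Set.BijOn (position α β E) (Set.Icc Real.pi (2 * Real.pi))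
        (Set.Icc (rootD α β E) (rootC α β E)) ∧
      (∀ θ ∈ Set.Ioo 0 Real.pi,
        IsAngle α β (position α β E θ)
          (momentum α β E (position α β E θ)) θ) ∧
      ∀ θ ∈ Set.Ioo Real.pi (2 * Real.pi),
        IsAngle α β (position α β E θ)
          (-momentum α β E (position α β E θ)) θ) ∧
    -- the Fourier expansion and the first coefficient
    (∀ E ∈ Set.Ioo 0 (EMax α β),
      (∀ θ : ℝ, HasSum
        (fun n : ℕ =>
          -(Real.pi * √((rootB α β E - rootD α β E) *
              (rootA α β E - rootC α β E)) /
            ellipticK (modulus α β E)) *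
          (Real.sinh (2 * ((n : ℝ) + 1) * omega α β E) /
            Real.sinh (2 * ((n : ℝ) + 1) * omegaZero α β E) *
            Real.cos (((n : ℝ) + 1) * θ)))
        (position α β E θ -
          (rootA α β E +
            (rootD α β E - rootA α β E) *
              ellipticPi (gammaSq α β E) (modulus α β E) /
              ellipticK (modulus α β E)))) ∧
      fourierQ α β 1 E =
        ((-(Real.pi * √((rootB α β E - rootD α β E) *
              (rootA α β E - rootC α β E)) *
            Real.sinh (2 * omega α β E)) /
          (2 * ellipticK (modulus α β E) *
            Real.sinh (2 * omegaZero α β E)) : ℝ) : ℂ)) ∧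
    -- the slow flow is made of differentiable functions of the action
    DifferentiableOn ℝ (energyOfAction α β)
      (action α β '' Set.Ioo 0 (EMax α β)) ∧
    DifferentiableOn ℝ (firstCoeffOfAction α β)
      (action α β '' Set.Ioo 0 (EMax α β)) ∧
    -- the first integral
    ∀ F Ω : ℝ,
      (∀ ξ ∈ Set.Ioo 0 (EMax α β), ∀ ϑ : ℝ,
        (firstIntegral α β F Ω ϑ ξ : ℂ) =
          (ξ : ℂ) - Complex.I * F / 2 *
            (fourierQ α β 1 ξ * Complex.exp (Complex.I * ϑ) -
              star (fourierQ α β 1 ξ) * Complex.exp (-(Complex.I * ϑ))) -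
            Ω * action α β ξ ∧
        firstIntegral α β F Ω ϑ ξ =
          1 / (2 * Real.pi) * (∫ φ in (0 : ℝ)..(2 * Real.pi),
            (ξ - F * position α β ξ (ϑ + φ) * Real.sin φ)) -
            Ω * action α β ξ) ∧
      ∀ (T : Set ℝ) (J ϑ : ℝ → ℝ), T.OrdConnected →
        IsSlowFlowSolution α β F Ω T J ϑ →
        ∃ C₀ : ℝ, ∀ t ∈ T,
          firstIntegral α β F Ω (ϑ t) (energyOfAction α β (J t)) = C₀ := by
  have hw : ∀ {E}, E ∈ Set.Ioo 0 (EMax α β) → IsWellEnergy α β E := fun hE => ⟨hα, hβ, hβα, hE⟩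
  refine ⟨(qThres_spec hα hβ hβα).2.2.2, fun E hE => ?_, fun E hE => ?_, fun E hE => ?_,
    IsWellEnergy.strictMonoOn_action hα hβ hβα, fun E hE q p hqp hq => ?_, fun E hE => ?_,
    fun E hE => ?_, ?_, ?_, fun F Ω => ⟨fun ξ hξ ϑ => ?_, fun T J ϑ hT hsol => ?_⟩⟩
  · obtain ⟨ho, h1, h2, h3, h4⟩ := isOrderedRoots_roots hα hβ hβα hE
    exact ⟨ho.hab, h1, h2, h3, h4, ho.sub_V⟩
  · have h := hw hE
    exact ⟨⟨h.params.hk0, h.params.k_lt_one⟩, h.params.n_neg,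
      existsUnique_jacobiCn_eq h.coModulus_sq_lt_one h.sqrt_ratio_mem⟩
  · have h := hw hE
    refine ⟨action_eq_actionClosedForm hβ h.ordered, h.hasDerivAt_action.congr_deriv ?_⟩
    rw [h.timeScale_eq]
    ring
  · exact ⟨(hw hE).isAngle_of_pos hqp hq, (hw hE).isAngle_of_neg hqp hq⟩
  · have h := hw hE
    exact ⟨h.periodic_position, h.position_zero, h.position_pi, h.bijOn_position,
      h.bijOn_position', fun θ hθ => h.isAngle_position hθ, fun θ hθ => h.isAngle_position' hθ⟩
  · refine ⟨(hw hE).hasSum_position, ?_⟩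
    rw [(hw hE).fourierQ_one, G, neg_div]
  · rintro _ ⟨E, hE, rfl⟩
    exact (hw hE).hasDerivAt_energyOfAction.differentiableAt.differentiableWithinAt
  · rintro _ ⟨E, hE, rfl⟩
    exact (hw hE).hasDerivAt_firstCoeffOfAction.differentiableAt.differentiableWithinAt
  · exact ⟨(hw hξ).firstIntegral_eq_fourierQ F Ω ϑ, (hw hξ).firstIntegral_eq_average F Ω ϑ⟩
  · exact firstIntegral_const hα hβ hβα hT hsol
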